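/- Let $n\ge 2$ and $0\le\kappa\le n$ be integers, with $\kappa\ne 1$ when $n=2$. Equip $\mathbf R^{2n}$, with coordinates $(x_1,\dots,x_n,y_1,\dots,y_n)$, with the symplectic form $\omega=dx_1\wedge dy_1+\dots+dx_n\wedge dy_n$. Then there are complex numbers $\lambda_1,\dots,\lambda_n$ such that (a) $\lambda_j$ is purely imaginary precisely when $1\le j\le\kappa$, and the family $(\lambda_k)_{\kappa<k\le n}$ is closed under complex conjugation; (b) $\lambda_1,\dots,\lambda_n$ are non-resonant: $\lambda_1\alpha_1+\dots+\lambda_n\alpha_n\ne 0$ for all $\alpha\in\mathbf Z^n\setminus\{0\}$; and there is a real-valued real analytic function $h$, defined near $0\in\mathbf R^{2n}$, of the form $$h(x,y)=\frac12\sum_{1\le j\le\kappa} i\lambda_j(x_j^2+y_j^2)+\frac12\,\mathrm{Re}\sum_{\kappa<k,l\le n,\ \lambda_l=\overline{\lambda_k}}\lambda_k(x_k+ix_l)(y_k-iy_l)+O(3),$$ such that the Birkhoff normal form of $h$ is divergent. Here a Birkhoff normal form of $h$ is a real formal power series $\hat h$ with $\hat h=h\circ\varphi^{-1}$ for some formal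 symplectic transformation $\varphi$ of $\mathbf R^{2n}$ fixing $0$, such that $\hat h$ is a formal power series in the quantities $x_j^2+y_j^2$ $(1\le j\le\kappa)$ and $(x_k+ix_l)(y_k-iy_l)$ $(\kappa<k,l\le n,\ \lambda_l=\overline{\lambda_k})$. That the Birkhoff normal form of $h$ is divergent means that $h$ has a Birkhoff normal form and that none of its Birkhoff normal forms converges in a neighbourhood of $0$. -/

import Mathlib

open scoped Topology Matrix ComplexConjugate
open Asymptotics

namespace Birkhoff

/-- The coordinates `(x₁, …, xₙ, y₁, …, yₙ)` of `ℝ²ⁿ`: `Sum.inl j` stands for `x_j` and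
`Sum.inr j` for `y_j`. -/
abbrev Coord (n : ℕ) : Type := Fin n ⊕ Fin n

/-- The Hamiltonian eigenvalues: `λ_j` is purely imaginary exactly for the first `κ` indices, and the
non-real ones among the others come in complex conjugate pairs (the Hamiltonian is real). -/
def IsSpectrum {n : ℕ} (κ : ℕ) (lam : Fin n → ℂ) : Prop :=
  (∀ j : Fin n, (lam j).re = 0 ↔ (j : ℕ) < κ) ∧
    ∀ k : Fin n, κ ≤ (k : ℕ) → ∃ l : Fin n, κ ≤ (l : ℕ) ∧ lam l = conj (lam k)

/-- `λ·α ≠ 0` for every nonzero integer vector `α`. -/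
def NonResonant {n : ℕ} (lam : Fin n → ℂ) : Prop :=
  ∀ α : Fin n → ℤ, α ≠ 0 → ∑ j, lam j * (α j : ℂ) ≠ 0

/-- The ordered pairs `(k, l)` with `κ < k, l ≤ n` (counting from `1`) and `λ_l = conj λ_k`.
For real `λ_k` this includes `(k, k)`. -/
def IsConjPair {n : ℕ} (κ : ℕ) (lam : Fin n → ℂ) (p : Fin n × Fin n) : Prop :=
  κ ≤ (p.1 : ℕ) ∧ κ ≤ (p.2 : ℕ) ∧ lam p.2 = conj (lam p.1)

open Classical in
/-- The quadratic form
`½ ∑_{j ≤ κ} i λ_j (x_j² + y_j²) + ½ Re ∑_{κ < k, l ≤ n, λ_l = conj λ_k} λ_k (x_k + i x_l)(y_k - i y_l)`.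
The numbers `i λ_j` with `j ≤ κ` are real, so that taking the real part only changes the type. -/
noncomputable def quadraticPart {n : ℕ} (κ : ℕ) (lam : Fin n → ℂ) (z : Coord n → ℝ) : ℝ :=
  (1 / 2) * ∑ j ∈ Finset.univ.filter (fun j : Fin n => (j : ℕ) < κ),
      (Complex.I * lam j).re * (z (.inl j) ^ 2 + z (.inr j) ^ 2) +
    (1 / 2) * (∑ p ∈ Finset.univ.filter (fun p : Fin n × Fin n => IsConjPair κ lam p),
      lam p.1 * ((z (.inl p.1) : ℂ) + Complex.I * (z (.inl p.2) : ℂ)) *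
        ((z (.inr p.1) : ℂ) - Complex.I * (z (.inr p.2) : ℂ))).re

/-- The term of multidegree `m` of a power series, evaluated at the point `z`. -/
noncomputable def term {σ : Type*} (H : MvPowerSeries σ ℝ) (z : σ → ℝ) (m : σ →₀ ℕ) : ℝ :=
  MvPowerSeries.coeff m H * m.prod fun i k => z i ^ k

/-- `H` is the power series expansion of `h` at the origin. -/
def HasExpansion {σ : Type*} (h : (σ → ℝ) → ℝ) (H : MvPowerSeries σ ℝ) : Prop :=
  ∀ᶠ z in 𝓝 (0 : σ → ℝ), HasSum (term H z) (h z)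

/-- The formal power series converges in a neighbourhood of the origin. -/
def IsConvergent {σ : Type*} (H : MvPowerSeries σ ℝ) : Prop :=
  ∀ᶠ z in 𝓝 (0 : σ → ℝ), Summable (term H z)

/-- The Jacobian matrix of a formal map, rows indexed by components. -/
noncomputable def jacobian {n : ℕ} (φ : Coord n → MvPowerSeries (Coord n) ℝ) :
    Matrix (Coord n) (Coord n) (MvPowerSeries (Coord n) ℝ) :=
  Matrix.of fun i j => MvPowerSeries.pderiv ℝ j (φ i)

/-- A formal symplectic transformation of `(ℝ²ⁿ, 0)`: a formal map fixing the origin that preserves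
`ω = ∑ dx_j ∧ dy_j`. (Such a map is formally invertible, its linear part being a symplectic
matrix.) -/
def IsFormalSymplectic {n : ℕ} (φ : Coord n → MvPowerSeries (Coord n) ℝ) : Prop :=
  (∀ i, MvPowerSeries.constantCoeff (φ i) = 0) ∧
    (jacobian φ)ᵀ * Matrix.J (Fin n) (MvPowerSeries (Coord n) ℝ) * jacobian φ =
      Matrix.J (Fin n) (MvPowerSeries (Coord n) ℝ)

/-- The quadratic monomials of the normal form: `x_j² + y_j²` for `j ≤ κ` and
`(x_k + i x_l)(y_k - i y_l)` for `κ < k, l ≤ n` with `λ_l = conj λ_k`. -/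
noncomputable def invariants {n : ℕ} (κ : ℕ) (lam : Fin n → ℂ) :
    {j : Fin n // (j : ℕ) < κ} ⊕ {p : Fin n × Fin n // IsConjPair κ lam p} →
      MvPowerSeries (Coord n) ℂ
  | .inl j => MvPowerSeries.X (.inl j.1) ^ 2 + MvPowerSeries.X (.inr j.1) ^ 2
  | .inr p =>
      (MvPowerSeries.X (.inl p.1.1) + MvPowerSeries.C Complex.I * MvPowerSeries.X (.inl p.1.2)) *
        (MvPowerSeries.X (.inr p.1.1) - MvPowerSeries.C Complex.I * MvPowerSeries.X (.inr p.1.2))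

/-- The real formal power series `F` is a formal power series in the `invariants`. The coefficients
of the outer series `g` are complex because the invariants are; `F` itself is real. -/
def IsNormalForm {n : ℕ} (κ : ℕ) (lam : Fin n → ℂ) (F : MvPowerSeries (Coord n) ℝ) : Prop :=
  ∃ g : MvPowerSeries
      ({j : Fin n // (j : ℕ) < κ} ⊕ {p : Fin n × Fin n // IsConjPair κ lam p}) ℂ,
    MvPowerSeries.map Complex.ofRealHom F = MvPowerSeries.subst (invariants κ lam) g

/-- `F` is a Birkhoff normal form of `H`: `F` is in normal form and `F = H ∘ φ⁻¹`, that is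
`F ∘ φ = H`, for some formal symplectic transformation `φ`. -/
def IsBirkhoffNormalFormOf {n : ℕ} (κ : ℕ) (lam : Fin n → ℂ)
    (F H : MvPowerSeries (Coord n) ℝ) : Prop :=
  IsNormalForm κ lam F ∧
    ∃ φ : Coord n → MvPowerSeries (Coord n) ℝ,
      IsFormalSymplectic φ ∧ MvPowerSeries.subst φ F = H

end Birkhoff

/-! The frequencies are the powers 1, x, x², ... of one transcendental x in (0,1), multiplied by i
in the elliptic planes. Transcendence gives non-resonance. By Baire category x can also be chosen
with |q x - p| < (p+q)^(-(p+q)) for arbitrarily large p (`exists_transcendental_approximable`). A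
complex linear symplectic map turns the quadratic part into Q = ∑ μ_j x_j y_j. Monomials are then
eigenvectors of {Q, ·}, and a normal form is a power series in the actions I_j = x_j y_j
(`isNormalForm_iff`).

Two neighbouring planes s, t of the same type give a divisor δ = μ_t q - μ_s p with |δ| ≤ |q x - p|.
Add c P to a Hamiltonian with quadratic part Q, where P = a x_s^p y_t^q + b y_s^p x_t^q has degree d
= p + q. A generator c G with {Q, G} = P removes c P and leaves the second order term (c²/2){G, P},
whose coefficient at I_s^(p-1) I_t^q is c² a b p²/δ. Below degree 2d - 1 the normal form is a
quadratic polynomial in c with leading term (1/2){G, P}. The other terms of the Hamiltonian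
influence only its two lower coefficients, and terms of degree at least 2d - 1 have no influence at
all (`exists_normalForms_of_perturbation`). A second difference then shows that one of c = -1, 0, 1
yields a coefficient of modulus at least |a b|/(2|δ|) (`exists_large_normalForm`).

Hence the constants can be chosen one after another along degrees that at least double, later
choices leaving the earlier large coefficients intact. The sum of all perturbations has
geometrically bounded coefficients, so it is analytic (`exists_divergent_perturbation`).

It remains to treat every normal form at once. A formal symplectic map between two normal forms
sends the actions to series that commute with a normalized Hamiltonian, hence to series in the
actions. Comparing weights, it can only permute the actions up to sign (`exists_perm_of_balanced`).
So every Birkhoff normal form has, for infinitely many d, a coefficient of degree 2d - 2 of size at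
least d^d/2^d, and it diverges (`exists_coeff_ge`, `not_isConvergent_of_large`). -/

set_option linter.unusedSectionVars false

namespace Birkhoff

open MvPowerSeries

/-! ### The degree filtration, substitution and the chain rule -/

section Order

variable {σ τ R : Type*} [CommRing R]

/-- The ideal of power series all of whose terms have degree at least `N`. -/
def ordGE (σ R : Type*) [CommRing R] (N : ℕ) : Ideal (MvPowerSeries σ R) where
  carrier := {f | ∀ m : σ →₀ ℕ, m.degree < N → coeff m f = 0}
  add_mem' := fun ha hb m hm => by rw [map_add, ha m hm, hb m hm, add_zero]
  zero_mem' := fun m _ => by simp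
  smul_mem' := fun c f hf m hm => by
    classical
    rw [smul_eq_mul, coeff_mul]
    refine Finset.sum_eq_zero fun p hp => ?_
    have h : p.1 + p.2 = m := Finset.HasAntidiagonal.mem_antidiagonal.mp hp
    have h2 : p.2.degree < N := by
      rw [← h, map_add] at hm
      omega
    rw [hf _ h2, mul_zero]

theorem mem_ordGE {N : ℕ} {f : MvPowerSeries σ R} :
    f ∈ ordGE σ R N ↔ ∀ m : σ →₀ ℕ, m.degree < N → coeff m f = 0 := Iff.rfl

theorem ordGE_anti {M N : ℕ} (h : M ≤ N) {f : MvPowerSeries σ R} (hf : f ∈ ordGE σ R N) :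
    f ∈ ordGE σ R M := fun m hm => hf m (hm.trans_le h)

theorem mem_ordGE_zero (f : MvPowerSeries σ R) : f ∈ ordGE σ R 0 :=
  fun _ hm => absurd hm (Nat.not_lt_zero _)

theorem mem_ordGE_one {f : MvPowerSeries σ R} : f ∈ ordGE σ R 1 ↔ constantCoeff f = 0 := by
  rw [mem_ordGE]
  constructor
  · intro h
    simpa using h 0 (by simp)
  · intro h m hm
    obtain rfl : m = 0 := by
      rw [← Finsupp.degree_eq_zero_iff]
      omega
    simpa using h

theorem eq_zero_of_forall_mem_ordGE {f : MvPowerSeries σ R} (h : ∀ N, f ∈ ordGE σ R N) :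
    f = 0 := by
  ext m
  simpa using h (m.degree + 1) m (Nat.lt_succ_self _)

theorem mul_mem_ordGE {a b : ℕ} {f g : MvPowerSeries σ R} (hf : f ∈ ordGE σ R a)
    (hg : g ∈ ordGE σ R b) : f * g ∈ ordGE σ R (a + b) := by
  classical
  intro m hm
  rw [coeff_mul]
  refine Finset.sum_eq_zero fun p hp => ?_
  have h : p.1 + p.2 = m := Finset.HasAntidiagonal.mem_antidiagonal.mp hp
  rw [← h, map_add] at hm
  rcases lt_or_ge p.1.degree a with h1 | h1
  · rw [hf _ h1, zero_mul]
  · rw [hg _ (by omega), mul_zero]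

theorem pow_mem_ordGE {a : ℕ} {f : MvPowerSeries σ R} (hf : f ∈ ordGE σ R a) (k : ℕ) :
    f ^ k ∈ ordGE σ R (k * a) := by
  induction k with
  | zero => exact ordGE_anti (by simp) (mem_ordGE_zero _)
  | succ k ih =>
    rw [pow_succ, Nat.succ_mul]
    exact mul_mem_ordGE ih hf

theorem smul_mem_ordGE {N : ℕ} {f : MvPowerSeries σ R} (hf : f ∈ ordGE σ R N) (c : R) :
    c • f ∈ ordGE σ R N := by
  rw [smul_eq_C_mul]
  exact Ideal.mul_mem_left _ _ hf

theorem X_mem_ordGE (i : σ) : (X i : MvPowerSeries σ R) ∈ ordGE σ R 1 :=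
  mem_ordGE_one.mpr (by simp)

theorem map_mem_ordGE {S : Type*} [CommRing S] (φ : R →+* S) {N : ℕ} {f : MvPowerSeries σ R}
    (hf : f ∈ ordGE σ R N) : MvPowerSeries.map φ f ∈ ordGE σ S N := by
  intro m hm
  rw [coeff_map, hf m hm, map_zero]

theorem pderiv_mem_ordGE {N : ℕ} {f : MvPowerSeries σ R} (hf : f ∈ ordGE σ R N) (i : σ) :
    pderiv R i f ∈ ordGE σ R (N - 1) := by
  intro m hm
  rw [coeff_pderiv, hf _ (by rw [map_add, Finsupp.degree_single]; omega), zero_mul]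

theorem sub_truncTotal_mem_ordGE [Finite σ] (N : ℕ) (f : MvPowerSeries σ R) :
    f - ((truncTotal N f : MvPolynomial σ R) : MvPowerSeries σ R) ∈ ordGE σ R N := by
  intro m hm
  rw [map_sub, MvPolynomial.coeff_coe, coeff_truncTotal _ hm, sub_self]

theorem pderiv_comm (i j : σ) (f : MvPowerSeries σ R) :
    pderiv R i (pderiv R j f) = pderiv R j (pderiv R i f) := by
  classical
  ext m
  simp only [coeff_pderiv, Finsupp.add_apply, Finsupp.single_apply]
  rw [add_right_comm]
  by_cases h : i = j
  · subst h; rfl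
  · simp [h, Ne.symm h]
    ring

theorem map_pderiv {S : Type*} [CommRing S] (φ : R →+* S) (i : σ) (f : MvPowerSeries σ R) :
    MvPowerSeries.map φ (pderiv R i f) = pderiv S i (MvPowerSeries.map φ f) := by
  ext m
  simp [coeff_pderiv]

theorem subst_mem_ordGE [Finite σ] {a : σ → MvPowerSeries τ R} (ha : ∀ i, constantCoeff (a i) = 0)
    {N : ℕ} {f : MvPowerSeries σ R} (hf : f ∈ ordGE σ R N) : subst a f ∈ ordGE τ R N := by
  intro m hm
  rw [coeff_subst (hasSubst_of_constantCoeff_zero ha), finsum_eq_zero_of_forall_eq_zero]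
  intro d
  rcases lt_or_ge d.degree N with h | h
  · rw [hf d h, zero_smul]
  · have : (d.prod fun s e => a s ^ e) ∈ ordGE τ R d.degree := by
      rw [Finsupp.prod, Finsupp.degree_apply]
      have hs : ∀ s : Finset σ, ∏ i ∈ s, a i ^ d i ∈ ordGE τ R (∑ i ∈ s, d i) := by
        classical
        intro s
        induction s using Finset.induction_on with
        | empty => exact mem_ordGE_zero _
        | insert i s hi ih =>
          rw [Finset.prod_insert hi, Finset.sum_insert hi]
          refine mul_mem_ordGE ?_ ih
          simpa using pow_mem_ordGE (mem_ordGE_one.mpr (ha i)) (d i)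
      exact hs _
    rw [this m (hm.trans_le h), smul_zero]

/-- Two power series valued additive maps that agree on polynomials and shift the order by a
bounded amount agree. -/
theorem eq_of_eq_on_polynomials [Finite σ] {L L' : MvPowerSeries σ R →+ MvPowerSeries τ R} (k : ℕ)
    (hL : ∀ N, ∀ f ∈ ordGE σ R N, L f ∈ ordGE τ R (N - k))
    (hL' : ∀ N, ∀ f ∈ ordGE σ R N, L' f ∈ ordGE τ R (N - k))
    (h : ∀ p : MvPolynomial σ R, L (p : MvPowerSeries σ R) = L' p) (f : MvPowerSeries σ R) :
    L f = L' f := by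
  rw [← sub_eq_zero]
  refine eq_zero_of_forall_mem_ordGE fun N => ?_
  -- Truncation at degree N + k leaves room for the k orders that the maps may lose.
  have key := sub_truncTotal_mem_ordGE (N + k) f
  have h1 := hL _ _ key
  have h2 := hL' _ _ key
  rw [Nat.add_sub_cancel] at h1 h2
  have h3 := Ideal.sub_mem _ h1 h2
  rw [map_sub, map_sub, h] at h3
  simpa using h3

/-- The chain rule for the substitution of power series without constant term. -/
theorem pderiv_subst [Fintype σ] {a : σ → MvPowerSeries τ R} (ha : ∀ i, constantCoeff (a i) = 0)
    (i : τ) (f : MvPowerSeries σ R) :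
    pderiv R i (subst a f) = ∑ j, subst a (pderiv R j f) * pderiv R i (a j) := by
  classical
  have hs := hasSubst_of_constantCoeff_zero ha
  let L : MvPowerSeries σ R →+ MvPowerSeries τ R :=
    ((pderiv R i : MvPowerSeries τ R →ₗ[R] MvPowerSeries τ R).comp
      (substAlgHom hs).toLinearMap).toAddMonoidHom
  let L' : MvPowerSeries σ R →+ MvPowerSeries τ R :=
    ∑ j, (AddMonoidHom.mulRight (pderiv R i (a j))).comp
      ((substAlgHom hs).toLinearMap.comp
        (pderiv R j : MvPowerSeries σ R →ₗ[R] MvPowerSeries σ R)).toAddMonoidHom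
  have e : ∀ f, L f = pderiv R i (subst a f) := fun f => by simp [L]
  have e' : ∀ f, L' f = ∑ j, subst a (pderiv R j f) * pderiv R i (a j) := fun f => by
    simp [L']
  rw [← e, ← e']
  -- Both sides lower the order by at most one, so polynomials suffice, and these are handled by
  -- induction.
  refine eq_of_eq_on_polynomials 1 ?_ ?_ ?_ f
  · intro N f hf
    rw [e]
    exact pderiv_mem_ordGE (subst_mem_ordGE ha hf) i
  · intro N f hf
    rw [e']
    exact Ideal.sum_mem _ fun j _ =>
      Ideal.mul_mem_right _ _ (subst_mem_ordGE ha (pderiv_mem_ordGE hf j))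
  · intro p
    rw [e, e']
    induction p using MvPolynomial.induction_on with
    | C r =>
      have h0 : subst a (0 : MvPowerSeries σ R) = 0 := by rw [← coe_substAlgHom hs, map_zero]
      simp [subst_C, h0]
    | add p q hp hq =>
      simp only [MvPolynomial.coe_add, map_add, subst_add hs, hp, hq, add_mul,
        Finset.sum_add_distrib]
    | mul_X p k hp =>
      simp only [MvPolynomial.coe_mul, MvPolynomial.coe_X, subst_mul hs, subst_X hs,
        Derivation.leibniz, smul_eq_mul, hp, subst_add hs, add_mul, Finset.sum_add_distrib]
      congr 1
      · rw [Finset.sum_eq_single k]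
        · rw [pderiv_X_self, ← coe_substAlgHom hs, map_one, mul_one]
        · intro j _ hj
          rw [pderiv_X_of_ne hj.symm, ← coe_substAlgHom hs, map_zero, mul_zero, zero_mul]
        · simp
      · rw [Finset.mul_sum]
        exact Finset.sum_congr rfl fun j _ => by ring

/-- Preserving the order is continuity for the degree filtration, so the homomorphism is determined
by the images of the variables. This converts between automorphisms of the algebra and formal maps.
-/
theorem eq_subst_of_ordGE [Finite σ] (e : MvPowerSeries σ R →ₐ[R] MvPowerSeries τ R)
    (he : ∀ N, ∀ f ∈ ordGE σ R N, e f ∈ ordGE τ R N) (f : MvPowerSeries σ R) :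
    e f = subst (fun i => e (X i)) f := by
  have ha : ∀ i, constantCoeff (e (X i)) = 0 := fun i =>
    mem_ordGE_one.mp (he 1 _ (X_mem_ordGE i))
  have hs := hasSubst_of_constantCoeff_zero ha
  rw [← substAlgHom_apply hs]
  refine eq_of_eq_on_polynomials (L := e.toLinearMap.toAddMonoidHom)
    (L' := (substAlgHom (R := R) hs).toLinearMap.toAddMonoidHom) 0 he ?_ ?_ f
  · intro N f hf
    exact (substAlgHom_apply hs f).symm ▸ subst_mem_ordGE ha hf
  · intro p
    have : e.comp (MvPolynomial.coeToMvPowerSeries.algHom (σ := σ) R)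
        = (substAlgHom hs).comp (MvPolynomial.coeToMvPowerSeries.algHom (σ := σ) R) := by
      ext i
      simp [subst_X hs]
    simpa using congrArg (fun F => F p) this

end Order
-- The Poisson bracket
section Bracket

variable {n : ℕ} {K L : Type*} [Field K] [CharZero K] [Field L] [CharZero L]

/-- The Hamiltonian derivation `{f, ·}`. -/
noncomputable def ham (f : MvPowerSeries (Coord n) K) :
    Derivation K (MvPowerSeries (Coord n) K) (MvPowerSeries (Coord n) K) :=
  ∑ j, (pderiv K (.inl j) f • pderiv K (.inr j) - pderiv K (.inr j) f • pderiv K (.inl j))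

/-- The Poisson bracket. -/
noncomputable def pb (f g : MvPowerSeries (Coord n) K) : MvPowerSeries (Coord n) K := ham f g

theorem pb_eq (f g : MvPowerSeries (Coord n) K) :
    pb f g = ∑ j, (pderiv K (.inl j) f * pderiv K (.inr j) g
      - pderiv K (.inr j) f * pderiv K (.inl j) g) := by
  rw [pb, ham, ← Derivation.coeFnAddMonoidHom_apply, map_sum, Finset.sum_apply]
  rfl

theorem pb_antisymm (f g : MvPowerSeries (Coord n) K) : pb f g = -pb g f := by
  rw [pb_eq, pb_eq, ← Finset.sum_neg_distrib]
  exact Finset.sum_congr rfl fun j _ => by ring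

theorem pb_self (f : MvPowerSeries (Coord n) K) : pb f f = 0 := by
  rw [pb_eq]
  exact Finset.sum_eq_zero fun j _ => by ring

theorem pb_add_right (f g h : MvPowerSeries (Coord n) K) : pb f (g + h) = pb f g + pb f h :=
  map_add (ham f) g h

theorem pb_sub_right (f g h : MvPowerSeries (Coord n) K) : pb f (g - h) = pb f g - pb f h :=
  map_sub (ham f) g h

theorem pb_smul_right (c : K) (f g : MvPowerSeries (Coord n) K) : pb f (c • g) = c • pb f g :=
  (ham f).map_smul c g

theorem pb_zero_right (f : MvPowerSeries (Coord n) K) : pb f 0 = 0 := map_zero (ham f)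

theorem pb_neg_right (f g : MvPowerSeries (Coord n) K) : pb f (-g) = -pb f g :=
  map_neg (ham f) g

theorem pb_mul_right (f g h : MvPowerSeries (Coord n) K) :
    pb f (g * h) = g * pb f h + h * pb f g := (ham f).leibniz g h

theorem pb_add_left (f g h : MvPowerSeries (Coord n) K) : pb (f + g) h = pb f h + pb g h := by
  rw [pb_antisymm, pb_add_right, pb_antisymm h f, pb_antisymm h g]; ring

theorem pb_sub_left (f g h : MvPowerSeries (Coord n) K) : pb (f - g) h = pb f h - pb g h := by
  rw [pb_antisymm, pb_sub_right, pb_antisymm h f, pb_antisymm h g]; ring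

theorem pb_smul_left (c : K) (f g : MvPowerSeries (Coord n) K) : pb (c • f) g = c • pb f g := by
  rw [pb_antisymm, pb_smul_right, pb_antisymm g f, smul_neg, neg_neg]

theorem pb_zero_left (f : MvPowerSeries (Coord n) K) : pb 0 f = 0 := by
  rw [pb_antisymm, pb_zero_right, neg_zero]

theorem pb_neg_left (f g : MvPowerSeries (Coord n) K) : pb (-f) g = -pb f g := by
  rw [pb_antisymm, pb_neg_right, pb_antisymm g f, neg_neg]

theorem pb_mul_left (f g h : MvPowerSeries (Coord n) K) :
    pb (f * g) h = f * pb g h + g * pb f h := by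
  rw [pb_antisymm, pb_mul_right, pb_antisymm h f, pb_antisymm h g]; ring

theorem pb_mem_ordGE {a b : ℕ} {f g : MvPowerSeries (Coord n) K} (hf : f ∈ ordGE _ K a)
    (hg : g ∈ ordGE _ K b) : pb f g ∈ ordGE _ K (a + b - 2) := by
  rw [pb_eq]
  refine Ideal.sum_mem _ fun j _ => Ideal.sub_mem _ ?_ ?_ <;>
  exact ordGE_anti (by omega) (mul_mem_ordGE (pderiv_mem_ordGE hf _) (pderiv_mem_ordGE hg _))

theorem map_pb (φ : K →+* L) (f g : MvPowerSeries (Coord n) K) :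
    MvPowerSeries.map φ (pb f g) = pb (MvPowerSeries.map φ f) (MvPowerSeries.map φ g) := by
  simp only [pb_eq, map_sum, map_sub, map_mul, map_pderiv]

theorem pb_jacobi (f g h : MvPowerSeries (Coord n) K) :
    pb f (pb g h) = pb (pb f g) h + pb g (pb f h) := by
  rw [← sub_eq_zero]
  set S := pb f (pb g h) - (pb (pb f g) h + pb g (pb f h)) with hS
  let x : Fin n → MvPowerSeries (Coord n) K → MvPowerSeries (Coord n) K :=
    fun j f => pderiv K (.inl j) f
  let y : Fin n → MvPowerSeries (Coord n) K → MvPowerSeries (Coord n) K :=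
    fun j f => pderiv K (.inr j) f
  let A : Fin n → Fin n → MvPowerSeries (Coord n) K := fun i j =>
    (x i f * (x j g * y i (y j h) + y j h * y i (x j g) -
        (y j g * y i (x j h) + x j h * y i (y j g)))
      - y i f * (x j g * x i (y j h) + y j h * x i (x j g) -
        (y j g * x i (x j h) + x j h * x i (y j g))))
    - ((x j f * x i (y j g) + y j g * x i (x j f) -
        (y j f * x i (x j g) + x j g * x i (y j f))) * y i h
      - (x j f * y i (y j g) + y j g * y i (x j f) -
        (y j f * y i (x j g) + x j g * y i (y j f))) * x i h
      + (x i g * (x j f * y i (y j h) + y j h * y i (x j f) -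
        (y j f * y i (x j h) + x j h * y i (y j f)))
      - y i g * (x j f * x i (y j h) + y j h * x i (x j f) -
        (y j f * x i (x j h) + x j h * x i (y j f)))))
  have e : S = ∑ i, ∑ j, A i j := by
    rw [hS]
    simp only [pb_eq, map_sum, map_sub, Derivation.leibniz, smul_eq_mul, Finset.mul_sum,
      Finset.sum_mul, ← Finset.sum_add_distrib, ← Finset.sum_sub_distrib, A, x, y]
  have hx : ∀ i j f, x i (x j f) = x j (x i f) := fun i j f => pderiv_comm _ _ f
  have hy : ∀ i j f, y i (y j f) = y j (y i f) := fun i j f => pderiv_comm _ _ f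
  have hxy : ∀ i j f, y i (x j f) = x j (y i f) := fun i j f => pderiv_comm _ _ f
  -- The terms `A i j` do not vanish separately. Since partial derivatives commute, `A i j + A j i`
  -- does, so both orders of summation are added; characteristic zero then gives S = 0.
  have e2 : S + S = 0 := by
    conv_lhs => rw [e]; arg 2; rw [Finset.sum_comm]
    rw [← Finset.sum_add_distrib]
    refine Finset.sum_eq_zero fun i _ => ?_
    rw [← Finset.sum_add_distrib]
    refine Finset.sum_eq_zero fun j _ => ?_
    simp only [A, hxy, hx j i, hy j i]
    ring
  ext m
  have := congrArg (coeff m) e2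
  rw [map_add, map_zero] at this
  simpa using add_self_eq_zero.mp this

theorem pb_X_inl (j : Fin n) (g : MvPowerSeries (Coord n) K) :
    pb (X (.inl j)) g = pderiv K (.inr j) g := by
  rw [pb_eq, Finset.sum_eq_single j]
  · rw [pderiv_X_self, pderiv_X_of_ne (by simp), one_mul, zero_mul, sub_zero]
  · intro i _ hi
    rw [pderiv_X_of_ne (by simpa using hi.symm), pderiv_X_of_ne (by simp), zero_mul, zero_mul,
      sub_zero]
  · simp

theorem pb_X_inr (j : Fin n) (g : MvPowerSeries (Coord n) K) :
    pb (X (.inr j)) g = -pderiv K (.inl j) g := by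
  rw [pb_eq, Finset.sum_eq_single j]
  · rw [pderiv_X_self, pderiv_X_of_ne (by simp), one_mul, zero_mul, zero_sub]
  · intro i _ hi
    rw [pderiv_X_of_ne (by simp), pderiv_X_of_ne (by simpa using hi.symm), zero_mul, zero_mul,
      sub_zero]
  · simp

end Bracket

/-! ### Exponentials of operators that raise the order -/

section LieExp

variable {σ K : Type*} [Field K] [CharZero K]

/-- The divided power `D ^ k / k!`. -/
noncomputable def divPow (D : Module.End K (MvPowerSeries σ K)) (k : ℕ) :
    Module.End K (MvPowerSeries σ K) := (k.factorial : K)⁻¹ • D ^ k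

/-- The operator raises the order of every power series. -/
def RaisesOrder (D : Module.End K (MvPowerSeries σ K)) : Prop :=
  ∀ N, ∀ f ∈ ordGE σ K N, D f ∈ ordGE σ K (N + 1)

/-- The exponential of an operator that raises the order. -/
noncomputable def lieExp (D : Module.End K (MvPowerSeries σ K)) (f : MvPowerSeries σ K) :
    MvPowerSeries σ K := fun m => coeff m (∑ k ∈ Finset.range (m.degree + 1), divPow D k f)

variable {D : Module.End K (MvPowerSeries σ K)}

theorem coeff_lieExp (f : MvPowerSeries σ K) (m : σ →₀ ℕ) : coeff m (lieExp D f)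
    = coeff m (∑ k ∈ Finset.range (m.degree + 1), divPow D k f) := rfl

theorem divPow_zero (f : MvPowerSeries σ K) : divPow D 0 f = f := by simp [divPow]

theorem divPow_one (f : MvPowerSeries σ K) : divPow D 1 f = D f := by simp [divPow]

theorem divPow_succ (k : ℕ) (f : MvPowerSeries σ K) :
    ((k : K) + 1) • divPow D (k + 1) f = D (divPow D k f) := by
  have h : (k : K) + 1 ≠ 0 := by exact_mod_cast Nat.succ_ne_zero k
  simp only [divPow, LinearMap.smul_apply, map_smul, pow_succ', Module.End.mul_apply, smul_smul]
  congr 1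
  rw [Nat.factorial_succ]
  push_cast
  field_simp

theorem RaisesOrder.divPow_mem (hD : RaisesOrder D) (k : ℕ) {N : ℕ} {f : MvPowerSeries σ K}
    (hf : f ∈ ordGE σ K N) : divPow D k f ∈ ordGE σ K (N + k) := by
  refine smul_mem_ordGE ?_ _
  induction k with
  | zero => simpa using hf
  | succ k ih =>
    rw [pow_succ', Module.End.mul_apply, ← add_assoc]
    exact hD _ _ ih

/-- The k-th divided power has order at least k, so the terms cut off in the definition of `lieExp`
contribute nothing in the degree considered. All later identities are checked on these partial sums.
-/
theorem RaisesOrder.lieExp_sub_mem (hD : RaisesOrder D) (N : ℕ) (f : MvPowerSeries σ K) :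
    lieExp D f - ∑ k ∈ Finset.range N, divPow D k f ∈ ordGE σ K N := by
  intro m hm
  rw [map_sub, sub_eq_zero]
  rw [coeff_lieExp, ← Finset.sum_range_add_sum_Ico _ (Nat.succ_le_of_lt hm), map_add, left_eq_add]
  refine (Ideal.sum_mem (ordGE σ K (m.degree + 1)) fun k hk => ?_) m (Nat.lt_succ_self _)
  exact ordGE_anti (by have := (Finset.mem_Ico.mp hk).1; omega)
    (hD.divPow_mem k (mem_ordGE_zero f))

theorem RaisesOrder.lieExp_mem (hD : RaisesOrder D) {N : ℕ} {f : MvPowerSeries σ K}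
    (hf : f ∈ ordGE σ K N) : lieExp D f ∈ ordGE σ K N := by
  have h := Ideal.add_mem _ (hD.lieExp_sub_mem N f)
    (Ideal.sum_mem _ fun k (_ : k ∈ Finset.range N) =>
      ordGE_anti (Nat.le_add_right N k) (hD.divPow_mem k hf))
  simpa using h

theorem lieExp_add (f g : MvPowerSeries σ K) : lieExp D (f + g) = lieExp D f + lieExp D g := by
  ext m
  simp only [coeff_lieExp, map_add, Finset.sum_add_distrib]

theorem lieExp_smul (c : K) (f : MvPowerSeries σ K) : lieExp D (c • f) = c • lieExp D f := by
  ext m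
  simp only [coeff_lieExp, map_smul, ← Finset.smul_sum, smul_eq_mul]

theorem lieExp_sub (f g : MvPowerSeries σ K) : lieExp D (f - g) = lieExp D f - lieExp D g := by
  rw [eq_sub_iff_add_eq, ← lieExp_add, sub_add_cancel]

/-- The square and the triangle of indices differ only by terms with i + j ≥ M. The loss s accounts
for operations that lower the order, such as the bracket. -/
theorem sum_range_sum_range_sub_antidiagonal_mem {u : ℕ → ℕ → MvPowerSeries σ K} {s : ℕ}
    (hu : ∀ i j, u i j ∈ ordGE σ K (i + j - s)) (M : ℕ) :
    ∑ i ∈ Finset.range M, ∑ j ∈ Finset.range M, u i j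
      - ∑ k ∈ Finset.range M, ∑ p ∈ Finset.HasAntidiagonal.antidiagonal k, u p.1 p.2 ∈ ordGE σ K (M - s) := by
  have h : ∑ k ∈ Finset.range M, ∑ p ∈ Finset.HasAntidiagonal.antidiagonal k, u p.1 p.2
      = ∑ i ∈ Finset.range M, ∑ j ∈ Finset.range (M - i), u i j := by
    rw [← Finset.sum_range_diag_flip]
    exact Finset.sum_congr rfl fun k _ =>
      Finset.Nat.sum_antidiagonal_eq_sum_range_succ_mk _ _
  rw [h, ← Finset.sum_sub_distrib]
  refine Ideal.sum_mem _ fun i _ => ?_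
  rw [← Finset.sum_range_add_sum_Ico _ (Nat.sub_le M i), add_sub_cancel_left]
  refine Ideal.sum_mem _ fun j hj => ordGE_anti ?_ (hu i j)
  have := (Finset.mem_Ico.mp hj).1
  omega

/-- Leibniz rule for divided powers, in which no binomial coefficients occur. The induction
multiplies by k + 1 and splits it as the sum of the two indices. -/
theorem divPow_bilin {B : MvPowerSeries σ K → MvPowerSeries σ K → MvPowerSeries σ K}
    (hsl : ∀ (c : K) f g, B (c • f) g = c • B f g) (hsr : ∀ (c : K) f g, B f (c • g) = c • B f g)
    (hB : ∀ f g, D (B f g) = B (D f) g + B f (D g)) (k : ℕ) (f g : MvPowerSeries σ K) :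
    divPow D k (B f g) = ∑ p ∈ Finset.HasAntidiagonal.antidiagonal k, B (divPow D p.1 f) (divPow D p.2 g) := by
  induction k with
  | zero => simp [divPow_zero]
  | succ k ih =>
    have hk : (k : K) + 1 ≠ 0 := by exact_mod_cast Nat.succ_ne_zero k
    apply smul_right_injective _ hk
    simp only
    rw [divPow_succ, ih, map_sum]
    simp only [hB, ← divPow_succ, hsl, hsr, Finset.sum_add_distrib]
    have e : ∀ p ∈ Finset.HasAntidiagonal.antidiagonal (k + 1), ((k : K) + 1) • B (divPow D p.1 f) (divPow D p.2 g)
        = (p.1 : K) • B (divPow D p.1 f) (divPow D p.2 g)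
          + (p.2 : K) • B (divPow D p.1 f) (divPow D p.2 g) := by
      intro p hp
      rw [← add_smul]
      congr 1
      exact_mod_cast (Finset.HasAntidiagonal.mem_antidiagonal.mp hp).symm
    rw [Finset.smul_sum, Finset.sum_congr rfl e, Finset.sum_add_distrib]
    congr 1
    · rw [Finset.Nat.sum_antidiagonal_succ]
      simp
    · rw [Finset.Nat.sum_antidiagonal_succ']
      simp

/-- The exponential of a derivation of a bilinear operation is an endomorphism for that operation.
Stated for a general B so as to cover the product (s = 0) and the Poisson bracket (s = 2). -/
theorem RaisesOrder.lieExp_bilin (hD : RaisesOrder D)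
    {B : MvPowerSeries σ K → MvPowerSeries σ K → MvPowerSeries σ K}
    (hl : ∀ f g h, B (f + g) h = B f h + B g h) (hr : ∀ f g h, B f (g + h) = B f g + B f h)
    (hsl : ∀ (c : K) f g, B (c • f) g = c • B f g) (hsr : ∀ (c : K) f g, B f (c • g) = c • B f g)
    (hB : ∀ f g, D (B f g) = B (D f) g + B f (D g)) {s : ℕ}
    (hs : ∀ a b, ∀ f ∈ ordGE σ K a, ∀ g ∈ ordGE σ K b, B f g ∈ ordGE σ K (a + b - s))
    (f g : MvPowerSeries σ K) : lieExp D (B f g) = B (lieExp D f) (lieExp D g) := by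
  rw [← sub_eq_zero]
  refine eq_zero_of_forall_mem_ordGE fun N => ?_
  set M := N + s
  set f' := ∑ k ∈ Finset.range M, divPow D k f with hf'
  set g' := ∑ k ∈ Finset.range M, divPow D k g with hg'
  have h1 := hD.lieExp_sub_mem M (B f g)
  have hf := hD.lieExp_sub_mem M f
  have hg := hD.lieExp_sub_mem M g
  rw [← hf'] at hf
  rw [← hg'] at hg
  have hB0l : ∀ g, B 0 g = 0 := fun g => by simpa using hl 0 0 g
  have hB0r : ∀ f, B f 0 = 0 := fun f => by simpa using hr f 0 0
  have hsuml : ∀ (t : Finset ℕ) (F : ℕ → MvPowerSeries σ K) g,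
      B (∑ k ∈ t, F k) g = ∑ k ∈ t, B (F k) g := fun t F g => by
    induction t using Finset.induction_on with
    | empty => simp [hB0l]
    | insert a t ha ih => rw [Finset.sum_insert ha, Finset.sum_insert ha, hl, ih]
  have hsumr : ∀ (t : Finset ℕ) (F : ℕ → MvPowerSeries σ K) f,
      B f (∑ k ∈ t, F k) = ∑ k ∈ t, B f (F k) := fun t F f => by
    induction t using Finset.induction_on with
    | empty => simp [hB0r]
    | insert a t ha ih => rw [Finset.sum_insert ha, Finset.sum_insert ha, hr, ih]
  have h2 : B (lieExp D f) (lieExp D g) - B f' g' ∈ ordGE σ K N := by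
    have e : B (lieExp D f) (lieExp D g) - B f' g'
        = B (lieExp D f - f') (lieExp D g) + B f' (lieExp D g - g') := by
      have a1 := hl (lieExp D f - f') f' (lieExp D g)
      have a2 := hr f' (lieExp D g - g') g'
      rw [sub_add_cancel] at a1 a2
      rw [a1, a2]; ring
    rw [e]
    refine Ideal.add_mem _ (ordGE_anti ?_ (hs M 0 _ hf _ (mem_ordGE_zero _)))
      (ordGE_anti ?_ (hs 0 M _ (mem_ordGE_zero _) _ hg)) <;> omega
  have h3 : B f' g' - ∑ k ∈ Finset.range M, divPow D k (B f g) ∈ ordGE σ K N := by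
    have := sum_range_sum_range_sub_antidiagonal_mem (K := K)
      (u := fun i j => B (divPow D i f) (divPow D j g)) (s := s)
      (fun i j => ordGE_anti (by omega) (hs _ _ _ (hD.divPow_mem i (mem_ordGE_zero f)) _
        (hD.divPow_mem j (mem_ordGE_zero g)))) M
    rw [hf', hg', hsuml]
    simp only [hsumr, divPow_bilin hsl hsr hB]
    exact ordGE_anti (by omega) this
  have h1' : lieExp D (B f g) - ∑ k ∈ Finset.range M, divPow D k (B f g) ∈ ordGE σ K N :=
    ordGE_anti (by omega) h1
  have := Ideal.sub_mem _ (Ideal.sub_mem _ h1' h3) h2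
  convert this using 1
  ring

theorem RaisesOrder.neg (hD : RaisesOrder D) : RaisesOrder (-D) := fun N f hf => by
  simpa using hD N f hf

/-- Only powers of the single operator D occur, so this is the coefficient of t^k in exp(t) exp(-t)
= 1. -/
theorem divPow_comp_neg (k : ℕ) (f : MvPowerSeries σ K) :
    ∑ p ∈ Finset.HasAntidiagonal.antidiagonal k, divPow D p.1 (divPow (-D) p.2 f) = if k = 0 then f else 0 := by
  have h := congrArg (PowerSeries.coeff k) (PowerSeries.exp_mul_exp_neg_eq_one (A := K))
  rw [PowerSeries.coeff_mul] at h
  have e : ∀ p ∈ Finset.HasAntidiagonal.antidiagonal k, divPow D p.1 (divPow (-D) p.2 f) =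
      (PowerSeries.coeff p.1 (PowerSeries.exp K) *
        PowerSeries.coeff p.2 (PowerSeries.evalNegHom (PowerSeries.exp K))) • (D ^ k) f := by
    intro p hp
    have hp' : p.1 + p.2 = k := Finset.HasAntidiagonal.mem_antidiagonal.mp hp
    simp only [divPow, LinearMap.smul_apply, map_smul, smul_smul, PowerSeries.coeff_exp,
      PowerSeries.evalNegHom, PowerSeries.coeff_rescale]
    have h3 : ∀ j, ((-D) ^ j) f = ((-1 : K) ^ j) • (D ^ j) f := fun j => by
      induction j with
      | zero => simp
      | succ j ih =>
        rw [pow_succ', Module.End.mul_apply, ih, LinearMap.neg_apply, map_smul, pow_succ' (-1 : K),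
          pow_succ' D, Module.End.mul_apply, mul_smul, neg_one_smul]
    rw [h3, map_smul, ← Module.End.mul_apply, ← pow_add, hp', smul_smul]
    congr 1
    simp
    ring
  rw [Finset.sum_congr rfl e, ← Finset.sum_smul, h, PowerSeries.coeff_one]
  split_ifs with hk
  · simp [hk]
  · simp

theorem RaisesOrder.lieExp_lieExp_neg (hD : RaisesOrder D) (f : MvPowerSeries σ K) :
    lieExp D (lieExp (-D) f) = f := by
  rw [← sub_eq_zero]
  refine eq_zero_of_forall_mem_ordGE fun N => ?_
  refine ordGE_anti (Nat.le_succ N) ?_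
  -- A successor, so that the range contains k = 0, the only index with a nonzero contribution.
  set M := N + 1 with hM
  set f' := ∑ k ∈ Finset.range M, divPow (-D) k f with hf'
  have h1 := hD.lieExp_mem (hD.neg.lieExp_sub_mem M f)
  rw [← hf', lieExp_sub] at h1
  have h2 := hD.lieExp_sub_mem M f'
  have h3 := sum_range_sum_range_sub_antidiagonal_mem (K := K)
    (u := fun i j => divPow D i (divPow (-D) j f)) (s := 0)
    (fun i j => ordGE_anti (by omega)
      (hD.divPow_mem i (hD.neg.divPow_mem j (mem_ordGE_zero f)))) M
  have e1 : ∑ k ∈ Finset.range M, divPow D k f'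
      = ∑ i ∈ Finset.range M, ∑ j ∈ Finset.range M, divPow D i (divPow (-D) j f) := by
    simp only [hf', map_sum]
  have e2 : ∑ k ∈ Finset.range M, ∑ p ∈ Finset.HasAntidiagonal.antidiagonal k, divPow D p.1 (divPow (-D) p.2 f)
      = f := by
    rw [Finset.sum_congr rfl fun k _ => divPow_comp_neg k f, hM, Finset.sum_range_succ']
    simp
  rw [e2, ← e1, Nat.sub_zero] at h3
  have := Ideal.add_mem _ (Ideal.add_mem _ h1 h2) h3
  convert this using 1
  ring

end LieExp

/-! ### Formal symplectic flows and the normalization procedure -/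

section Normalization

variable {n : ℕ} {K : Type*} [Field K] [CharZero K]

/-- An algebra automorphism of the ring of formal power series that preserves the Poisson bracket
and the order. -/
structure IsSymplecticAut (e : MvPowerSeries (Coord n) K ≃ₐ[K] MvPowerSeries (Coord n) K) :
    Prop where
  map_pb : ∀ f g, e (pb f g) = pb (e f) (e g)
  map_mem : ∀ N, ∀ f ∈ ordGE (Coord n) K N, e f ∈ ordGE (Coord n) K N
  symm_mem : ∀ N, ∀ f ∈ ordGE (Coord n) K N, e.symm f ∈ ordGE (Coord n) K N

theorem IsSymplecticAut.symm {e : MvPowerSeries (Coord n) K ≃ₐ[K] MvPowerSeries (Coord n) K}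
    (h : IsSymplecticAut e) : IsSymplecticAut e.symm where
  map_pb f g := by
    apply e.injective
    rw [h.map_pb]
    simp
  map_mem := h.symm_mem
  symm_mem := h.map_mem

theorem IsSymplecticAut.trans {e e' : MvPowerSeries (Coord n) K ≃ₐ[K] MvPowerSeries (Coord n) K}
    (h : IsSymplecticAut e) (h' : IsSymplecticAut e') : IsSymplecticAut (e.trans e') where
  map_pb f g := by simp [h.map_pb, h'.map_pb]
  map_mem N f hf := h'.map_mem N _ (h.map_mem N f hf)
  symm_mem N f hf := h.symm_mem N _ (h'.symm_mem N f hf)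

/-- The operator `{G, ·}`. -/
noncomputable def ad (G : MvPowerSeries (Coord n) K) : Module.End K (MvPowerSeries (Coord n) K) :=
  (ham G : MvPowerSeries (Coord n) K →ₗ[K] MvPowerSeries (Coord n) K)

theorem ad_apply (G f : MvPowerSeries (Coord n) K) : ad G f = pb G f := rfl

theorem ad_raisesOrder {G : MvPowerSeries (Coord n) K} (hG : G ∈ ordGE (Coord n) K 3) :
    RaisesOrder (ad G) := fun _ _ hf => ordGE_anti (by omega) (pb_mem_ordGE hG hf)

theorem lieExp_mul {G : MvPowerSeries (Coord n) K} (hG : G ∈ ordGE (Coord n) K 3)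
    (f g : MvPowerSeries (Coord n) K) :
    lieExp (ad G) (f * g) = lieExp (ad G) f * lieExp (ad G) g :=
  (ad_raisesOrder hG).lieExp_bilin (B := fun f g => f * g) (s := 0) add_mul mul_add
    (fun _ _ _ => smul_mul_assoc _ _ _) (fun _ _ _ => mul_smul_comm _ _ _)
    (fun f g => by rw [ad_apply, ad_apply, ad_apply, pb_mul_right]; ring)
    (fun _ _ _ hf _ hg => mul_mem_ordGE hf hg) f g

theorem lieExp_pb {G : MvPowerSeries (Coord n) K} (hG : G ∈ ordGE (Coord n) K 3)
    (f g : MvPowerSeries (Coord n) K) :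
    lieExp (ad G) (pb f g) = pb (lieExp (ad G) f) (lieExp (ad G) g) :=
  (ad_raisesOrder hG).lieExp_bilin (B := pb) (s := 2) pb_add_left pb_add_right
    pb_smul_left pb_smul_right (fun f g => pb_jacobi G f g)
    (fun _ _ _ hf _ hg => pb_mem_ordGE hf hg) f g

theorem ad_neg (G : MvPowerSeries (Coord n) K) : ad (-G) = -ad G := by
  ext1 f
  rw [LinearMap.neg_apply, ad_apply, ad_apply, pb_neg_left]

theorem lieExp_one {G : MvPowerSeries (Coord n) K} (hG : G ∈ ordGE (Coord n) K 3) :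
    lieExp (ad G) 1 = 1 := by
  rw [← sub_eq_zero]
  refine eq_zero_of_forall_mem_ordGE fun N => ordGE_anti (Nat.le_succ N) ?_
  have h := (ad_raisesOrder hG).lieExp_sub_mem (N + 1) 1
  rw [Finset.sum_range_succ', divPow_zero, Finset.sum_eq_zero, zero_add] at h
  · exact h
  · intro k _
    rw [divPow, LinearMap.smul_apply, pow_succ, Module.End.mul_apply, ad_apply, pb,
      Derivation.map_one_eq_zero, map_zero, smul_zero]

/-- The time one map of the Hamiltonian flow of a series of order at least three. -/
noncomputable def flow {G : MvPowerSeries (Coord n) K} (hG : G ∈ ordGE (Coord n) K 3) :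
    MvPowerSeries (Coord n) K ≃ₐ[K] MvPowerSeries (Coord n) K :=
  AlgEquiv.ofLinearEquiv
    { toFun := lieExp (ad G)
      map_add' := lieExp_add
      map_smul' := lieExp_smul
      invFun := lieExp (ad (-G))
      left_inv := fun f => by
        have := (ad_raisesOrder (Submodule.neg_mem _ hG)).lieExp_lieExp_neg f
        rwa [← ad_neg, neg_neg] at this
      right_inv := fun f => by
        have := (ad_raisesOrder hG).lieExp_lieExp_neg f
        rwa [← ad_neg] at this }
    (lieExp_one hG) (lieExp_mul hG)

theorem flow_apply {G : MvPowerSeries (Coord n) K} (hG : G ∈ ordGE (Coord n) K 3)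
    (f : MvPowerSeries (Coord n) K) : flow hG f = lieExp (ad G) f := rfl

theorem isSymplecticAut_flow {G : MvPowerSeries (Coord n) K} (hG : G ∈ ordGE (Coord n) K 3) :
    IsSymplecticAut (flow hG) where
  map_pb := lieExp_pb hG
  map_mem _ _ hf := (ad_raisesOrder hG).lieExp_mem hf
  symm_mem _ _ hf := (ad_raisesOrder (Submodule.neg_mem _ hG)).lieExp_mem hf

/-- In the telescoped difference one factor is {g, ·}, which brings the order to N when applied to
H, and each of the k other factors raises it by at least one. -/
theorem ad_pow_add_sub_mem {N : ℕ} {G g H : MvPowerSeries (Coord n) K}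
    (hG : G ∈ ordGE (Coord n) K 3) (hN : 3 ≤ N) (hg : g ∈ ordGE (Coord n) K N)
    (hH : H ∈ ordGE (Coord n) K 2) (k : ℕ) :
    ((ad (G + g)) ^ (k + 1)) H - ((ad G) ^ (k + 1)) H ∈ ordGE (Coord n) K (N + k) := by
  have hk : ∀ k, ((ad G) ^ k) H ∈ ordGE (Coord n) K (2 + k) := by
    intro k
    induction k with
    | zero => simpa using hH
    | succ k ih =>
      rw [pow_succ', Module.End.mul_apply]
      exact ad_raisesOrder hG _ _ ih
  induction k with
  | zero =>
    simp only [zero_add, pow_one, ad_apply, pb_add_left, add_sub_cancel_left]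
    exact ordGE_anti (by omega) (pb_mem_ordGE hg hH)
  | succ k ih =>
    rw [pow_succ', pow_succ' (ad G), Module.End.mul_apply, Module.End.mul_apply]
    have hGg : G + g ∈ ordGE (Coord n) K 3 := Ideal.add_mem _ hG (ordGE_anti hN hg)
    have h1 := ad_raisesOrder hGg _ _ ih
    have h2 := pb_mem_ordGE hg (hk (k + 1))
    have := Ideal.add_mem _ h1 (ordGE_anti (show N + k + 1 ≤ _ by omega) h2)
    rw [← add_assoc]
    convert this using 1
    rw [map_sub, ad_apply, ad_apply, ad_apply, pb_add_left, pb_add_left]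
    ring

/-- First order expansion of the time one map in the generating function. -/
theorem lieExp_add_sub_mem {N : ℕ} {G g H : MvPowerSeries (Coord n) K}
    (hG : G ∈ ordGE (Coord n) K 3) (hN : 3 ≤ N) (hg : g ∈ ordGE (Coord n) K N)
    (hH : H ∈ ordGE (Coord n) K 2) :
    lieExp (ad (G + g)) H - lieExp (ad G) H - pb g H ∈ ordGE (Coord n) K (N + 1) := by
  have hGg : G + g ∈ ordGE (Coord n) K 3 := Ideal.add_mem _ hG (ordGE_anti hN hg)
  have h1 := (ad_raisesOrder hGg).lieExp_sub_mem (N + 1) H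
  have h2 := (ad_raisesOrder hG).lieExp_sub_mem (N + 1) H
  obtain ⟨M, rfl⟩ : ∃ M, N = M + 1 := ⟨N - 1, by omega⟩
  have h3 : ∑ k ∈ Finset.range (M + 1 + 1), divPow (ad (G + g)) k H
      - ∑ k ∈ Finset.range (M + 1 + 1), divPow (ad G) k H - pb g H
      ∈ ordGE (Coord n) K (M + 1 + 1) := by
    simp only [Finset.sum_range_succ' _ (M + 1), Finset.sum_range_succ' _ M, divPow_zero,
      zero_add, divPow_one, ad_apply, pb_add_left]
    have : ∑ k ∈ Finset.range M, (divPow (ad (G + g)) (k + 1 + 1) H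
        - divPow (ad G) (k + 1 + 1) H) ∈ ordGE (Coord n) K (M + 1 + 1) := by
      refine Ideal.sum_mem _ fun k _ => ?_
      rw [divPow, divPow, LinearMap.smul_apply, LinearMap.smul_apply, ← smul_sub]
      exact smul_mem_ordGE (ordGE_anti (by omega) (ad_pow_add_sub_mem hG hN hg hH (k + 1))) _
    rw [Finset.sum_sub_distrib] at this
    convert this using 1
    ring
  have := Ideal.add_mem _ (Ideal.sub_mem _ h1 h2) h3
  convert this using 1
  ring

/-- The operator `{q, ·}` is semisimple, degree by degree. -/
def IsSemisimpleHam (q : MvPowerSeries (Coord n) K) : Prop :=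
  ∀ N, ∀ R : MvPowerSeries (Coord n) K, pb q R ∈ ordGE (Coord n) K N →
    ∃ w ∈ ordGE (Coord n) K N, pb q (R - pb q w) = 0

variable {q : MvPowerSeries (Coord n) K}

theorem pb_quadratic_mem (hq : q ∈ ordGE (Coord n) K 2) {N : ℕ} {f : MvPowerSeries (Coord n) K}
    (hf : f ∈ ordGE (Coord n) K N) : pb q f ∈ ordGE (Coord n) K N :=
  ordGE_anti (by omega) (pb_mem_ordGE hq hf)

/-- Adding w to the generator changes the transformed series by {w, H}, which is -{q, w} up to order
N + 1. Semisimplicity supplies a w for which the remainder commutes with q to that order. -/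
theorem normalization_step (hq : q ∈ ordGE (Coord n) K 2) (hs : IsSemisimpleHam q)
    {H G : MvPowerSeries (Coord n) K} (hH : H - q ∈ ordGE (Coord n) K 3)
    (hG : G ∈ ordGE (Coord n) K 3) {N : ℕ} (hN : 3 ≤ N)
    (h : pb q (lieExp (ad G) H) ∈ ordGE (Coord n) K N) :
    ∃ g ∈ ordGE (Coord n) K N, pb q (lieExp (ad (G + g)) H) ∈ ordGE (Coord n) K (N + 1) := by
  obtain ⟨w, hw, hw0⟩ := hs N _ h
  refine ⟨w, hw, ?_⟩
  have hH2 : H ∈ ordGE (Coord n) K 2 := by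
    simpa using Ideal.add_mem _ (ordGE_anti (by norm_num) hH) hq
  have h1 := lieExp_add_sub_mem hG hN hw hH2
  have h2 : pb w (H - q) ∈ ordGE (Coord n) K (N + 1) := ordGE_anti (by omega) (pb_mem_ordGE hw hH)
  have h3 := pb_quadratic_mem hq (Ideal.add_mem _ h1 h2)
  have e : lieExp (ad (G + w)) H = (lieExp (ad (G + w)) H - lieExp (ad G) H - pb w H
      + pb w (H - q)) + (lieExp (ad G) H - pb q w) := by
    rw [pb_sub_right, pb_antisymm w q]
    ring
  rw [e, pb_add_right, hw0, add_zero]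
  exact h3

/-- Formal normalization: a series whose terms of degree less than `N` are already normalized can be
normalized by the flow of a series of order at least `N`. -/
theorem exists_normalization (hq : q ∈ ordGE (Coord n) K 2) (hs : IsSemisimpleHam q)
    {H : MvPowerSeries (Coord n) K} (hH : H - q ∈ ordGE (Coord n) K 3) {N : ℕ} (hN : 3 ≤ N)
    (h : pb q H ∈ ordGE (Coord n) K N) :
    ∃ G, ∃ hG : G ∈ ordGE (Coord n) K 3, G ∈ ordGE (Coord n) K N ∧ pb q (flow hG H) = 0 := by
  have hH2 : H ∈ ordGE (Coord n) K 2 := by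
    simpa using Ideal.add_mem _ (ordGE_anti (by norm_num) hH) hq
  have h0 : lieExp (ad (0 : MvPowerSeries (Coord n) K)) H = H := by
    have h00 : (0 : MvPowerSeries (Coord n) K) ∈ ordGE (Coord n) K 3 := Submodule.zero_mem _
    rw [← sub_eq_zero]
    refine eq_zero_of_forall_mem_ordGE fun N => ordGE_anti (Nat.le_succ N) ?_
    have h := (ad_raisesOrder h00).lieExp_sub_mem (N + 1) H
    rw [Finset.sum_range_succ', divPow_zero, Finset.sum_eq_zero, zero_add] at h
    · exact h
    · intro k _
      rw [divPow, LinearMap.smul_apply, pow_succ, Module.End.mul_apply, ad_apply, pb_zero_left,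
        map_zero, smul_zero]
  -- Generators of order N whose flow normalizes H below degree N + k; the successive corrections
  -- have order N + k.
  let S := fun k => {G : MvPowerSeries (Coord n) K // G ∈ ordGE (Coord n) K N ∧
    pb q (lieExp (ad G) H) ∈ ordGE (Coord n) K (N + k)}
  have step : ∀ k (G : S k), ∃ G' : S (k + 1), G'.1 - G.1 ∈ ordGE (Coord n) K (N + k) := by
    intro k G
    obtain ⟨g, hg, hg'⟩ := normalization_step hq hs hH (ordGE_anti hN G.2.1)
      (le_trans hN (Nat.le_add_right N k)) G.2.2
    exact ⟨⟨G.1 + g, Ideal.add_mem _ G.2.1 (ordGE_anti (Nat.le_add_right N k) hg), hg'⟩,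
      by simpa using hg⟩
  choose next hnext using step
  let s : ∀ k, S k := fun k =>
    Nat.rec ⟨0, Submodule.zero_mem _, by rw [h0]; exact h⟩ (fun k G => next k G) k
  have hs' : ∀ k, (s (k + 1)).1 - (s k).1 ∈ ordGE (Coord n) K (N + k) := fun k => hnext k (s k)
  have hs'' : ∀ k j, (s (k + j)).1 - (s k).1 ∈ ordGE (Coord n) K (N + k) := by
    intro k j
    induction j with
    | zero => simp
    | succ j ih =>
      have := Ideal.add_mem _ ih (ordGE_anti (show N + k ≤ N + (k + j) by omega) (hs' (k + j)))
      convert this using 1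
      change (s (k + j + 1)).1 - (s k).1 = _
      ring
  -- The limit of the generators: coefficients of degree e no longer change from `s e` on.
  let G : MvPowerSeries (Coord n) K := fun m => coeff m (s m.degree).1
  have hGs : ∀ k, G - (s k).1 ∈ ordGE (Coord n) K (N + k) := by
    intro k m hm
    rw [map_sub]
    change coeff m (s m.degree).1 - _ = 0
    rcases le_total m.degree k with hk | hk
    · obtain ⟨j, rfl⟩ := Nat.exists_eq_add_of_le hk
      rw [← neg_sub, ← map_sub, hs'' _ j m (by omega), neg_zero]
    · obtain ⟨j, hj⟩ := Nat.exists_eq_add_of_le hk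
      rw [hj, ← map_sub, hs'' _ j m hm]
  have hGN : G ∈ ordGE (Coord n) K N := by
    simpa using Ideal.add_mem _ (hGs 0) (s 0).2.1
  refine ⟨G, ordGE_anti hN hGN, hGN, ?_⟩
  rw [flow_apply]
  refine eq_zero_of_forall_mem_ordGE fun k => ordGE_anti (show k ≤ N + k by omega) ?_
  have h1 := lieExp_add_sub_mem (ordGE_anti hN (s k).2.1) (show 3 ≤ N + k by omega) (hGs k) hH2
  rw [add_sub_cancel] at h1
  have h2 : pb (G - (s k).1) H ∈ ordGE (Coord n) K (N + k) :=
    ordGE_anti (by omega) (pb_mem_ordGE (hGs k) hH2)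
  have h3 := pb_quadratic_mem hq (Ideal.add_mem _ (ordGE_anti (Nat.le_succ _) h1) h2)
  rw [sub_add_cancel, pb_sub_right] at h3
  simpa using Ideal.add_mem _ h3 (s k).2.2

theorem flow_sub_mem {N k : ℕ} {G f : MvPowerSeries (Coord n) K} (hG : G ∈ ordGE (Coord n) K 3)
    (hGN : G ∈ ordGE (Coord n) K (N + 2)) (hf : f ∈ ordGE (Coord n) K k) :
    flow hG f - f ∈ ordGE (Coord n) K (N + k) := by
  rw [flow_apply]
  have h := (ad_raisesOrder hG).lieExp_sub_mem (N + k + 1) f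
  rw [Finset.sum_range_succ', divPow_zero] at h
  have h2 : ∑ i ∈ Finset.range (N + k), divPow (ad G) (i + 1) f ∈ ordGE (Coord n) K (N + k) := by
    refine Ideal.sum_mem _ fun i _ => ?_
    rw [divPow, LinearMap.smul_apply, pow_succ, Module.End.mul_apply]
    have h1 : ad G f ∈ ordGE (Coord n) K (N + k) := ordGE_anti (by omega) (pb_mem_ordGE hGN hf)
    have h3 := (ad_raisesOrder hG).divPow_mem i h1
    rw [divPow, LinearMap.smul_apply] at h3
    -- One bracket with G has been applied to f first, so the divided power carries i! where (i +
    -- 1)! is wanted.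
    have h4 := smul_mem_ordGE (smul_mem_ordGE h3 (i.factorial : K)) ((i + 1).factorial : K)⁻¹
    rw [smul_smul (i.factorial : K), mul_inv_cancel₀ (by exact_mod_cast i.factorial_ne_zero),
      one_smul] at h4
    exact ordGE_anti (by omega) h4
  have := Ideal.add_mem _ (ordGE_anti (Nat.le_succ _) h) h2
  convert this using 1
  ring

/-- Solution of the homological equation for a Hamiltonian in normal form, up to order `N`. -/
theorem exists_homological_solution (hq : q ∈ ordGE (Coord n) K 2) (hs : IsSemisimpleHam q)
    {F P Gp : MvPowerSeries (Coord n) K} (hF : F - q ∈ ordGE (Coord n) K 3) {d : ℕ}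
    (h : P + pb Gp F ∈ ordGE (Coord n) K (d + 1)) (k : ℕ) :
    ∃ G, G - Gp ∈ ordGE (Coord n) K (d + 1) ∧
      pb q (P + pb G F) ∈ ordGE (Coord n) K (d + 1 + k) := by
  induction k with
  | zero => exact ⟨Gp, by simp, pb_quadratic_mem hq h⟩
  | succ k ih =>
    obtain ⟨G, hG, hG'⟩ := ih
    obtain ⟨w, hw, hw0⟩ := hs _ _ hG'
    refine ⟨G + w, ?_, ?_⟩
    · have := Ideal.add_mem _ hG (ordGE_anti (Nat.le_add_right _ k) hw)
      convert this using 1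
      ring
    · have e : P + pb (G + w) F = (P + pb G F - pb q w) + pb w (F - q) := by
        rw [pb_add_left, pb_sub_right, pb_antisymm w q]
        ring
      rw [e, pb_add_right, hw0, zero_add]
      exact pb_quadratic_mem hq (ordGE_anti (by omega) (pb_mem_ordGE hw hF))

/-- Three flows are composed: `G₀` normalizes H, `c • G` removes c P, and `G₃` cleans up from order
2d - 1 on. The bracket of G and P starts in degree 2d - 2. Replacing them there by `Gp` and P costs
one further order, so below degree 2d - 1 the quadratic coefficient in c does not depend on H. The
series A and B depend on H, but neither on c nor on R. -/
theorem exists_normalForms_of_perturbation (hq : q ∈ ordGE (Coord n) K 2) (hs : IsSemisimpleHam q)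
    {H P Gp : MvPowerSeries (Coord n) K} (hH : H - q ∈ ordGE (Coord n) K 3) {d : ℕ} (hd : 3 ≤ d)
    (hP : P ∈ ordGE (Coord n) K d) (hGp : Gp ∈ ordGE (Coord n) K d) (hGP : pb q Gp = P)
    (hn : pb q (pb Gp P) = 0) :
    ∃ A B : MvPowerSeries (Coord n) K, ∀ (c : K), ∀ R ∈ ordGE (Coord n) K (2 * d - 1),
      ∃ e : MvPowerSeries (Coord n) K ≃ₐ[K] MvPowerSeries (Coord n) K, IsSymplecticAut e ∧
        pb q (e (H + c • P + R)) = 0 ∧ e (H + c • P + R) - q ∈ ordGE (Coord n) K 3 ∧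
        e (H + c • P + R) - (A + c • B + (c ^ 2 / 2) • pb Gp P)
          ∈ ordGE (Coord n) K (2 * d - 1) := by
  have hq0 : pb q H ∈ ordGE (Coord n) K 3 := by
    have := pb_quadratic_mem hq hH
    rwa [pb_sub_right, pb_self, sub_zero] at this
  obtain ⟨G₀, hG₀, -, hF₀⟩ := exists_normalization hq hs hH le_rfl hq0
  set F := flow hG₀ H with hF
  set P' := flow hG₀ P with hP'
  have hH2 : H ∈ ordGE (Coord n) K 2 := by
    simpa using Ideal.add_mem _ (ordGE_anti (by norm_num) hH) hq
  have hFq : F - q ∈ ordGE (Coord n) K 3 := by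
    have := Ideal.add_mem _ (flow_sub_mem (N := 1) hG₀ hG₀ hH2) hH
    simpa using this
  have hPP : P' - P ∈ ordGE (Coord n) K (d + 1) :=
    ordGE_anti (by omega) (flow_sub_mem (N := 1) hG₀ hG₀ hP)
  have hF2 : F ∈ ordGE (Coord n) K 2 := by
    simpa using Ideal.add_mem _ (ordGE_anti (by norm_num) hFq) hq
  have hP'd : P' ∈ ordGE (Coord n) K d := by
    simpa using Ideal.add_mem _ (ordGE_anti (by omega) hPP) hP
  have hstart : P' + pb Gp F ∈ ordGE (Coord n) K (d + 1) := by
    have h1 : pb Gp (F - q) ∈ ordGE (Coord n) K (d + 1) :=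
      ordGE_anti (by omega) (pb_mem_ordGE hGp hFq)
    have := Ideal.add_mem _ hPP h1
    convert this using 1
    rw [pb_sub_right, pb_antisymm Gp q, hGP]
    ring
  -- The count d - 2 makes the homological equation hold up to order d + 1 + (d - 2) = 2d - 1.
  obtain ⟨G, hG, hG'⟩ := exists_homological_solution hq hs hFq hstart (d - 2)
  have hGd : G ∈ ordGE (Coord n) K d := by
    simpa using Ideal.add_mem _ (ordGE_anti (by omega) hG) hGp
  set B := P' + pb G F with hB
  have hBd : B ∈ ordGE (Coord n) K (d + 1) := by
    have h1 : pb (G - Gp) F ∈ ordGE (Coord n) K (d + 1) :=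
      ordGE_anti (by omega) (pb_mem_ordGE hG hF2)
    have := Ideal.add_mem _ h1 hstart
    convert this using 1
    rw [pb_sub_left]
    ring
  refine ⟨F, B, fun c R hR => ?_⟩
  have hcG : c • G ∈ ordGE (Coord n) K 3 := ordGE_anti hd (smul_mem_ordGE hGd c)
  set R' := flow hG₀ R with hR'
  have hR'm : R' ∈ ordGE (Coord n) K (2 * d - 1) := (isSymplecticAut_flow hG₀).map_mem _ _ hR
  set H₁ := flow hG₀ (H + c • P + R) with hH₁
  have eH₁ : H₁ = F + c • P' + R' := by rw [hH₁, map_add, map_add, map_smul]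
  set T := F + c • B + (c ^ 2 / 2) • pb Gp P with hT
  -- second order expansion of the flow of `c • G`
  have hexp : flow hcG H₁ - T ∈ ordGE (Coord n) K (2 * d - 1) := by
    have a1 : flow hcG R' ∈ ordGE (Coord n) K (2 * d - 1) :=
      (isSymplecticAut_flow hcG).map_mem _ _ hR'm
    have two : (2 : K) ≠ 0 := two_ne_zero
    have hcGd : c • G ∈ ordGE (Coord n) K d := smul_mem_ordGE hGd c
    have hcGd' : c • G ∈ ordGE (Coord n) K (d - 2 + 2) := ordGE_anti (by omega) hcGd
    -- Cubic and higher terms in G have order at least 3(d - 2) + k. For k = 2 this is 3d - 4, which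
    -- is at least 2d - 1 precisely because d ≥ 3.
    have expand : ∀ k, ∀ f ∈ ordGE (Coord n) K k,
        flow hcG f - (f + c • pb G f + (c ^ 2 / 2) • pb G (pb G f))
          ∈ ordGE (Coord n) K (3 * (d - 2) + k) := by
      intro k f hf
      rw [flow_apply]
      have h := (ad_raisesOrder hcG).lieExp_sub_mem (3 * (d - 2) + k + 3) f
      simp only [Finset.sum_range_succ' _ (3 * (d - 2) + k + 2),
        Finset.sum_range_succ' _ (3 * (d - 2) + k + 1), Finset.sum_range_succ' _ (3 * (d - 2) + k),
        divPow_zero, zero_add, divPow_one, ad_apply, pb_smul_left] at h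
      have e2 : divPow (ad (c • G)) (1 + 1) f = (c ^ 2 / 2) • pb G (pb G f) := by
        simp only [divPow, LinearMap.smul_apply, pow_succ, pow_zero, one_mul, Module.End.mul_apply,
          ad_apply, pb_smul_left, pb_smul_right, smul_smul, Nat.factorial]
        congr 1
        push_cast
        ring
      rw [e2] at h
      have h2 : ∑ i ∈ Finset.range (3 * (d - 2) + k), divPow (ad (c • G)) (i + 1 + 1 + 1) f
          ∈ ordGE (Coord n) K (3 * (d - 2) + k) := by
        refine Ideal.sum_mem _ fun i _ => ?_
        have h1 : ∀ j, ((ad (c • G)) ^ j) f ∈ ordGE (Coord n) K (j * (d - 2) + k) := by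
          intro j
          induction j with
          | zero => simpa using hf
          | succ j ih =>
            rw [pow_succ', Module.End.mul_apply]
            refine ordGE_anti ?_ (pb_mem_ordGE hcGd ih)
            rw [add_mul]
            omega
        refine smul_mem_ordGE (ordGE_anti ?_ (h1 _)) _
        have : 3 * (d - 2) ≤ (i + 1 + 1 + 1) * (d - 2) := Nat.mul_le_mul_right _ (by omega)
        omega
      have := Ideal.add_mem _ (ordGE_anti (show 3 * (d - 2) + k ≤ _ by omega) h) h2
      convert this using 1
      ring
    have a2 := ordGE_anti (show 2 * d - 1 ≤ _ by omega) (expand 2 F hF2)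
    have a3 := smul_mem_ordGE (ordGE_anti (show 2 * d - 1 ≤ _ by omega) (expand d P' hP'd)) c
    have a4 : pb G (pb G P') ∈ ordGE (Coord n) K (2 * d - 1) :=
      ordGE_anti (by omega) (pb_mem_ordGE hGd (pb_mem_ordGE hGd hP'd))
    have a5 : pb G B ∈ ordGE (Coord n) K (2 * d - 1) :=
      ordGE_anti (by omega) (pb_mem_ordGE hGd hBd)
    have a6 : pb G P' - pb Gp P ∈ ordGE (Coord n) K (2 * d - 1) := by
      have b1 : pb (G - Gp) P' ∈ ordGE (Coord n) K (2 * d - 1) :=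
        ordGE_anti (by omega) (pb_mem_ordGE hG hP'd)
      have b2 : pb Gp (P' - P) ∈ ordGE (Coord n) K (2 * d - 1) :=
        ordGE_anti (by omega) (pb_mem_ordGE hGp hPP)
      have := Ideal.add_mem _ b1 b2
      convert this using 1
      rw [pb_sub_left, pb_sub_right]
      ring
    have key := Ideal.add_mem _ (Ideal.add_mem _ a1 a2) (Ideal.add_mem _ a3 (Ideal.add_mem _
      (smul_mem_ordGE a4 (c * (c ^ 2 / 2))) (Ideal.add_mem _ (smul_mem_ordGE a5 (c ^ 2 / 2))
        (smul_mem_ordGE a6 (c ^ 2 / 2)))))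
    convert key using 1
    -- The bracket {G, {G, F}} is {G, B} - {G, P'}, so half of the c²{G, P'} coming from the
    -- perturbation is cancelled and (c²/2){G, P'} survives.
    have eGF : pb G F = B - P' := by rw [hB]; ring
    rw [eH₁, map_add, map_add, map_smul, hT, eGF, pb_sub_right]
    simp only [smul_eq_C_mul, map_mul]
    have hC : (C (c ^ 2 / 2) : MvPowerSeries (Coord n) K) * 2 = C c * C c := by
      rw [← map_ofNat (C (σ := Coord n) (R := K)) 2, ← map_mul, ← map_mul]
      congr 1
      field_simp
    linear_combination (-pb G P') * hC
  have hT0 : pb q T ∈ ordGE (Coord n) K (2 * d - 1) := by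
    rw [hT, pb_add_right, pb_add_right, hF₀, pb_smul_right, pb_smul_right, hn, smul_zero, add_zero,
      zero_add]
    exact smul_mem_ordGE (ordGE_anti (by omega) hG') c
  have hTq : T - q ∈ ordGE (Coord n) K 3 := by
    have b1 : c • B ∈ ordGE (Coord n) K 3 := smul_mem_ordGE (ordGE_anti (by omega) hBd) c
    have b2 : (c ^ 2 / 2) • pb Gp P ∈ ordGE (Coord n) K 3 :=
      smul_mem_ordGE (ordGE_anti (by omega) (pb_mem_ordGE hGp hP)) _
    have := Ideal.add_mem _ hFq (Ideal.add_mem _ b1 b2)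
    convert this using 1
    rw [hT]
    ring
  set H₂ := flow hcG H₁ with hH₂
  have hH₂q : H₂ - q ∈ ordGE (Coord n) K 3 := by
    simpa using Ideal.add_mem _ (ordGE_anti (by omega) hexp) hTq
  have hH₂0 : pb q H₂ ∈ ordGE (Coord n) K (2 * d - 1) := by
    have := Ideal.add_mem _ (pb_quadratic_mem hq hexp) hT0
    rwa [← pb_add_right, sub_add_cancel] at this
  -- T is already normalized below degree 2d - 1, so the last generator has order 2d - 1 and leaves
  -- the lower degrees unchanged.
  obtain ⟨G₃, hG₃, hG₃N, h₃⟩ := exists_normalization hq hs hH₂q (show 3 ≤ 2 * d - 1 by omega) hH₂0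
  have hH₂2 : H₂ ∈ ordGE (Coord n) K 2 := by
    simpa using Ideal.add_mem _ (ordGE_anti (by norm_num) hH₂q) hq
  have hG₃N' : G₃ ∈ ordGE (Coord n) K ((2 * d - 3) + 2) := ordGE_anti (by omega) hG₃N
  have hfin : flow hG₃ H₂ - H₂ ∈ ordGE (Coord n) K (2 * d - 1) :=
    ordGE_anti (by omega) (flow_sub_mem hG₃ hG₃N' hH₂2)
  refine ⟨((flow hG₀).trans (flow hcG)).trans (flow hG₃),
    ((isSymplecticAut_flow hG₀).trans (isSymplecticAut_flow hcG)).trans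
      (isSymplecticAut_flow hG₃), h₃, ?_, ?_⟩
  · change flow hG₃ H₂ - q ∈ _
    simpa using Ideal.add_mem _ (ordGE_anti (by omega) hfin) hH₂q
  · change flow hG₃ H₂ - T ∈ _
    simpa using Ideal.add_mem _ hfin hexp

end Normalization

/-! ### Series in the actions and uniqueness of the normal form -/

section Actions

variable {n : ℕ} {K : Type*} [Field K] [CharZero K]

/-- The action variable `x_j y_j`. -/
noncomputable def act (K : Type*) [Field K] (j : Fin n) : MvPowerSeries (Coord n) K :=
  X (.inl j) * X (.inr j)

/-- The quadratic form `∑ μ_j x_j y_j`. -/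
noncomputable def diagQuad (μ : Fin n → K) : MvPowerSeries (Coord n) K := ∑ j, μ j • act K j

/-- The exponents of `x_j` and `y_j` agree in every term. -/
def Balanced (f : MvPowerSeries (Coord n) K) : Prop :=
  ∀ m : Coord n →₀ ℕ, coeff m f ≠ 0 → ∀ j, m (.inl j) = m (.inr j)

theorem coeff_X_mul_pderiv {σ : Type*} (i : σ) (f : MvPowerSeries σ K) (m : σ →₀ ℕ) :
    coeff m (X i * pderiv K i f) = m i * coeff m f := by
  classical
  rw [X, coeff_monomial_mul]
  split_ifs with h
  · rw [coeff_pderiv, tsub_add_cancel_of_le h, one_mul, mul_comm]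
    have h1 : 1 ≤ m i := by simpa using h i
    simp only [Finsupp.tsub_apply, Finsupp.single_eq_same]
    rw [Nat.cast_sub h1]
    simp
  · have h1 : m i = 0 := by
      by_contra h0
      exact h (Finsupp.single_le_iff.mpr (Nat.one_le_iff_ne_zero.mpr h0))
    simp [h1]

theorem pb_act (j : Fin n) (f : MvPowerSeries (Coord n) K) :
    pb (act K j) f = X (.inr j) * pderiv K (.inr j) f - X (.inl j) * pderiv K (.inl j) f := by
  rw [act, pb_mul_left, pb_X_inl, pb_X_inr]
  ring

/-- Each monomial is an eigenvector of {I_j, ·}; its eigenvalue is the weight in the j-th plane. -/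
theorem coeff_pb_act (j : Fin n) (f : MvPowerSeries (Coord n) K) (m : Coord n →₀ ℕ) :
    coeff m (pb (act K j) f) = ((m (.inr j) : K) - m (.inl j)) * coeff m f := by
  rw [pb_act, map_sub, coeff_X_mul_pderiv, coeff_X_mul_pderiv]
  ring

theorem pb_diagQuad (μ : Fin n → K) (f : MvPowerSeries (Coord n) K) :
    pb (diagQuad μ) f = ∑ j, μ j • pb (act K j) f := by
  have h : ∀ s : Finset (Fin n), pb (∑ j ∈ s, μ j • act K j) f = ∑ j ∈ s, μ j • pb (act K j) f := by
    intro s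
    induction s using Finset.induction_on with
    | empty => simp [pb_zero_left]
    | insert a s ha ih =>
      rw [Finset.sum_insert ha, Finset.sum_insert ha, pb_add_left, pb_smul_left, ih]
  exact h _

theorem coeff_pb_diagQuad (μ : Fin n → K) (f : MvPowerSeries (Coord n) K) (m : Coord n →₀ ℕ) :
    coeff m (pb (diagQuad μ) f)
      = (∑ j, μ j * ((m (.inr j) : K) - m (.inl j))) * coeff m f := by
  rw [pb_diagQuad, map_sum, Finset.sum_mul]
  refine Finset.sum_congr rfl fun j _ => ?_
  rw [coeff_smul, coeff_pb_act, mul_assoc]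

theorem act_mem_ordGE (j : Fin n) : act K j ∈ ordGE (Coord n) K 2 :=
  mul_mem_ordGE (X_mem_ordGE _) (X_mem_ordGE _)

theorem diagQuad_mem_ordGE (μ : Fin n → K) : diagQuad μ ∈ ordGE (Coord n) K 2 :=
  Ideal.sum_mem _ fun j _ => smul_mem_ordGE (act_mem_ordGE j) _

theorem isSemisimpleHam_diagQuad (μ : Fin n → K) : IsSemisimpleHam (diagQuad μ) := by
  intro N R hR
  let ω : (Coord n →₀ ℕ) → K := fun m => ∑ j, μ j * ((m (.inr j) : K) - m (.inl j))
  -- Coefficientwise division by the eigenvalue. A zero eigenvalue does no harm, since the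
  -- coefficient is multiplied by it afterwards; below degree N the hypothesis on {q, R} already
  -- gives zero.
  let w : MvPowerSeries (Coord n) K := fun m => if m.degree < N then 0 else coeff m R / ω m
  have hw : ∀ m, coeff m w = if m.degree < N then 0 else coeff m R / ω m := fun m => rfl
  refine ⟨w, fun m hm => by rw [hw, if_pos hm], ?_⟩
  ext m
  rw [coeff_pb_diagQuad, map_sub, coeff_pb_diagQuad, map_zero, hw]
  change ω m * (coeff m R - ω m * _) = 0
  split_ifs with h
  · have := hR m h
    rw [coeff_pb_diagQuad] at this
    rw [mul_zero, sub_zero]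
    exact this
  · by_cases h0 : ω m = 0
    · rw [h0, zero_mul]
    · rw [mul_div_cancel₀ _ h0, sub_self, mul_zero]

theorem balanced_iff {f : MvPowerSeries (Coord n) K} :
    Balanced f ↔ ∀ j, pb (act K j) f = 0 := by
  constructor
  · intro h j
    ext m
    rw [coeff_pb_act, map_zero]
    by_cases h0 : coeff m f = 0
    · rw [h0, mul_zero]
    · rw [h m h0 j, sub_self, zero_mul]
  · intro h m hm j
    have := congrArg (coeff m) (h j)
    rw [coeff_pb_act, map_zero, mul_eq_zero, or_iff_left hm, sub_eq_zero] at this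
    exact_mod_cast this.symm

/-- Non-resonance over an arbitrary field. -/
def IntIndep (μ : Fin n → K) : Prop := ∀ α : Fin n → ℤ, α ≠ 0 → ∑ j, μ j * (α j : K) ≠ 0

theorem balanced_of_pb_diagQuad {μ : Fin n → K} (hμ : IntIndep μ) {f : MvPowerSeries (Coord n) K}
    (h : pb (diagQuad μ) f = 0) : Balanced f := by
  intro m hm j
  have := congrArg (coeff m) h
  rw [coeff_pb_diagQuad, map_zero, mul_eq_zero, or_iff_left hm] at this
  by_contra hj
  refine hμ (fun j => (m (.inr j) : ℤ) - m (.inl j)) (fun h0 => hj ?_) ?_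
  · have h1 := congrFun h0 j
    simp only [Pi.zero_apply] at h1
    omega
  · push_cast
    exact this

theorem X_ne_zero' (i : Coord n) : (X i : MvPowerSeries (Coord n) K) ≠ 0 := by
  classical
  intro h
  have := congrArg (coeff (Finsupp.single i 1)) h
  simp [coeff_X] at this

theorem Balanced.X_mul_pderiv {f : MvPowerSeries (Coord n) K} (h : Balanced f) (j : Fin n) :
    X (.inr j) * pderiv K (.inr j) f = X (.inl j) * pderiv K (.inl j) f := by
  rw [← sub_eq_zero, ← pb_act]
  exact balanced_iff.mp h j

/-- Functions of the actions are in involution. Multiplication by x_j y_j, legitimate in a domain,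
turns partial derivatives into the operators compared in `Balanced.X_mul_pderiv`. -/
theorem Balanced.pb_eq_zero {f g : MvPowerSeries (Coord n) K} (hf : Balanced f) (hg : Balanced g) :
    pb f g = 0 := by
  rw [pb_eq]
  refine Finset.sum_eq_zero fun j _ => ?_
  have h1 := hf.X_mul_pderiv j
  have h2 := hg.X_mul_pderiv j
  have h3 : (X (.inl j) * X (.inr j) : MvPowerSeries (Coord n) K) ≠ 0 :=
    mul_ne_zero (X_ne_zero' _) (X_ne_zero' _)
  apply mul_left_cancel₀ h3
  rw [mul_zero]
  linear_combination (X (.inl j) * pderiv K (.inl j) f) * h2 -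
    (X (.inl j) * pderiv K (.inl j) g) * h1

/-- A series commuting with a normalized Hamiltonian is normalized. -/
theorem balanced_of_pb_eq_zero {μ : Fin n → K} (hμ : IntIndep μ) {F f : MvPowerSeries (Coord n) K}
    (hF : Balanced F) (hFq : F - diagQuad μ ∈ ordGE (Coord n) K 3) (h : pb F f = 0) :
    Balanced f := by
  apply balanced_of_pb_diagQuad hμ
  refine eq_zero_of_forall_mem_ordGE fun N => ?_
  induction N with
  | zero => exact mem_ordGE_zero _
  | succ N ih =>
    -- Induction on the order of {q, f}. The part f - {q, w} is balanced and commutes with F, hence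
    -- so does {q, w}. Therefore {q, f} = {q, {q, w}} = -{F - q, {q, w}}, which gains one order.
    obtain ⟨w, hw, hw0⟩ := isSemisimpleHam_diagQuad μ N f ih
    set q := diagQuad μ
    have h1 := hF.pb_eq_zero (balanced_of_pb_diagQuad hμ hw0)
    rw [pb_sub_right, h, zero_sub, neg_eq_zero] at h1
    rw [pb_sub_right, sub_eq_zero] at hw0
    have hw' : pb q w ∈ ordGE (Coord n) K N := pb_quadratic_mem (diagQuad_mem_ordGE μ) hw
    have h2 : pb (F - q) (pb q w) ∈ ordGE (Coord n) K (N + 1) :=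
      ordGE_anti (by omega) (pb_mem_ordGE hFq hw')
    rw [pb_sub_left, h1, zero_sub, Submodule.neg_mem_iff] at h2
    rwa [hw0]

/-- The derivative of a balanced series with respect to an action variable. -/
noncomputable def actDeriv (j : Fin n) (f : MvPowerSeries (Coord n) K) : MvPowerSeries (Coord n) K :=
  fun m => coeff (m + Finsupp.single (.inr j) 1) (pderiv K (.inl j) f)

theorem coeff_actDeriv (j : Fin n) (f : MvPowerSeries (Coord n) K) (m : Coord n →₀ ℕ) :
    coeff m (actDeriv j f) = coeff (m + Finsupp.single (.inr j) 1) (pderiv K (.inl j) f) := rfl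

theorem Balanced.pderiv_inl {f : MvPowerSeries (Coord n) K} (h : Balanced f) (j : Fin n) :
    pderiv K (.inl j) f = X (.inr j) * actDeriv j f := by
  classical
  ext m
  rw [X, coeff_monomial_mul]
  split_ifs with hm
  · rw [coeff_actDeriv, tsub_add_cancel_of_le hm, one_mul]
  · have h1 : m (.inr j) = 0 := by
      by_contra h0
      exact hm (Finsupp.single_le_iff.mpr (Nat.one_le_iff_ne_zero.mpr h0))
    rw [coeff_pderiv]
    by_contra h2
    have h3 := h _ (left_ne_zero_of_mul h2) j
    simp [h1] at h3

theorem Balanced.pderiv_inr {f : MvPowerSeries (Coord n) K} (h : Balanced f) (j : Fin n) :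
    pderiv K (.inr j) f = X (.inl j) * actDeriv j f := by
  apply mul_left_cancel₀ (X_ne_zero' (K := K) (.inr j))
  rw [h.X_mul_pderiv, h.pderiv_inl]
  ring

theorem Balanced.actDeriv {f : MvPowerSeries (Coord n) K} (h : Balanced f) (j : Fin n) :
    Balanced (actDeriv j f) := by
  classical
  intro m hm i
  rw [coeff_actDeriv, coeff_pderiv] at hm
  have := h _ (left_ne_zero_of_mul hm) i
  by_cases hij : j = i
  · subst hij
    simpa using this
  · simpa [hij] using this

/-- Chain rule for a function of the actions: `actDeriv k` plays the role of ∂f/∂I_k. -/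
theorem Balanced.pb_eq_sum {f : MvPowerSeries (Coord n) K} (h : Balanced f)
    (u : MvPowerSeries (Coord n) K) : pb f u = ∑ k, Birkhoff.actDeriv k f * pb (act K k) u := by
  rw [pb_eq]
  refine Finset.sum_congr rfl fun k _ => ?_
  rw [h.pderiv_inl, h.pderiv_inr, pb_act]
  ring

open Classical in
/-- The part of a series of weight `α`. -/
noncomputable def weightPart (α : Fin n → ℤ) (u : MvPowerSeries (Coord n) K) :
    MvPowerSeries (Coord n) K :=
  fun m => if ∀ j, (m (.inr j) : ℤ) - m (.inl j) = α j then coeff m u else 0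

open Classical in
theorem coeff_weightPart (α : Fin n → ℤ) (u : MvPowerSeries (Coord n) K) (m : Coord n →₀ ℕ) :
    coeff m (weightPart α u) =
      if ∀ j, (m (.inr j) : ℤ) - m (.inl j) = α j then coeff m u else 0 := rfl

theorem weightPart_sum (α : Fin n → ℤ) (u : Fin n → MvPowerSeries (Coord n) K) :
    weightPart α (∑ k, u k) = ∑ k, weightPart α (u k) := by
  ext m
  rw [map_sum, coeff_weightPart]
  split_ifs with h
  · rw [map_sum]
    exact Finset.sum_congr rfl fun k _ => by rw [coeff_weightPart, if_pos h]
  · exact (Finset.sum_eq_zero fun k _ => by rw [coeff_weightPart, if_neg h]).symm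

theorem weightPart_pb_act (α : Fin n → ℤ) (k : Fin n) (u : MvPowerSeries (Coord n) K) :
    weightPart α (pb (act K k) u) = (α k : K) • weightPart α u := by
  ext m
  rw [coeff_smul, coeff_weightPart, coeff_weightPart]
  split_ifs with h
  · rw [coeff_pb_act, ← h k]
    push_cast
    rfl
  · rw [mul_zero]

/-- A balanced series has weight zero, so multiplication by it respects the weight decomposition. -/
theorem Balanced.weightPart_mul {g : MvPowerSeries (Coord n) K} (hg : Balanced g) (α : Fin n → ℤ)
    (u : MvPowerSeries (Coord n) K) : weightPart α (g * u) = g * weightPart α u := by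
  classical
  ext m
  rw [coeff_weightPart, coeff_mul, coeff_mul]
  have hw : ∀ p ∈ Finset.HasAntidiagonal.antidiagonal m, coeff p.1 g ≠ 0 → ∀ j,
      (p.2 (.inr j) : ℤ) - p.2 (.inl j) = (m (.inr j) : ℤ) - m (.inl j) := by
    intro p hp h0 j
    have hb := hg _ h0 j
    have hm := Finset.HasAntidiagonal.mem_antidiagonal.mp hp
    rw [← hm]
    simp only [Finsupp.add_apply]
    omega
  split_ifs with h
  · refine Finset.sum_congr rfl fun p hp => ?_
    by_cases h0 : coeff p.1 g = 0
    · rw [h0, zero_mul, zero_mul]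
    · rw [coeff_weightPart, if_pos fun j => (hw p hp h0 j).trans (h j)]
  · refine (Finset.sum_eq_zero fun p hp => ?_).symm
    by_cases h0 : coeff p.1 g = 0
    · rw [h0, zero_mul]
    · rw [coeff_weightPart, if_neg fun h' => h fun j => (hw p hp h0 j).symm.trans (h' j), mul_zero]

theorem weightPart_smul (α : Fin n → ℤ) (c : K) (u : MvPowerSeries (Coord n) K) :
    weightPart α (c • u) = c • weightPart α u := by
  ext m
  rw [coeff_smul, coeff_weightPart, coeff_weightPart, coeff_smul, mul_ite, mul_zero]

theorem pb_act_X_inl (i j : Fin n) :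
    pb (act K i) (X (.inl j)) = (if i = j then (-1 : K) else 0) • X (.inl j) := by
  rw [pb_act, pderiv_X_of_ne (by simp)]
  split_ifs with h
  · subst h
    simp
  · rw [pderiv_X_of_ne (by simpa using Ne.symm h)]
    simp

theorem balanced_act (k : Fin n) : Balanced (act K k : MvPowerSeries (Coord n) K) := by
  rw [balanced_iff]
  intro j
  rw [pb_act, act]
  by_cases hjk : j = k
  · subst hjk
    simp [Derivation.leibniz, pderiv_X_self, pderiv_X_of_ne]
    ring
  · simp [Derivation.leibniz, pderiv_X_of_ne, Ne.symm hjk]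

/-- An endomorphism of the Poisson algebra that maps the action variables to balanced series
permutes the action variables up to sign. -/
theorem exists_perm_of_balanced (Ψ : MvPowerSeries (Coord n) K →ₐ[K] MvPowerSeries (Coord n) K)
    (hpb : ∀ f g, Ψ (pb f g) = pb (Ψ f) (Ψ g))
    (hord : ∀ N, ∀ f ∈ ordGE (Coord n) K N, Ψ f ∈ ordGE (Coord n) K N)
    (hbal : ∀ i, Balanced (Ψ (act K i))) :
    ∃ (π : Equiv.Perm (Fin n)) (s : Fin n → K), (∀ i, s i = 1 ∨ s i = -1) ∧
      ∀ i, Ψ (act K i) = s i • act K (π i) := by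
  classical
  have key : ∀ j, ∃ (k : Fin n) (s : K), (s = 1 ∨ s = -1) ∧
      ∀ i, actDeriv k (Ψ (act K i)) = if i = j then C s else 0 := by
    intro j
    set u := Ψ (X (.inl j)) with hu
    set v := Ψ (X (.inr j)) with hv
    have huv : pb u v = 1 := by
      rw [← hpb, pb_X_inl, pderiv_X_self, map_one]
    -- The series u is an eigenvector of {Ψ(I_i), ·} with eigenvalue -1 if i = j and 0 otherwise. In
    -- its component of weight ±e_k only the k-th derivative of Ψ(I_i) acts, and cancelling the
    -- nonzero component determines that derivative.
    have main : ∀ (α : Fin n → ℤ) (k : Fin n) (s : ℤ), (s = 1 ∨ s = -1) → α = Pi.single k s →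
        weightPart α u ≠ 0 → ∃ (k : Fin n) (s : K), (s = 1 ∨ s = -1) ∧
          ∀ i, actDeriv k (Ψ (act K i)) = if i = j then C s else 0 := by
      intro α k s hs hα hne
      refine ⟨k, -(s : K), by rcases hs with rfl | rfl <;> simp, fun i => ?_⟩
      have e1 : pb (Ψ (act K i)) u = (if i = j then (-1 : K) else 0) • u := by
        rw [hu, ← hpb, pb_act_X_inl, map_smul]
      rw [(hbal i).pb_eq_sum] at e1
      have e2 := congrArg (weightPart α) e1
      rw [weightPart_sum, weightPart_smul] at e2
      simp only [((hbal i).actDeriv _).weightPart_mul, weightPart_pb_act] at e2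
      rw [Finset.sum_eq_single k, hα, Pi.single_eq_same, ← hα] at e2
      · have hs1 : (s : K) * s = 1 := by rcases hs with rfl | rfl <;> simp
        have hC : (C (s : K) : MvPowerSeries (Coord n) K) * C (s : K) = 1 := by
          rw [← map_mul, hs1, map_one]
        apply mul_right_cancel₀ hne
        rw [smul_eq_C_mul, smul_eq_C_mul] at e2
        split_ifs at e2 ⊢ with hij
        · simp only [map_neg, map_one] at e2 ⊢
          linear_combination (C (s : K)) * e2 - actDeriv k (Ψ (act K i)) * weightPart α u * hC
        · simp only [map_zero, zero_mul] at e2 ⊢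
          linear_combination (C (s : K)) * e2 - actDeriv k (Ψ (act K i)) * weightPart α u * hC
      · intro b _ hb
        rw [hα, Pi.single_eq_of_ne hb]
        simp
      · simp
    -- Some weight ±e_k does occur: without linear terms u would have order 2, and {u, v} could not
    -- be 1.
    have hlin : ∃ i : Coord n, coeff (Finsupp.single i 1) u ≠ 0 := by
      by_contra hcon
      push Not at hcon
      have h0 : u ∈ ordGE (Coord n) K 2 := by
        have h1 := hord 1 _ (X_mem_ordGE (R := K) (Sum.inl j))
        intro m hm
        rcases Nat.lt_or_ge m.degree 1 with h | h
        · exact h1 m h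
        · have hm1 : m.degree = 1 := by omega
          have : m ∈ Set.range (fun a : Coord n => Finsupp.single a 1) := by
            rw [Finsupp.range_single_one]
            exact hm1
          obtain ⟨i, rfl⟩ := this
          exact hcon i
      have h2 := pb_mem_ordGE h0 (hord 1 _ (X_mem_ordGE (R := K) (Sum.inr j)))
      rw [← hv, huv] at h2
      simpa using mem_ordGE_one.mp h2
    obtain ⟨i, hi⟩ := hlin
    rcases i with k | k
    · refine main (Pi.single k (-1)) k (-1) (Or.inr rfl) rfl fun h => hi ?_
      have := congrArg (coeff (Finsupp.single (Sum.inl k) 1)) h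
      rw [coeff_weightPart, if_pos] at this
      · simpa using this
      · intro l
        by_cases hl : l = k
        · subst hl; simp
        · simp [hl]
    · refine main (Pi.single k 1) k 1 (Or.inl rfl) rfl fun h => hi ?_
      have := congrArg (coeff (Finsupp.single (Sum.inr k) 1)) h
      rw [coeff_weightPart, if_pos] at this
      · simpa using this
      · intro l
        by_cases hl : l = k
        · subst hl; simp
        · simp [hl]
  choose π s hs hπ using key
  have hs0 : ∀ j, s j ≠ 0 := fun j => by rcases hs j with h | h <;> simp [h]
  have hinj : Function.Injective π := by
    intro j j' hjj
    by_contra hne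
    have h1 := hπ j j
    have h2 := hπ j' j
    rw [if_pos rfl, hjj] at h1
    rw [if_neg hne, h1] at h2
    have := congrArg constantCoeff h2
    simp [hs0] at this
  refine ⟨Equiv.ofBijective π (Finite.injective_iff_bijective.mp hinj), s, hs, fun i => ?_⟩
  rw [Equiv.ofBijective_apply, ← sub_eq_zero]
  -- The difference is balanced, has vanishing x-derivatives and no constant term, so it is zero.
  set g := Ψ (act K i) - s i • act K (π i) with hg
  have hgb : Balanced g := by
    rw [balanced_iff]
    intro j
    rw [hg, pb_sub_right, pb_smul_right, balanced_iff.mp (balanced_act _) j,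
      balanced_iff.mp (hbal i) j, smul_zero, sub_zero]
  have hpd : ∀ k, pderiv K (.inl k) g = 0 := by
    intro k
    obtain ⟨j, rfl⟩ := (Finite.injective_iff_bijective.mp hinj).2 k
    rw [hg, map_sub, (hbal i).pderiv_inl, hπ, Derivation.map_smul, act, Derivation.leibniz,
      pderiv_X_of_ne (show (Sum.inr (π i) : Coord n) ≠ .inl (π j) by simp)]
    split_ifs with hij
    · subst hij
      rw [pderiv_X_self, smul_eq_C_mul]
      simp
      ring
    · rw [pderiv_X_of_ne (by simpa using fun h => hij (hinj h))]
      simp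
  ext m
  rw [map_zero]
  by_contra hm
  have hb := hgb m hm
  by_cases hx : ∃ k, m (.inl k) ≠ 0
  · obtain ⟨k, hk⟩ := hx
    have h1 := congrArg (coeff (m - Finsupp.single (.inl k) 1)) (hpd k)
    rw [coeff_pderiv, tsub_add_cancel_of_le
      (Finsupp.single_le_iff.mpr (Nat.one_le_iff_ne_zero.mpr hk)), map_zero, mul_eq_zero,
      or_iff_right hm] at h1
    exact Nat.cast_add_one_ne_zero _ h1
  · push Not at hx
    have hm0 : m = 0 := by
      ext i
      rcases i with k | k
      · simpa using hx k
      · rw [← hb k]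
        simpa using hx k
    have hg1 : g ∈ ordGE (Coord n) K 1 := ordGE_anti (show 1 ≤ 2 by norm_num)
      (Ideal.sub_mem _ (hord 2 _ (act_mem_ordGE i)) (smul_mem_ordGE (act_mem_ordGE _) _))
    exact hm (hg1 m (by rw [hm0]; simp))

/-- The exponent of `∏ (x_j y_j) ^ k_j`. -/
noncomputable def actExp (k : Fin n →₀ ℕ) : Coord n →₀ ℕ := Finsupp.sumElim k k

theorem actExp_inl (k : Fin n →₀ ℕ) (j : Fin n) : actExp k (.inl j) = k j := rfl

theorem actExp_inr (k : Fin n →₀ ℕ) (j : Fin n) : actExp k (.inr j) = k j := rfl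

theorem actExp_injective : Function.Injective (actExp (n := n)) := fun k l h => by
  ext j
  exact DFunLike.congr_fun h (Sum.inl j)

theorem eq_actExp {m : Coord n →₀ ℕ} (h : ∀ j, m (.inl j) = m (.inr j)) :
    ∃ k, m = actExp k := by
  refine ⟨Finsupp.equivFunOnFinite.symm fun j => m (.inl j), ?_⟩
  ext i
  rcases i with j | j
  · simp [actExp_inl]
  · simp [actExp_inr, h j]

theorem actExp_add (k l : Fin n →₀ ℕ) : actExp (k + l) = actExp k + actExp l := by
  ext i
  rcases i with j | j <;> rfl

theorem act_eq_monomial (j : Fin n) : act K j = monomial (actExp (Finsupp.single j 1)) 1 := by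
  rw [act, X, X, monomial_mul_monomial, one_mul]
  congr 2
  ext i
  classical
  rcases i with l | l <;> simp [actExp_inl, actExp_inr, Finsupp.single_apply]

theorem prod_smul_act_pow {τ : Type*} (π : τ → Fin n) (c : τ → K) (d : τ →₀ ℕ) :
    (d.prod fun i e => (c i • act K (π i)) ^ e)
      = monomial (actExp (d.mapDomain π)) (d.prod fun i e => c i ^ e) := by
  classical
  induction d using Finsupp.induction with
  | zero =>
    rw [Finsupp.prod_zero_index, Finsupp.prod_zero_index, Finsupp.mapDomain_zero]
    have : actExp (0 : Fin n →₀ ℕ) = 0 := by ext i; rcases i with j | j <;> rfl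
    rw [this]
    rfl
  | single_add i e d hi he ih =>
    have hdisj : Disjoint (Finsupp.single i e).support d.support := by
      rw [Finsupp.support_single i he]
      simpa using hi
    rw [Finsupp.prod_add_index_of_disjoint hdisj, Finsupp.prod_add_index_of_disjoint hdisj, ih,
      Finsupp.prod_single_index (by simp), Finsupp.prod_single_index (by simp),
      Finsupp.mapDomain_add, Finsupp.mapDomain_single, actExp_add, smul_pow, act_eq_monomial,
      monomial_pow, ← map_smul, monomial_mul_monomial]
    congr 2
    · congr 1
      ext j
      rcases j with j | j <;> simp [actExp_inl, actExp_inr, Finsupp.single_apply]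
    · simp

theorem constantCoeff_smul_act {τ : Type*} (π : τ → Fin n) (c : τ → K) (i : τ) :
    constantCoeff (c i • act K (π i)) = 0 := by
  simp [act, smul_eq_C_mul]

/-- Distinct monomials in the scaled actions are multiples of distinct monomials in the coordinates,
so coefficients can be read off one by one. -/
theorem coeff_subst_act {τ : Type*} [Finite τ] (π : τ ≃ Fin n) (c : τ → K) (g : MvPowerSeries τ K)
    (k : τ →₀ ℕ) : coeff (actExp (k.mapDomain π)) (subst (fun i => c i • act K (π i)) g)
      = (k.prod fun i e => c i ^ e) * coeff k g := by
  classical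
  rw [coeff_subst (hasSubst_of_constantCoeff_zero (constantCoeff_smul_act π c)),
    finsum_eq_single _ k]
  · rw [prod_smul_act_pow, coeff_monomial_same, smul_eq_mul, mul_comm]
  · intro d hd
    rw [prod_smul_act_pow, coeff_monomial_ne, smul_zero]
    intro h
    exact hd (Finsupp.mapDomain_injective π.injective (actExp_injective h)).symm

theorem balanced_subst_act {τ : Type*} [Finite τ] (π : τ → Fin n) (c : τ → K)
    (g : MvPowerSeries τ K) : Balanced (subst (fun i => c i • act K (π i)) g) := by
  classical
  intro m hm j
  by_contra hj
  refine hm ?_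
  rw [coeff_subst (hasSubst_of_constantCoeff_zero (constantCoeff_smul_act π c))]
  refine finsum_eq_zero_of_forall_eq_zero fun d => ?_
  rw [prod_smul_act_pow, coeff_monomial_ne, smul_zero]
  rintro rfl
  exact hj rfl

theorem Balanced.exists_eq_subst {τ : Type*} [Finite τ] {f : MvPowerSeries (Coord n) K}
    (hf : Balanced f) (π : τ ≃ Fin n) {c : τ → K} (hc : ∀ i, c i ≠ 0) :
    ∃ g : MvPowerSeries τ K, f = subst (fun i => c i • act K (π i)) g := by
  classical
  let g : MvPowerSeries τ K :=
    fun k => (k.prod fun i e => c i ^ e)⁻¹ * coeff (actExp (k.mapDomain π)) f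
  have hg : ∀ k, coeff k g = (k.prod fun i e => c i ^ e)⁻¹ * coeff (actExp (k.mapDomain π)) f :=
    fun k => rfl
  refine ⟨g, ?_⟩
  ext m
  by_cases hb : ∀ j, m (.inl j) = m (.inr j)
  · obtain ⟨k, rfl⟩ := eq_actExp hb
    obtain ⟨k, rfl⟩ : ∃ k', k = Finsupp.mapDomain π k' :=
      ⟨k.mapDomain π.symm, by rw [← Finsupp.mapDomain_comp]; simp⟩
    rw [coeff_subst_act, hg, mul_inv_cancel_left₀]
    exact Finset.prod_ne_zero_iff.mpr fun i _ => pow_ne_zero _ (hc i)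
  · have h1 : coeff m f = 0 := by
      by_contra h
      exact hb (hf m h)
    rw [h1]
    by_contra h
    exact hb (balanced_subst_act π c _ m (Ne.symm h))

/-- Uniqueness of normal forms, up to a permutation of the action variables and signs. -/
theorem coeff_normalForm_unique {μ : Fin n → K} (hμ : IntIndep μ)
    {F F₁ : MvPowerSeries (Coord n) K} (hF : Balanced F)
    (hF₁ : Balanced F₁) (hq : F₁ - diagQuad μ ∈ ordGE (Coord n) K 3)
    (Ψ : MvPowerSeries (Coord n) K →ₐ[K] MvPowerSeries (Coord n) K)
    (hpb : ∀ f g, Ψ (pb f g) = pb (Ψ f) (Ψ g))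
    (hord : ∀ N, ∀ f ∈ ordGE (Coord n) K N, Ψ f ∈ ordGE (Coord n) K N) (hΨ : Ψ F = F₁) :
    ∃ (π : Equiv.Perm (Fin n)) (s : Fin n → K), (∀ i, s i = 1 ∨ s i = -1) ∧
      ∀ k : Fin n →₀ ℕ, coeff (actExp (k.mapDomain π)) F₁
        = (k.prod fun i e => s i ^ e) * coeff (actExp k) F := by
  -- The actions commute with F, so their images commute with Ψ F = F₁ and are balanced.
  obtain ⟨π, s, hs, hπ⟩ := exists_perm_of_balanced Ψ hpb hord fun i => by
    refine balanced_of_pb_eq_zero hμ hF₁ hq ?_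
    rw [← hΨ, ← hpb, pb_antisymm, balanced_iff.mp hF i, neg_zero, map_zero]
  refine ⟨π, s, hs, fun k => ?_⟩
  obtain ⟨g, hg⟩ := hF.exists_eq_subst (Equiv.refl (Fin n)) (c := fun _ => 1) (by simp)
  have hact : HasSubst fun i : Fin n => (1 : K) • act K i :=
    hasSubst_of_constantCoeff_zero (constantCoeff_smul_act id fun _ => (1 : K))
  have hX : ∀ i, constantCoeff (Ψ (X i)) = 0 := fun i =>
    mem_ordGE_one.mp (hord 1 _ (X_mem_ordGE i))
  -- With F = g(I) this reads F₁ = g(Ψ I), and Ψ I is the signed permutation of the actions.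
  have e : F₁ = subst (fun i => s i • act K (π i)) g := by
    rw [← hΨ, eq_subst_of_ordGE Ψ hord, hg]
    simp only [Equiv.refl_apply]
    rw [subst_comp_subst_apply hact (hasSubst_of_constantCoeff_zero hX)]
    congr 1
    funext i
    rw [← eq_subst_of_ordGE Ψ hord, one_smul, hπ]
  have h1 := coeff_subst_act (Equiv.refl (Fin n)) (fun _ => (1 : K)) g k
  rw [← hg] at h1
  simp only [Equiv.coe_refl, Finsupp.mapDomain_id, one_pow, Finsupp.prod, Finset.prod_const_one,
    one_mul] at h1
  rw [e, coeff_subst_act, h1]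

end Actions

/-! ### A resonant pair of monomials and its small divisor -/

section Perturbation

variable {n : ℕ} {K : Type*} [Field K] [CharZero K]

theorem pb_diagQuad_monomial (μ : Fin n → K) (m : Coord n →₀ ℕ) (c : K) :
    pb (diagQuad μ) (monomial m c)
      = (∑ j, μ j * ((m (.inr j) : K) - m (.inl j))) • monomial m c := by
  classical
  ext k
  rw [coeff_pb_diagQuad, coeff_smul, coeff_monomial]
  split_ifs with h
  · rw [h]
  · simp

/-- The monomial `x_s ^ p * y_t ^ q`. -/
noncomputable def crossMonomial (K : Type*) [Field K] (s t : Fin n) (p q : ℕ) :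
    MvPowerSeries (Coord n) K := X (.inl s) ^ p * X (.inr t) ^ q

theorem crossMonomial_eq (s t : Fin n) (p q : ℕ) : crossMonomial K s t p q
    = monomial (Finsupp.single (.inl s) p + Finsupp.single (.inr t) q) 1 := by
  rw [crossMonomial, X_pow_eq, X_pow_eq, monomial_mul_monomial, one_mul]

theorem crossMonomial_mem_ordGE (s t : Fin n) (p q : ℕ) :
    crossMonomial K s t p q ∈ ordGE (Coord n) K (p + q) := by
  have h1 := pow_mem_ordGE (X_mem_ordGE (R := K) (Sum.inl s : Coord n)) p
  have h2 := pow_mem_ordGE (X_mem_ordGE (R := K) (Sum.inr t : Coord n)) q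
  rw [mul_one] at h1 h2
  exact mul_mem_ordGE h1 h2

theorem pb_diagQuad_crossMonomial (μ : Fin n → K) (s t : Fin n) (p q : ℕ) :
    pb (diagQuad μ) (crossMonomial K s t p q) = (μ t * q - μ s * p) • crossMonomial K s t p q := by
  classical
  rw [crossMonomial_eq, pb_diagQuad_monomial]
  congr 1
  simp only [Finsupp.add_apply, Finsupp.single_apply, Sum.inr.injEq, Sum.inl.injEq, reduceCtorEq,
    if_false, zero_add, add_zero, mul_sub, Finset.sum_sub_distrib, Nat.cast_ite, Nat.cast_zero,
    mul_ite, mul_zero, Finset.sum_ite_eq, Finset.mem_univ, if_true]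

/-- The two monomials have opposite weights, so their bracket is a function of the actions. Its
first term is the one followed through the proof. -/
theorem pb_crossMonomial {s t : Fin n} (hst : s ≠ t) (p q : ℕ) :
    pb (crossMonomial K s t p q) (crossMonomial K t s q p)
      = ((p : K) ^ 2) • (act K s ^ (p - 1) * act K t ^ q)
        - ((q : K) ^ 2) • (act K s ^ p * act K t ^ (q - 1)) := by
  have hder : ∀ (i : Coord n) (s t : Fin n) (p q : ℕ), pderiv K i (crossMonomial K s t p q)
      = (p : MvPowerSeries (Coord n) K) * X (.inl s) ^ (p - 1) * pderiv K i (X (.inl s)) *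
          X (.inr t) ^ q
        + X (.inl s) ^ p * ((q : MvPowerSeries (Coord n) K) * X (.inr t) ^ (q - 1) *
          pderiv K i (X (.inr t))) := by
    intro i s t p q
    rw [crossMonomial, Derivation.leibniz, Derivation.leibniz_pow, Derivation.leibniz_pow]
    simp only [smul_eq_mul, nsmul_eq_mul]
    ring
  rw [pb_eq, ← Finset.sum_subset (Finset.subset_univ {s, t}), Finset.sum_pair hst]
  · simp only [hder]
    simp only [pderiv_X_self, pderiv_X_of_ne (show (Sum.inr t : Coord n) ≠ .inl s by simp),
      pderiv_X_of_ne (show (Sum.inr s : Coord n) ≠ .inl s by simp),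
      pderiv_X_of_ne (show (Sum.inl s : Coord n) ≠ .inr s by simp),
      pderiv_X_of_ne (show (Sum.inl t : Coord n) ≠ .inr s by simp),
      pderiv_X_of_ne (show (Sum.inr t : Coord n) ≠ .inr s by simpa using hst.symm),
      pderiv_X_of_ne (show (Sum.inl t : Coord n) ≠ .inl s by simpa using hst.symm),
      pderiv_X_of_ne (show (Sum.inr t : Coord n) ≠ .inl t by simp),
      pderiv_X_of_ne (show (Sum.inr s : Coord n) ≠ .inl t by simp),
      pderiv_X_of_ne (show (Sum.inl s : Coord n) ≠ .inr t by simp),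
      pderiv_X_of_ne (show (Sum.inl t : Coord n) ≠ .inr t by simp),
      pderiv_X_of_ne (show (Sum.inr s : Coord n) ≠ .inr t by simpa using hst),
      pderiv_X_of_ne (show (Sum.inl s : Coord n) ≠ .inl t by simpa using hst)]
    simp only [smul_eq_C_mul, map_pow, map_natCast, act]
    ring
  · intro j _ hj
    simp only [Finset.mem_insert, Finset.mem_singleton, not_or] at hj
    simp only [hder]
    simp only [pderiv_X_of_ne (show (Sum.inr t : Coord n) ≠ .inl j by simp),
      pderiv_X_of_ne (show (Sum.inl s : Coord n) ≠ .inl j by simpa using Ne.symm hj.1),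
      pderiv_X_of_ne (show (Sum.inr t : Coord n) ≠ .inr j by simpa using Ne.symm hj.2),
      pderiv_X_of_ne (show (Sum.inl s : Coord n) ≠ .inr j by simp)]
    ring

theorem coeff_act_pow_mul_act_pow (s t : Fin n) (a b : ℕ) (k : Fin n →₀ ℕ) [Decidable
    (k = Finsupp.single s a + Finsupp.single t b)] :
    coeff (actExp k) (act K s ^ a * act K t ^ b)
      = if k = Finsupp.single s a + Finsupp.single t b then 1 else 0 := by
  classical
  have e : act K s ^ a * act K t ^ b
      = monomial (actExp (Finsupp.single s a + Finsupp.single t b)) 1 := by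
    rw [act_eq_monomial, act_eq_monomial, monomial_pow, monomial_pow, monomial_mul_monomial,
      one_pow, one_pow, one_mul, actExp_add]
    congr 2
    congr 1 <;>
    · ext j
      rcases j with j | j <;> simp [actExp_inl, actExp_inr, Finsupp.single_apply]
  rw [e, coeff_monomial]
  congr 1
  exact propext actExp_injective.eq_iff

theorem degree_actExp (k : Fin n →₀ ℕ) : (actExp k).degree = 2 * k.degree := by
  rw [Finsupp.degree_eq_sum, Finsupp.degree_eq_sum, Fintype.sum_sum_type]
  simp only [actExp_inl, actExp_inr]
  ring

/-- The constant c depends on H but is chosen before R and serves all R at once. This uniformity is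
what permits the inductive construction. -/
theorem exists_large_normalForm {μ : Fin n → ℂ} {H : MvPowerSeries (Coord n) ℂ}
    (hH : H - diagQuad μ ∈ ordGE (Coord n) ℂ 3) {s t : Fin n} (hst : s ≠ t) {p q : ℕ}
    (hp : 1 ≤ p) (hpq : 3 ≤ p + q) (a b : ℂ) (hδ : μ t * q - μ s * p ≠ 0) :
    ∃ c : ℝ, (c = -1 ∨ c = 0 ∨ c = 1) ∧ ∀ R ∈ ordGE (Coord n) ℂ (2 * (p + q) - 1),
      ∃ e : MvPowerSeries (Coord n) ℂ ≃ₐ[ℂ] MvPowerSeries (Coord n) ℂ, ∃ F,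
        IsSymplecticAut e ∧
        e (H + (c : ℂ) • (a • crossMonomial ℂ s t p q + b • crossMonomial ℂ t s q p) + R) = F ∧
        pb (diagQuad μ) F = 0 ∧ F - diagQuad μ ∈ ordGE (Coord n) ℂ 3 ∧
        ‖a * b‖ / (2 * ‖μ t * q - μ s * p‖)
          ≤ ‖coeff (actExp (Finsupp.single s (p - 1) + Finsupp.single t q)) F‖ := by
  classical
  set δ := μ t * q - μ s * p with hδdef
  set A := crossMonomial ℂ s t p q with hA
  set B := crossMonomial ℂ t s q p with hB
  set k := (Finsupp.single s (p - 1) + Finsupp.single t q) with hk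
  have hAm : A ∈ ordGE (Coord n) ℂ (p + q) := crossMonomial_mem_ordGE s t p q
  have hBm : B ∈ ordGE (Coord n) ℂ (p + q) := by
    rw [add_comm]
    exact crossMonomial_mem_ordGE t s q p
  have hqA : pb (diagQuad μ) A = δ • A := pb_diagQuad_crossMonomial μ s t p q
  have hqB : pb (diagQuad μ) B = (-δ) • B := by
    rw [hB, pb_diagQuad_crossMonomial, hδdef, neg_sub]
  set P := a • A + b • B with hP
  -- A and B are eigenvectors of {Q, ·} with eigenvalues δ and -δ, hence the minus sign.
  set G := δ⁻¹ • (a • A - b • B) with hG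
  have hPm : P ∈ ordGE (Coord n) ℂ (p + q) :=
    Ideal.add_mem _ (smul_mem_ordGE hAm a) (smul_mem_ordGE hBm b)
  have hGm : G ∈ ordGE (Coord n) ℂ (p + q) :=
    smul_mem_ordGE (Ideal.sub_mem _ (smul_mem_ordGE hAm a) (smul_mem_ordGE hBm b)) _
  have hGP : pb (diagQuad μ) G = P := by
    rw [hG, pb_smul_right, pb_sub_right, pb_smul_right, pb_smul_right, hqA, hqB, hP]
    rw [smul_comm a δ, smul_comm b (-δ), neg_smul, sub_neg_eq_add, ← smul_add, smul_smul,
      inv_mul_cancel₀ hδ, one_smul]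
  have hGPb : pb G P = (2 * a * b * δ⁻¹) • pb A B := by
    rw [hG, hP, pb_smul_left, pb_sub_left, pb_add_right, pb_add_right]
    simp only [pb_smul_left, pb_smul_right, pb_self, pb_antisymm B A]
    simp only [smul_eq_C_mul, map_mul]
    have : (C (2 : ℂ) : MvPowerSeries (Coord n) ℂ) = 2 := map_ofNat _ 2
    rw [this]
    ring
  have hn : pb (diagQuad μ) (pb G P) = 0 := by
    rw [hGPb, pb_smul_right, pb_jacobi, hqA, hqB, pb_smul_left, pb_smul_right, ← add_smul,
      add_neg_cancel, zero_smul, smul_zero]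
  obtain ⟨S₀, S₁, hS⟩ := exists_normalForms_of_perturbation (diagQuad_mem_ordGE μ)
    (isSemisimpleHam_diagQuad μ) hH hpq hPm hGm hGP hn
  set M := coeff (actExp k) (pb G P) with hM
  have hMval : M = 2 * a * b * δ⁻¹ * p ^ 2 := by
    rw [hM, hGPb, hA, hB, pb_crossMonomial hst, coeff_smul, map_sub, coeff_smul, coeff_smul,
      coeff_act_pow_mul_act_pow, coeff_act_pow_mul_act_pow, if_pos hk, if_neg]
    · ring
    · intro h
      have := DFunLike.congr_fun h s
      simp [hk, hst.symm] at this
      omega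
  have hMnorm : ‖a * b‖ / (2 * ‖δ‖) ≤ ‖M‖ / 4 := by
    rw [hMval]
    simp only [norm_mul, norm_inv, norm_pow, Complex.norm_natCast, Complex.norm_ofNat]
    have h1 : (1 : ℝ) ≤ (p : ℝ) ^ 2 := by
      have : (1 : ℝ) ≤ p := by exact_mod_cast hp
      nlinarith
    have h2 : 0 ≤ ‖a‖ * ‖b‖ / ‖δ‖ := by positivity
    have e1 : ‖a‖ * ‖b‖ / (2 * ‖δ‖) = (‖a‖ * ‖b‖ / ‖δ‖) * (1 / 2) := by
      field_simp
    have e2 : 2 * ‖a‖ * ‖b‖ * ‖δ‖⁻¹ * (p : ℝ) ^ 2 / 4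
        = (‖a‖ * ‖b‖ / ‖δ‖) * ((p : ℝ) ^ 2 / 2) := by
      field_simp
      ring
    rw [e1, e2]
    exact mul_le_mul_of_nonneg_left (by linarith) h2
  let f : ℝ → ℂ := fun c => coeff (actExp k) (S₀ + (c : ℂ) • S₁ + ((c : ℂ) ^ 2 / 2) • pb G P)
  -- The second difference f(1) + f(-1) - 2 f(0) equals M, so the three values cannot all have
  -- modulus below ‖M‖ / 4.
  have hlarge : ∃ c : ℝ, (c = -1 ∨ c = 0 ∨ c = 1) ∧ ‖M‖ / 4 ≤ ‖f c‖ := by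
    by_contra hcon
    push Not at hcon
    have h1 := hcon (-1) (Or.inl rfl)
    have h2 := hcon 0 (Or.inr (Or.inl rfl))
    have h3 := hcon 1 (Or.inr (Or.inr rfl))
    have e : M = f 1 + f (-1) - (f 0 + f 0) := by
      simp only [f, map_add, coeff_smul, ← hM]
      push_cast
      ring
    have h4 : ‖M‖ ≤ ‖f 1‖ + ‖f (-1)‖ + (‖f 0‖ + ‖f 0‖) := by
      calc ‖M‖ = ‖f 1 + f (-1) - (f 0 + f 0)‖ := by rw [← e]
        _ ≤ ‖f 1 + f (-1)‖ + ‖f 0 + f 0‖ := norm_sub_le _ _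
        _ ≤ _ := add_le_add (norm_add_le _ _) (norm_add_le _ _)
    linarith
  obtain ⟨c, hc, hfc⟩ := hlarge
  refine ⟨c, hc, fun R hR => ?_⟩
  obtain ⟨e, he, h1, h2, h3⟩ := hS c R hR
  refine ⟨e, _, he, rfl, h1, h2, hMnorm.trans (hfc.trans (le_of_eq ?_))⟩
  -- The degree is 2(p + q) - 2, the last one that is under control.
  have hdeg : (actExp k).degree < 2 * (p + q) - 1 := by
    rw [degree_actExp, hk, map_add, Finsupp.degree_single, Finsupp.degree_single]
    omega
  have := h3 _ hdeg
  rw [map_sub, sub_eq_zero] at this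
  rw [this]

end Perturbation

/-! ### Canonical relations and formal symplectic maps -/

section Canonical

variable {n : ℕ} {K : Type*} [Field K] [CharZero K]

theorem pb_eq_sum_sum (f g : MvPowerSeries (Coord n) K) :
    pb f g = ∑ a, ∑ b, pderiv K a f * pderiv K b g * pb (X a) (X b) := by
  classical
  have h : ∀ g : MvPowerSeries (Coord n) K, ∀ a, pb (X a) g = ∑ b, pderiv K b g * pb (X a) (X b) := by
    intro g a
    rcases a with i | i
    · rw [pb_X_inl, Finset.sum_eq_single (Sum.inr i)]
      · rw [pb_X_inl, pderiv_X_self, mul_one]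
      · intro b _ hb
        rw [pb_X_inl, pderiv_X_of_ne hb, mul_zero]
      · simp
    · rw [pb_X_inr, Finset.sum_eq_single (Sum.inl i)]
      · rw [pb_X_inr, pderiv_X_self]; ring
      · intro b _ hb
        rw [pb_X_inr, pderiv_X_of_ne hb, neg_zero, mul_zero]
      · simp
  simp only [mul_assoc, ← Finset.mul_sum, ← h]
  rw [pb_eq, Fintype.sum_sum_type, ← Finset.sum_add_distrib]
  refine Finset.sum_congr rfl fun j _ => ?_
  rw [pb_X_inl, pb_X_inr]
  ring

theorem pb_X_X_eq_C (a b : Coord n) : ∃ c : K, pb (X a) (X b) = C c := by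
  classical
  rcases a with i | i
  · rw [pb_X_inl]
    by_cases h : b = .inr i
    · exact ⟨1, by rw [h, pderiv_X_self, map_one]⟩
    · exact ⟨0, by rw [pderiv_X_of_ne h, map_zero]⟩
  · rw [pb_X_inr]
    by_cases h : b = .inl i
    · exact ⟨-1, by rw [h, pderiv_X_self, map_neg, map_one]⟩
    · exact ⟨0, by rw [pderiv_X_of_ne h, map_zero, neg_zero]⟩

/-- The components of the formal map satisfy the canonical relations. -/
def IsCanonical (ψ : Coord n → MvPowerSeries (Coord n) K) : Prop :=
  (∀ i, constantCoeff (ψ i) = 0) ∧ ∀ a b, pb (ψ a) (ψ b) = pb (X a) (X b)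

theorem IsCanonical.hasSubst {ψ : Coord n → MvPowerSeries (Coord n) K} (h : IsCanonical ψ) :
    HasSubst ψ := hasSubst_of_constantCoeff_zero h.1

/-- The chain rule in both arguments reduces the claim to brackets of coordinates, which are
constants and so unaffected by substitution. -/
theorem IsCanonical.subst_pb {ψ : Coord n → MvPowerSeries (Coord n) K} (h : IsCanonical ψ)
    (f g : MvPowerSeries (Coord n) K) : subst ψ (pb f g) = pb (subst ψ f) (subst ψ g) := by
  have hs := h.hasSubst
  have e1 : pb (subst ψ f) (subst ψ g)
      = ∑ a, ∑ b, subst ψ (pderiv K a f) * subst ψ (pderiv K b g) * pb (ψ a) (ψ b) := by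
    have hl : ∀ f v, pb (subst ψ f) v = ∑ a, subst ψ (pderiv K a f) * pb (ψ a) v := by
      intro f v
      simp only [pb_eq, pderiv_subst h.1, Finset.sum_mul, Finset.mul_sum,
        ← Finset.sum_sub_distrib]
      rw [Finset.sum_comm]
      exact Finset.sum_congr rfl fun a _ => Finset.sum_congr rfl fun j _ => by ring
    rw [hl]
    refine Finset.sum_congr rfl fun a _ => ?_
    rw [pb_antisymm, hl, ← Finset.sum_neg_distrib, Finset.mul_sum]
    refine Finset.sum_congr rfl fun b _ => ?_
    rw [pb_antisymm (ψ b)]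
    ring
  rw [e1, pb_eq_sum_sum, ← coe_substAlgHom hs, map_sum]
  refine Finset.sum_congr rfl fun a _ => ?_
  rw [map_sum]
  refine Finset.sum_congr rfl fun b _ => ?_
  obtain ⟨c, hc⟩ := pb_X_X_eq_C (K := K) a b
  rw [map_mul, map_mul, h.2, hc, coe_substAlgHom, subst_C]

theorem IsSymplecticAut.isCanonical
    {e : MvPowerSeries (Coord n) K ≃ₐ[K] MvPowerSeries (Coord n) K} (h : IsSymplecticAut e) :
    IsCanonical fun i => e (X i) := by
  refine ⟨fun i => mem_ordGE_one.mp (h.map_mem 1 _ (X_mem_ordGE i)), fun a b => ?_⟩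
  obtain ⟨c, hc⟩ := pb_X_X_eq_C (K := K) a b
  rw [← h.map_pb, hc]
  exact e.commutes c

theorem IsCanonical.map {L : Type*} [Field L] [CharZero L]
    {ψ : Coord n → MvPowerSeries (Coord n) K} (h : IsCanonical ψ) (φ : K →+* L) :
    IsCanonical fun i => MvPowerSeries.map φ (ψ i) := by
  refine ⟨fun i => ?_, fun a b => ?_⟩
  · rw [constantCoeff_map, h.1, map_zero]
  · rw [← map_pb, h.2, map_pb, map_X, map_X]

/-- The definition says DᵀJD = J, the canonical relations say DJDᵀ = J. They agree because the
symplectic group is closed under transposition. -/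
theorem isFormalSymplectic_iff {φ : Coord n → MvPowerSeries (Coord n) ℝ} :
    IsFormalSymplectic φ ↔ IsCanonical φ := by
  rw [IsFormalSymplectic, IsCanonical, ← SymplecticGroup.mem_iff', SymplecticGroup.mem_iff]
  refine and_congr_right fun _ => ?_
  have h1 : ∀ a b, (jacobian φ * Matrix.J (Fin n) (MvPowerSeries (Coord n) ℝ) * (jacobian φ)ᵀ) a b
      = -pb (φ a) (φ b) := by
    intro a b
    rw [pb_eq, Matrix.mul_apply, Fintype.sum_sum_type, ← Finset.sum_neg_distrib,
      ← Finset.sum_add_distrib]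
    refine Finset.sum_congr rfl fun j _ => ?_
    rw [Matrix.mul_apply, Matrix.mul_apply, Fintype.sum_sum_type, Fintype.sum_sum_type]
    simp [Matrix.J, jacobian, Matrix.one_apply]
    ring
  have h2 : ∀ a b, Matrix.J (Fin n) (MvPowerSeries (Coord n) ℝ) a b
      = -pb (X a) (X b) := by
    classical
    intro a b
    rcases a with i | i
    · rw [pb_X_inl, pderiv_X]
      rcases b with j | j
      · simp [Matrix.J]
      · simp [Matrix.J, Matrix.one_apply, Pi.single_apply, eq_comm]
    · rw [pb_X_inr, pderiv_X]
      rcases b with j | j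
      · simp [Matrix.J, Matrix.one_apply, Pi.single_apply, eq_comm]
      · simp [Matrix.J]
  rw [← Matrix.ext_iff]
  simp only [h1, h2, neg_inj]

end Canonical

/-! ### Linear symplectic maps acting plane by plane -/

section LinearMaps

variable {n : ℕ} {K : Type*} [Field K] [CharZero K]

/-- The linear map acting on the plane of `x_j, y_j` by the matrix `!![α j, β j; γ j, δ j]`. -/
noncomputable def planeMap (α β γ δ : Fin n → K) : Coord n → MvPowerSeries (Coord n) K
  | .inl j => α j • X (.inl j) + β j • X (.inr j)
  | .inr j => γ j • X (.inl j) + δ j • X (.inr j)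

variable {α β γ δ : Fin n → K}

theorem constantCoeff_planeMap (i : Coord n) : constantCoeff (planeMap α β γ δ i) = 0 := by
  rcases i with j | j <;> simp [planeMap, smul_eq_C_mul]

theorem hasSubst_planeMap : HasSubst (planeMap α β γ δ) :=
  hasSubst_of_constantCoeff_zero constantCoeff_planeMap

theorem isCanonical_planeMap (h : ∀ j, α j * δ j - β j * γ j = 1) :
    IsCanonical (planeMap α β γ δ) := by
  classical
  refine ⟨constantCoeff_planeMap, fun a b => ?_⟩
  rcases a with i | i <;> rcases b with j | j <;>
    simp only [planeMap, pb_add_left, pb_add_right, pb_smul_left, pb_smul_right, pb_X_inl,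
      pb_X_inr, pderiv_X, Pi.single_apply, Sum.inl.injEq, Sum.inr.injEq, reduceCtorEq, if_false,
      smul_zero, add_zero, zero_add, neg_zero] <;>
    by_cases hij : j = i
  all_goals simp only [hij, if_true, if_false, smul_zero, neg_zero, add_zero]
  all_goals
    have hC : (C (α i) : MvPowerSeries (Coord n) K) * C (δ i) - C (β i) * C (γ i) = 1 := by
      rw [← map_mul, ← map_mul, ← map_sub, h, map_one]
    simp only [smul_eq_C_mul]
  · ring
  · linear_combination hC
  · linear_combination -hC
  · ring

theorem subst_planeMap_planeMap (h : ∀ j, α j * δ j - β j * γ j = 1) (i : Coord n) :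
    subst (planeMap α β γ δ) (planeMap δ (-β) (-γ) α i) = X i := by
  have hs := hasSubst_planeMap (α := α) (β := β) (γ := γ) (δ := δ)
  have hC : ∀ j, (C (α j) : MvPowerSeries (Coord n) K) * C (δ j) - C (β j) * C (γ j) = 1 :=
    fun j => by rw [← map_mul, ← map_mul, ← map_sub, h, map_one]
  rcases i with j | j
  all_goals
    simp only [planeMap, subst_add hs, subst_smul hs, subst_X hs]
    simp only [smul_eq_C_mul, Pi.neg_apply, map_neg]
  · linear_combination (X (.inl j)) * hC j
  · linear_combination (X (.inr j)) * hC j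

/-- The linear symplectic change of coordinates given by `planeMap`. -/
noncomputable def planeEquiv (h : ∀ j, α j * δ j - β j * γ j = 1) :
    MvPowerSeries (Coord n) K ≃ₐ[K] MvPowerSeries (Coord n) K :=
  AlgEquiv.ofAlgHom (substAlgHom (hasSubst_planeMap (α := α) (β := β) (γ := γ) (δ := δ)))
    (substAlgHom (hasSubst_planeMap (α := δ) (β := -β) (γ := -γ) (δ := α)))
    (AlgHom.ext fun f => by
      simp only [AlgHom.comp_apply, substAlgHom_apply, AlgHom.id_apply]
      rw [subst_comp_subst_apply hasSubst_planeMap hasSubst_planeMap]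
      simp only [subst_planeMap_planeMap h, subst_self, id])
    (AlgHom.ext fun f => by
      have h' : ∀ j, δ j * α j - (-β) j * (-γ) j = 1 := fun j => by
        rw [Pi.neg_apply, Pi.neg_apply]; linear_combination h j
      have := subst_planeMap_planeMap h'
      rw [neg_neg, neg_neg] at this
      simp only [AlgHom.comp_apply, substAlgHom_apply, AlgHom.id_apply]
      rw [subst_comp_subst_apply hasSubst_planeMap hasSubst_planeMap]
      simp only [this, subst_self, id])

theorem planeEquiv_apply (h : ∀ j, α j * δ j - β j * γ j = 1) (f : MvPowerSeries (Coord n) K) :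
    planeEquiv h f = subst (planeMap α β γ δ) f := substAlgHom_apply hasSubst_planeMap f

theorem planeEquiv_X (h : ∀ j, α j * δ j - β j * γ j = 1) (i : Coord n) :
    planeEquiv h (X i) = planeMap α β γ δ i := by
  rw [planeEquiv_apply, subst_X hasSubst_planeMap]

theorem planeEquiv_symm_apply (h : ∀ j, α j * δ j - β j * γ j = 1)
    (f : MvPowerSeries (Coord n) K) :
    (planeEquiv h).symm f = subst (planeMap δ (-β) (-γ) α) f := substAlgHom_apply hasSubst_planeMap f

theorem isSymplecticAut_planeEquiv (h : ∀ j, α j * δ j - β j * γ j = 1) :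
    IsSymplecticAut (planeEquiv h) where
  map_pb f g := by
    simp only [planeEquiv_apply]
    exact (isCanonical_planeMap h).subst_pb f g
  map_mem N f hf := by
    rw [planeEquiv_apply]
    exact subst_mem_ordGE constantCoeff_planeMap hf
  symm_mem N f hf := by
    rw [planeEquiv_symm_apply]
    exact subst_mem_ordGE constantCoeff_planeMap hf

end LinearMaps

/-! ### Passing between real and complex series -/

section Complexification

variable {n : ℕ}

/-- The complexification of a real power series. -/
noncomputable abbrev complexify {σ : Type*} (f : MvPowerSeries σ ℝ) : MvPowerSeries σ ℂ :=
  MvPowerSeries.map Complex.ofRealHom f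

theorem exists_complexify_add {σ : Type*} (f : MvPowerSeries σ ℂ) :
    ∃ u v : MvPowerSeries σ ℝ, f = complexify u + Complex.I • complexify v ∧
      ∀ N, f ∈ ordGE σ ℂ N → u ∈ ordGE σ ℝ N := by
  let u : MvPowerSeries σ ℝ := fun m => (coeff m f).re
  let v : MvPowerSeries σ ℝ := fun m => (coeff m f).im
  have hu : ∀ m, coeff m u = (coeff m f).re := fun _ => rfl
  have hv : ∀ m, coeff m v = (coeff m f).im := fun _ => rfl
  refine ⟨u, v, ?_, fun N hf m hm => ?_⟩
  · ext m
    rw [map_add, coeff_smul, coeff_map, coeff_map, hu, hv, mul_comm]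
    exact (Complex.re_add_im _).symm
  · rw [hu, hf m hm, Complex.zero_re]

theorem eq_zero_of_complexify_add {σ : Type*} {u v : MvPowerSeries σ ℝ}
    (h : complexify u + Complex.I • complexify v = 0) : u = 0 := by
  ext m
  have := congrArg (fun f => (coeff m f).re) h
  simpa [coeff_map] using this

/-- Solve over ℂ in diagonal coordinates, transport back and take the real part, which is still a
solution because q and R are real. -/
theorem isSemisimpleHam_of_complexify {q : MvPowerSeries (Coord n) ℝ} {μ : Fin n → ℂ}
    {T : MvPowerSeries (Coord n) ℂ ≃ₐ[ℂ] MvPowerSeries (Coord n) ℂ} (hT : IsSymplecticAut T)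
    (hq : T (complexify q) = diagQuad μ) : IsSemisimpleHam q := by
  intro N R hR
  have h1 := hT.map_mem N _ (map_mem_ordGE Complex.ofRealHom hR)
  rw [map_pb, hT.map_pb, hq] at h1
  obtain ⟨w, hw, hw0⟩ := isSemisimpleHam_diagQuad μ N _ h1
  obtain ⟨u, v, huv, hu⟩ := exists_complexify_add (T.symm w)
  refine ⟨u, hu N (hT.symm_mem N w hw), ?_⟩
  have h2 : pb (complexify q) (complexify R - pb (complexify q) (T.symm w)) = 0 := by
    apply T.injective
    rw [hT.map_pb, map_sub, hT.map_pb, AlgEquiv.apply_symm_apply, hq, hw0, map_zero]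
  rw [huv, pb_add_right, pb_smul_right] at h2
  apply eq_zero_of_complexify_add (v := -pb q (pb q v))
  simp only [complexify, map_neg, map_sub, map_pb, pb_sub_right] at h2 ⊢
  simp only [pb_add_right, pb_smul_right] at h2
  rw [← h2, smul_neg]
  ring

end Complexification

/-! ### The model quadratic part and the meaning of normal form -/

section Model

variable {n : ℕ}

/-- The eigenvalues `i t_j` for `j < κ` and `t_j` for the other indices. -/
noncomputable def spectrumOf (κ : ℕ) (t : Fin n → ℝ) (j : Fin n) : ℂ :=
  if (j : ℕ) < κ then Complex.I * t j else t j

/-- The real quadratic forms `-(x_j² + y_j²) / 2` for `j < κ` and `x_j y_j` for the other indices. -/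
noncomputable def planeQuad (κ : ℕ) (j : Fin n) : MvPowerSeries (Coord n) ℝ :=
  if (j : ℕ) < κ then (-1 / 2 : ℝ) • (X (.inl j) ^ 2 + X (.inr j) ^ 2) else act ℝ j

/-- The quadratic part of the Hamiltonian. -/
noncomputable def quadSeries (κ : ℕ) (t : Fin n → ℝ) : MvPowerSeries (Coord n) ℝ :=
  ∑ j, t j • planeQuad κ j

theorem planeQuad_mem_ordGE (κ : ℕ) (j : Fin n) : planeQuad κ j ∈ ordGE (Coord n) ℝ 2 := by
  have h : ∀ i : Coord n, (X i : MvPowerSeries (Coord n) ℝ) ^ 2 ∈ ordGE (Coord n) ℝ 2 := fun i => by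
    have := pow_mem_ordGE (X_mem_ordGE (R := ℝ) i) 2
    rwa [mul_one] at this
  rw [planeQuad]
  split_ifs
  · exact smul_mem_ordGE (Ideal.add_mem _ (h _) (h _)) _
  · exact act_mem_ordGE j

theorem quadSeries_mem_ordGE (κ : ℕ) (t : Fin n → ℝ) : quadSeries κ t ∈ ordGE (Coord n) ℝ 2 :=
  Ideal.sum_mem _ fun j _ => smul_mem_ordGE (planeQuad_mem_ordGE κ j) _

/-- The linear form that becomes a multiple of the `j`-th position variable. -/
noncomputable def posForm (κ : ℕ) (j : Fin n) : MvPowerSeries (Coord n) ℂ :=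
  if (j : ℕ) < κ then X (.inl j) - C Complex.I * X (.inr j) else X (.inl j)

/-- The linear form that becomes a multiple of the `j`-th momentum variable. -/
noncomputable def momForm (κ : ℕ) (j : Fin n) : MvPowerSeries (Coord n) ℂ :=
  if (j : ℕ) < κ then X (.inl j) + C Complex.I * X (.inr j) else X (.inr j)

/-- In an elliptic plane the matrix with rows (1, i/2) and (i, 1/2) sends x - i y to 2x and x + i y
to i y. -/
theorem diagonalize_det (κ : ℕ) (j : Fin n) :
    (fun _ => 1 : Fin n → ℂ) j * (fun j : Fin n => if (j : ℕ) < κ then (1 / 2 : ℂ) else 1) j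
      - (fun j : Fin n => if (j : ℕ) < κ then Complex.I / 2 else 0) j
        * (fun j : Fin n => if (j : ℕ) < κ then Complex.I else 0) j = 1 := by
  simp only
  split_ifs
  · have := Complex.I_mul_I
    linear_combination (-1 / 2 : ℂ) * this
  · ring

/-- The complex symplectic linear map that diagonalizes the quadratic part. -/
noncomputable def diagonalize (n κ : ℕ) :
    MvPowerSeries (Coord n) ℂ ≃ₐ[ℂ] MvPowerSeries (Coord n) ℂ :=
  planeEquiv (diagonalize_det κ)

theorem isSymplecticAut_diagonalize (κ : ℕ) : IsSymplecticAut (diagonalize n κ) :=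
  isSymplecticAut_planeEquiv _

theorem C_I_mul_C_I {σ : Type*} :
    (C Complex.I : MvPowerSeries σ ℂ) * C Complex.I = -1 := by
  rw [← map_mul, Complex.I_mul_I, map_neg, map_one]

theorem diagonalize_C (κ : ℕ) (c : ℂ) : diagonalize n κ (C c) = C c := (diagonalize n κ).commutes c

theorem diagonalize_posForm (κ : ℕ) (j : Fin n) :
    diagonalize n κ (posForm κ j) = (if (j : ℕ) < κ then 2 else 1 : ℂ) • X (.inl j) := by
  rw [posForm]
  split_ifs with h
  · rw [map_sub, map_mul, diagonalize_C, diagonalize, planeEquiv_X, planeEquiv_X]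
    simp only [planeMap, if_pos h, smul_eq_C_mul, map_one, div_eq_mul_inv, map_mul, one_mul]
    have h2 : (C (2 : ℂ) : MvPowerSeries (Coord n) ℂ) = 2 := map_ofNat _ 2
    rw [h2]
    linear_combination (-X (.inl j)) * C_I_mul_C_I
  · rw [diagonalize, planeEquiv_X]
    simp [planeMap, h]

theorem diagonalize_momForm (κ : ℕ) (j : Fin n) :
    diagonalize n κ (momForm κ j) = (if (j : ℕ) < κ then Complex.I else 1 : ℂ) • X (.inr j) := by
  rw [momForm]
  split_ifs with h
  · rw [map_add, map_mul, diagonalize_C, diagonalize, planeEquiv_X, planeEquiv_X]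
    simp only [planeMap, if_pos h, smul_eq_C_mul, map_one, div_eq_mul_inv, map_mul, one_mul]
    have h2 : (C (2 : ℂ)⁻¹ : MvPowerSeries (Coord n) ℂ) * 2 = 1 := by
      have : (2 : MvPowerSeries (Coord n) ℂ) = C 2 := (map_ofNat C 2).symm
      rw [this, ← map_mul, inv_mul_cancel₀ two_ne_zero, map_one]
    linear_combination (X (.inl j)) * C_I_mul_C_I + (C Complex.I * X (.inr j)) * h2
  · rw [diagonalize, planeEquiv_X]
    simp [planeMap, h]

theorem posForm_mul_momForm (κ : ℕ) (j : Fin n) : posForm κ j * momForm κ j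
    = if (j : ℕ) < κ then X (.inl j) ^ 2 + X (.inr j) ^ 2 else act ℂ j := by
  rw [posForm, momForm, act]
  split_ifs
  · linear_combination (-X (.inr j) ^ 2) * C_I_mul_C_I
  · rfl

theorem diagonalize_sq_add_sq {κ : ℕ} {j : Fin n} (h : (j : ℕ) < κ) :
    diagonalize n κ (X (.inl j) ^ 2 + X (.inr j) ^ 2) = (2 * Complex.I) • act ℂ j := by
  have := posForm_mul_momForm κ j
  rw [if_pos h] at this
  rw [← this, map_mul, diagonalize_posForm, diagonalize_momForm, if_pos h, if_pos h, act,
    smul_mul_smul_comm]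

theorem diagonalize_act {κ : ℕ} {j : Fin n} (h : ¬ (j : ℕ) < κ) :
    diagonalize n κ (act ℂ j) = act ℂ j := by
  have := posForm_mul_momForm κ j
  rw [if_neg h] at this
  rw [← this, map_mul, diagonalize_posForm, diagonalize_momForm, if_neg h, if_neg h, one_smul,
    one_smul, this, act]

/-- The eigenvalues in the diagonalizing coordinates. -/
noncomputable def diagSpectrum (κ : ℕ) (t : Fin n → ℝ) (j : Fin n) : ℂ :=
  if (j : ℕ) < κ then -(Complex.I * t j) else t j

theorem complexify_smul {σ : Type*} (c : ℝ) (f : MvPowerSeries σ ℝ) :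
    complexify (c • f) = (c : ℂ) • complexify f := by
  ext m
  simp [coeff_map]

theorem complexify_act (j : Fin n) : complexify (act ℝ j) = act ℂ j := by
  simp [complexify, act]

theorem diagonalize_quadSeries (κ : ℕ) (t : Fin n → ℝ) :
    diagonalize n κ (complexify (quadSeries κ t)) = diagQuad (diagSpectrum κ t) := by
  rw [quadSeries, complexify, map_sum, map_sum, diagQuad]
  refine Finset.sum_congr rfl fun j _ => ?_
  change diagonalize n κ (complexify (t j • planeQuad κ j)) = _
  rw [complexify_smul, map_smul, planeQuad, diagSpectrum]
  split_ifs with h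
  · rw [complexify_smul]
    have : complexify (X (.inl j) ^ 2 + X (.inr j) ^ 2 : MvPowerSeries (Coord n) ℝ)
        = X (.inl j) ^ 2 + X (.inr j) ^ 2 := by simp [complexify]
    rw [this, map_smul, diagonalize_sq_add_sq h, smul_smul, smul_smul]
    congr 1
    push_cast
    ring
  · rw [complexify_act, diagonalize_act h]

/-- The eigenvalues outside the elliptic planes are real and distinct, so only diagonal pairs occur.
-/
theorem isConjPair_spectrumOf {κ : ℕ} {t : Fin n → ℝ} (ht : Function.Injective t)
    {p : Fin n × Fin n} :
    IsConjPair κ (spectrumOf κ t) p ↔ κ ≤ (p.1 : ℕ) ∧ p.1 = p.2 := by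
  rw [IsConjPair]
  constructor
  · rintro ⟨h1, h2, h3⟩
    refine ⟨h1, ?_⟩
    rw [spectrumOf, spectrumOf, if_neg (not_lt.mpr h1), if_neg (not_lt.mpr h2),
      Complex.conj_ofReal] at h3
    exact (ht (by exact_mod_cast h3)).symm
  · rintro ⟨h1, h2⟩
    refine ⟨h1, h2 ▸ h1, ?_⟩
    rw [← h2, spectrumOf, if_neg (not_lt.mpr h1), Complex.conj_ofReal]

/-- The index set of the invariants. -/
abbrev InvIndex (κ : ℕ) (lam : Fin n → ℂ) : Type :=
  {j : Fin n // (j : ℕ) < κ} ⊕ {p : Fin n × Fin n // IsConjPair κ lam p}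

/-- The plane of an invariant. -/
def invPlane (κ : ℕ) (lam : Fin n → ℂ) : InvIndex κ lam → Fin n
  | .inl j => j.1
  | .inr p => p.1.1

theorem invPlane_bijective (κ : ℕ) {t : Fin n → ℝ} (ht : Function.Injective t) :
    Function.Bijective (invPlane κ (spectrumOf κ t)) := by
  constructor
  · rintro (⟨i, hi⟩ | ⟨⟨i, i'⟩, hi⟩) (⟨j, hj⟩ | ⟨⟨j, j'⟩, hj⟩) h
    · simp only [invPlane] at h
      subst h
      rfl
    · simp only [invPlane] at h
      subst h
      exact absurd hi (not_lt.mpr hj.1)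
    · simp only [invPlane] at h
      subst h
      exact absurd hj (not_lt.mpr hi.1)
    · simp only [invPlane] at h
      have h1 := ((isConjPair_spectrumOf ht).mp hi).2
      have h2 := ((isConjPair_spectrumOf ht).mp hj).2
      simp only at h1 h2
      subst h h1 h2
      rfl
  · intro j
    by_cases hj : (j : ℕ) < κ
    · exact ⟨.inl ⟨j, hj⟩, rfl⟩
    · exact ⟨.inr ⟨(j, j), (isConjPair_spectrumOf ht).mpr ⟨not_lt.mp hj, rfl⟩⟩, rfl⟩

/-- The correspondence between invariants and planes. -/
noncomputable def invEquiv (κ : ℕ) {t : Fin n → ℝ} (ht : Function.Injective t) :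
    InvIndex κ (spectrumOf κ t) ≃ Fin n := Equiv.ofBijective _ (invPlane_bijective κ ht)

/-- The factor relating an invariant to the action variable. -/
noncomputable def invFactor (κ : ℕ) (lam : Fin n → ℂ) : InvIndex κ lam → ℂ
  | .inl _ => 2 * Complex.I
  | .inr _ => 2

theorem norm_invFactor (κ : ℕ) (lam : Fin n → ℂ) (i : InvIndex κ lam) :
    ‖invFactor κ lam i‖ = 2 := by
  rcases i with i | i <;> simp [invFactor]

/-- On the diagonal the invariant is (1 + i)(1 - i) x_k y_k. -/
theorem invariants_inr {κ : ℕ} {t : Fin n → ℝ} (ht : Function.Injective t)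
    (p : {p : Fin n × Fin n // IsConjPair κ (spectrumOf κ t) p}) :
    invariants κ (spectrumOf κ t) (.inr p) = (2 : ℂ) • act ℂ p.1.1 := by
  have h := ((isConjPair_spectrumOf ht).mp p.2).2
  simp only [invariants]
  rw [← h, act, smul_eq_C_mul]
  have h2 : (C (2 : ℂ) : MvPowerSeries (Coord n) ℂ) = 2 := map_ofNat _ 2
  rw [h2]
  linear_combination (-X (.inl p.1.1) * X (.inr p.1.1)) * C_I_mul_C_I

theorem diagonalize_invariants {κ : ℕ} {t : Fin n → ℝ} (ht : Function.Injective t)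
    (i : InvIndex κ (spectrumOf κ t)) :
    diagonalize n κ (invariants κ (spectrumOf κ t) i)
      = invFactor κ (spectrumOf κ t) i • act ℂ (invEquiv κ ht i) := by
  rcases i with j | p
  · exact diagonalize_sq_add_sq j.2
  · rw [invariants_inr ht, map_smul, diagonalize_act (not_lt.mpr p.2.1)]
    rfl

theorem constantCoeff_invariants {κ : ℕ} {t : Fin n → ℝ} (ht : Function.Injective t)
    (i : InvIndex κ (spectrumOf κ t)) :
    constantCoeff (invariants κ (spectrumOf κ t) i) = 0 := by
  rcases i with j | p
  · simp [invariants]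
  · rw [invariants_inr ht]
    simp [act, smul_eq_C_mul]

theorem diagonalize_subst_invariants {κ : ℕ} {t : Fin n → ℝ} (ht : Function.Injective t)
    (g : MvPowerSeries (InvIndex κ (spectrumOf κ t)) ℂ) :
    diagonalize n κ (subst (invariants κ (spectrumOf κ t)) g)
      = subst (fun i => invFactor κ (spectrumOf κ t) i • act ℂ (invEquiv κ ht i)) g := by
  rw [diagonalize, planeEquiv_apply, subst_comp_subst_apply
    (hasSubst_of_constantCoeff_zero (constantCoeff_invariants ht)) hasSubst_planeMap]
  congr 1
  funext i
  rw [← planeEquiv_apply (diagonalize_det κ)]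
  exact diagonalize_invariants ht i

theorem isNormalForm_iff {κ : ℕ} {t : Fin n → ℝ} (ht : Function.Injective t)
    {F : MvPowerSeries (Coord n) ℝ} :
    IsNormalForm κ (spectrumOf κ t) F ↔ Balanced (diagonalize n κ (complexify F)) := by
  constructor
  · rintro ⟨g, hg⟩
    rw [complexify, hg, diagonalize_subst_invariants ht]
    exact balanced_subst_act _ _ g
  · intro h
    obtain ⟨g, hg⟩ := h.exists_eq_subst (invEquiv κ ht) (c := invFactor κ (spectrumOf κ t))
      (fun i => norm_ne_zero_iff.mp (by rw [norm_invFactor]; norm_num))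
    refine ⟨g, (diagonalize n κ).injective ?_⟩
    rw [diagonalize_subst_invariants ht, ← hg]

/-- The normalizing flow is taken over ℝ, so the transformation is real. Complexification only
serves to solve the homological equation and to recognize the normal form. -/
theorem exists_birkhoffNormalForm {κ : ℕ} {t : Fin n → ℝ} (ht : Function.Injective t)
    (hμ : IntIndep (diagSpectrum κ t)) {H : MvPowerSeries (Coord n) ℝ}
    (hH : H - quadSeries κ t ∈ ordGE (Coord n) ℝ 3) :
    ∃ F, IsBirkhoffNormalFormOf κ (spectrumOf κ t) F H := by
  have hs : IsSemisimpleHam (quadSeries κ t) :=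
    isSemisimpleHam_of_complexify (isSymplecticAut_diagonalize κ) (diagonalize_quadSeries κ t)
  have hq := quadSeries_mem_ordGE κ t
  have hq0 : pb (quadSeries κ t) H ∈ ordGE (Coord n) ℝ 3 := by
    have := pb_quadratic_mem hq hH
    rwa [pb_sub_right, pb_self, sub_zero] at this
  obtain ⟨G, hG, -, hF⟩ := exists_normalization hq hs hH le_rfl hq0
  have haut := (isSymplecticAut_flow hG).symm
  refine ⟨flow hG H, (isNormalForm_iff ht).mpr ?_, fun i => (flow hG).symm (X i),
    isFormalSymplectic_iff.mpr haut.isCanonical, ?_⟩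
  · apply balanced_of_pb_diagQuad hμ
    rw [← diagonalize_quadSeries, ← (isSymplecticAut_diagonalize κ).map_pb, ← map_pb, hF, map_zero,
      map_zero]
  · have := eq_subst_of_ordGE (flow hG).symm.toAlgHom haut.map_mem (flow hG H)
    simpa using this.symm

/-- Exponents of monomials in the invariants whose coefficients determine a normal form. -/
noncomputable def invExp (κ : ℕ) (lam : Fin n → ℂ) : InvIndex κ lam → (Coord n →₀ ℕ)
  | .inl j => Finsupp.single (.inl j.1) 2
  | .inr p => actExp (Finsupp.single p.1.1 1)

/-- The two series have the same terms free of `y_j` for all `j < κ`. -/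
def AgreeOnPositions (κ : ℕ) (f g : MvPowerSeries (Coord n) ℂ) : Prop :=
  ∀ m : Coord n →₀ ℕ, (∀ j : Fin n, (j : ℕ) < κ → m (.inr j) = 0) → coeff m f = coeff m g

/-- Setting y_j = 0 in the elliptic planes is multiplicative. It turns x_j² + y_j² into x_j², so the
invariants become multiples of independent monomials in the original real coordinates. -/
theorem AgreeOnPositions.mul {κ : ℕ} {f f' g g' : MvPowerSeries (Coord n) ℂ}
    (h : AgreeOnPositions κ f f') (h' : AgreeOnPositions κ g g') :
    AgreeOnPositions κ (f * g) (f' * g') := by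
  classical
  intro m hm
  rw [coeff_mul, coeff_mul]
  refine Finset.sum_congr rfl fun p hp => ?_
  have hpm := Finset.HasAntidiagonal.mem_antidiagonal.mp hp
  have h0 : ∀ j : Fin n, (j : ℕ) < κ → p.1 (.inr j) = 0 ∧ p.2 (.inr j) = 0 := fun j hj => by
    have := hm j hj
    rw [← hpm, Finsupp.add_apply] at this
    omega
  rw [h _ fun j hj => (h0 j hj).1, h' _ fun j hj => (h0 j hj).2]

theorem AgreeOnPositions.pow {κ : ℕ} {f g : MvPowerSeries (Coord n) ℂ}
    (h : AgreeOnPositions κ f g) (k : ℕ) : AgreeOnPositions κ (f ^ k) (g ^ k) := by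
  induction k with
  | zero => intro m _; rw [pow_zero, pow_zero]
  | succ k ih => rw [pow_succ, pow_succ]; exact ih.mul h

/-- The factor of the monomial of exponent `invExp` in an invariant. -/
noncomputable def invCoeff (κ : ℕ) (lam : Fin n → ℂ) : InvIndex κ lam → ℂ
  | .inl _ => 1
  | .inr _ => 2

theorem agreeOnPositions_invariants {κ : ℕ} {t : Fin n → ℝ} (ht : Function.Injective t)
    (i : InvIndex κ (spectrumOf κ t)) :
    AgreeOnPositions κ (invariants κ (spectrumOf κ t) i)
      (monomial (invExp κ (spectrumOf κ t) i) (invCoeff κ (spectrumOf κ t) i)) := by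
  classical
  rcases i with j | p
  · intro m hm
    simp only [invariants, invExp, invCoeff, map_add, X_pow_eq]
    rw [add_eq_left, coeff_monomial, if_neg]
    rintro rfl
    simpa using hm j.1 j.2
  · intro m _
    rw [invariants_inr ht, act_eq_monomial, ← map_smul, smul_eq_mul, mul_one]
    rfl

theorem agreeOnPositions_prod {κ : ℕ} {t : Fin n → ℝ} (ht : Function.Injective t)
    (d : InvIndex κ (spectrumOf κ t) →₀ ℕ) :
    AgreeOnPositions κ (d.prod fun i e => invariants κ (spectrumOf κ t) i ^ e)
      (monomial (d.sum fun i e => e • invExp κ (spectrumOf κ t) i)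
        (d.prod fun i e => invCoeff κ (spectrumOf κ t) i ^ e)) := by
  classical
  rw [Finsupp.prod, Finsupp.prod, Finsupp.sum]
  induction d.support using Finset.induction_on with
  | empty => intro m _; rfl
  | insert i s hi ih =>
    rw [Finset.prod_insert hi, Finset.prod_insert hi, Finset.sum_insert hi,
      ← monomial_mul_monomial, ← monomial_pow]
    exact ((agreeOnPositions_invariants ht i).pow _).mul ih

theorem sum_invExp_apply {κ : ℕ} {t : Fin n → ℝ} (ht : Function.Injective t)
    (d : InvIndex κ (spectrumOf κ t) →₀ ℕ) (i : InvIndex κ (spectrumOf κ t)) :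
    (d.sum fun i e => e • invExp κ (spectrumOf κ t) i) (.inl (invEquiv κ ht i))
      = d i * invExp κ (spectrumOf κ t) i (.inl (invEquiv κ ht i)) := by
  classical
  rw [Finsupp.sum_apply, Finsupp.sum, Finset.sum_eq_single i]
  · simp
  · intro i' _ hi'
    have hne : invEquiv κ ht i' ≠ invEquiv κ ht i := (invEquiv κ ht).injective.ne hi'
    rw [Finsupp.smul_apply, smul_eq_mul, mul_eq_zero]
    right
    rcases i' with j | p
    · exact Finsupp.single_eq_of_ne fun h => hne.symm (Sum.inl_injective h)
    · exact Finsupp.single_eq_of_ne hne.symm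
  · intro h
    rw [Finsupp.notMem_support_iff.mp h]
    simp

theorem invExp_pos {κ : ℕ} {t : Fin n → ℝ} (ht : Function.Injective t)
    (i : InvIndex κ (spectrumOf κ t)) :
    0 < invExp κ (spectrumOf κ t) i (.inl (invEquiv κ ht i)) := by
  classical
  rcases i with j | p
  · simp [invExp, invEquiv, invPlane]
  · simp [invExp, invEquiv, invPlane, actExp_inl]

theorem sum_invExp_injective {κ : ℕ} {t : Fin n → ℝ} (ht : Function.Injective t) :
    Function.Injective fun d : InvIndex κ (spectrumOf κ t) →₀ ℕ =>
      d.sum fun i e => e • invExp κ (spectrumOf κ t) i := by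
  intro d d' h
  ext i
  have := DFunLike.congr_fun h (.inl (invEquiv κ ht i))
  simp only [sum_invExp_apply ht] at this
  exact Nat.eq_of_mul_eq_mul_right (invExp_pos ht i) this

theorem sum_invExp_inr {κ : ℕ} {t : Fin n → ℝ} (d : InvIndex κ (spectrumOf κ t) →₀ ℕ) {j : Fin n}
    (hj : (j : ℕ) < κ) : (d.sum fun i e => e • invExp κ (spectrumOf κ t) i) (.inr j) = 0 := by
  classical
  rw [Finsupp.sum_apply]
  refine Finset.sum_eq_zero fun i _ => ?_
  simp only [Finsupp.smul_apply, smul_eq_mul, mul_eq_zero]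
  right
  rcases i with l | p
  · simp [invExp]
  · simp only [invExp, actExp_inr]
    refine Finsupp.single_eq_of_ne ?_
    rintro rfl
    exact absurd hj (not_lt.mpr p.2.1)

theorem degree_sum_invExp {κ : ℕ} {t : Fin n → ℝ} (d : InvIndex κ (spectrumOf κ t) →₀ ℕ) :
    (d.sum fun i e => e • invExp κ (spectrumOf κ t) i).degree = 2 * d.degree := by
  rw [Finsupp.sum, map_sum, Finsupp.degree_apply, Finset.mul_sum]
  refine Finset.sum_congr rfl fun i _ => ?_
  rw [map_nsmul, smul_eq_mul, mul_comm]
  congr 1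
  rcases i with l | p
  · simp [invExp]
  · simp [invExp, degree_actExp]

/-- Each coefficient of the outer series is visible, up to a power of 2, in a single coefficient of
the real normal form, without passing to complex coordinates. This is what convergence in the real
coordinates is tested against. -/
theorem coeff_subst_invariants {κ : ℕ} {t : Fin n → ℝ} (ht : Function.Injective t)
    (g : MvPowerSeries (InvIndex κ (spectrumOf κ t)) ℂ) (k : InvIndex κ (spectrumOf κ t) →₀ ℕ) :
    coeff (k.sum fun i e => e • invExp κ (spectrumOf κ t) i)
        (subst (invariants κ (spectrumOf κ t)) g)
      = (k.prod fun i e => invCoeff κ (spectrumOf κ t) i ^ e) * coeff k g := by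
  classical
  have key := fun d => agreeOnPositions_prod ht d (k.sum fun i e => e • invExp κ (spectrumOf κ t) i)
    fun j hj => sum_invExp_inr k hj
  rw [coeff_subst (hasSubst_of_constantCoeff_zero (constantCoeff_invariants ht)),
    finsum_eq_single _ k]
  · rw [key, coeff_monomial_same, smul_eq_mul, mul_comm]
  · intro d hd
    rw [key, coeff_monomial_ne, smul_zero]
    intro h
    exact hd (sum_invExp_injective ht h).symm

/-- The coefficients of a Birkhoff normal form control those of any normalization in the
diagonalizing coordinates. -/
theorem exists_coeff_ge {κ : ℕ} {t : Fin n → ℝ} (ht : Function.Injective t)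
    (hμ : IntIndep (diagSpectrum κ t)) {F H : MvPowerSeries (Coord n) ℝ}
    (hFH : IsBirkhoffNormalFormOf κ (spectrumOf κ t) F H)
    {e : MvPowerSeries (Coord n) ℂ ≃ₐ[ℂ] MvPowerSeries (Coord n) ℂ} (he : IsSymplecticAut e)
    {F₁ : MvPowerSeries (Coord n) ℂ} (heF : e (diagonalize n κ (complexify H)) = F₁)
    (hF₁ : pb (diagQuad (diagSpectrum κ t)) F₁ = 0)
    (hq : F₁ - diagQuad (diagSpectrum κ t) ∈ ordGE (Coord n) ℂ 3) (k : Fin n →₀ ℕ) :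
    ∃ m : Coord n →₀ ℕ, m.degree = 2 * k.degree ∧
      ‖coeff (actExp k) F₁‖ ≤ 2 ^ k.degree * |coeff m F| := by
  classical
  obtain ⟨hnf, φ, hφ, hsub⟩ := hFH
  have hcan := (isFormalSymplectic_iff.mp hφ).map Complex.ofRealHom
  set T := diagonalize n κ with hTdef
  have hT : IsSymplecticAut T := isSymplecticAut_diagonalize κ
  -- Leave the diagonal coordinates, undo the given normalization by φ, return, and apply e: the
  -- Birkhoff normal form goes to F₁.
  let Ψ : MvPowerSeries (Coord n) ℂ →ₐ[ℂ] MvPowerSeries (Coord n) ℂ :=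
    (e.toAlgHom.comp T.toAlgHom).comp ((substAlgHom hcan.hasSubst).comp T.symm.toAlgHom)
  have hΨ : ∀ f, Ψ f = e (T (subst (fun i => MvPowerSeries.map Complex.ofRealHom (φ i))
      (T.symm f))) := fun f => by
    simp [Ψ]
  obtain ⟨π, s, hs, hπ⟩ := coeff_normalForm_unique hμ ((isNormalForm_iff ht).mp hnf)
    (balanced_of_pb_diagQuad hμ hF₁) hq Ψ
    (fun f g => by
      simp only [hΨ]
      rw [hT.symm.map_pb, hcan.subst_pb, hT.map_pb, he.map_pb])
    (fun N f hf => by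
      rw [hΨ]
      exact he.map_mem _ _ (hT.map_mem _ _ (subst_mem_ordGE hcan.1 (hT.symm_mem _ _ hf))))
    (by
      rw [hΨ, AlgEquiv.symm_apply_apply, complexify,
        ← map_subst (isFormalSymplectic_iff.mp hφ).hasSubst, hsub, heF])
  obtain ⟨g, hg⟩ := hnf
  -- The exponent k is pulled back through the permutation and then re-indexed by the invariants.
  -- Signs have modulus one, each `invFactor` has modulus 2, and `invCoeff` can only help.
  set l := k.mapDomain π.symm with hl
  have hkl : l.mapDomain π = k := by
    rw [hl, ← Finsupp.mapDomain_comp]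
    simp
  set r := l.mapDomain (invEquiv κ ht).symm with hr
  have hlr : r.mapDomain (invEquiv κ ht) = l := by
    rw [hr, ← Finsupp.mapDomain_comp]
    simp
  have hdeg : r.degree = k.degree := by
    rw [hr, Finsupp.degree_mapDomain, hl, Finsupp.degree_mapDomain]
  refine ⟨r.sum fun i e => e • invExp κ (spectrumOf κ t) i, by rw [degree_sum_invExp, hdeg], ?_⟩
  have h1 := hπ l
  rw [hkl] at h1
  have h2 : coeff (actExp l) (T (complexify F))
      = (r.prod fun i e => invFactor κ (spectrumOf κ t) i ^ e) * coeff r g := by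
    rw [complexify, hg, hTdef, diagonalize_subst_invariants ht, ← hlr, coeff_subst_act]
  have h3 := coeff_subst_invariants ht g r
  rw [← hg, coeff_map] at h3
  have n1 : ‖l.prod fun i e => s i ^ e‖ = 1 := by
    rw [Finsupp.prod, norm_prod]
    refine Finset.prod_eq_one fun i _ => ?_
    rw [norm_pow]
    rcases hs i with h | h <;> simp [h]
  have n2 : ‖r.prod fun i e => invFactor κ (spectrumOf κ t) i ^ e‖ = 2 ^ k.degree := by
    rw [Finsupp.prod, norm_prod, ← hdeg, Finsupp.degree_apply, ← Finset.prod_pow_eq_pow_sum]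
    exact Finset.prod_congr rfl fun i _ => by rw [norm_pow, norm_invFactor]
  have n3 : 1 ≤ ‖r.prod fun i e => invCoeff κ (spectrumOf κ t) i ^ e‖ := by
    rw [Finsupp.prod, norm_prod]
    refine Finset.one_le_prod fun i _ => ?_
    rw [norm_pow]
    refine one_le_pow₀ ?_
    rcases i with i | i <;> simp [invCoeff]
  have n4 : ‖coeff r g‖ ≤ |coeff (r.sum fun i e => e • invExp κ (spectrumOf κ t) i) F| := by
    have := congrArg norm h3
    rw [norm_mul] at this
    have e1 : ‖Complex.ofRealHom (coeff (r.sum fun i e => e • invExp κ (spectrumOf κ t) i) F)‖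
        = |coeff (r.sum fun i e => e • invExp κ (spectrumOf κ t) i) F| := by simp
    rw [← e1, this]
    exact le_mul_of_one_le_left (norm_nonneg _) n3
  rw [h1, norm_mul, n1, one_mul, h2, norm_mul, n2]
  exact mul_le_mul_of_nonneg_left n4 (by positivity)

end Model

/-! ### Frequencies: transcendence and rational approximation -/

section Spectrum

variable {n : ℕ}

/-- There is a transcendental number in `(0, 1)` with extremely good rational approximations. -/
theorem exists_transcendental_approximable :
    ∃ x : ℝ, 0 < x ∧ x < 1 ∧ Transcendental ℤ x ∧ ∀ N : ℕ, ∃ p q : ℕ, N ≤ p ∧ 1 ≤ q ∧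
      |(q : ℝ) * x - p| < 1 / ((p + q : ℕ) : ℝ) ^ (p + q) := by
  -- Natural p and q approximate only nonnegative numbers; the negative half-line is included to
  -- make the set dense in ℝ and is discarded at the end.
  let U : ℕ → Set ℝ := fun N => Set.Iio 0 ∪ ⋃ (p : ℕ) (q : ℕ) (_ : N ≤ p) (_ : 1 ≤ q),
    {x : ℝ | |(q : ℝ) * x - p| < 1 / ((p + q : ℕ) : ℝ) ^ (p + q)}
  have hU : ∀ N, U N ∈ residual ℝ := fun N => by
    refine residual_of_dense_open (isOpen_Iio.union (isOpen_iUnion fun p => isOpen_iUnion fun q =>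
      isOpen_iUnion fun _ => isOpen_iUnion fun _ => isOpen_lt (by fun_prop) continuous_const))
      (dense_of_exists_between fun a b hab => ?_)
    rcases le_or_gt b 0 with hb | hb
    · obtain ⟨c, hc⟩ := exists_between hab
      exact ⟨c, Or.inl (hc.2.trans_le hb), hc⟩
    · obtain ⟨r, hr1, hr2⟩ := exists_rat_btwn (max_lt hab hb)
      have hr0 : 0 < r := by exact_mod_cast (le_max_right a 0).trans_lt hr1
      refine ⟨r, Or.inr ?_, (le_max_left a 0).trans_lt hr1, hr2⟩
      have hnum : 0 < r.num := Rat.num_pos.mpr hr0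
      have hnat : ((r.num.toNat : ℕ) : ℤ) = r.num := Int.toNat_of_nonneg hnum.le
      have hden := r.den_pos
      simp only [Set.mem_iUnion]
      -- The fraction is expanded by N + 1 to get p ≥ N, and q r - p is exactly zero.
      refine ⟨r.num.toNat * (N + 1), r.den * (N + 1), ?_, ?_, ?_⟩
      · have : 1 ≤ r.num.toNat := by omega
        nlinarith
      · nlinarith
      · have e1 : ((r.num.toNat : ℕ) : ℝ) = (r.num : ℝ) := by exact_mod_cast congrArg (Int.cast (R := ℝ)) hnat
        have e2 : (r.den : ℝ) * (r : ℝ) = r.num := by exact_mod_cast Rat.den_mul_eq_num r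
        have : ((r.den * (N + 1) : ℕ) : ℝ) * (r : ℝ) - ((r.num.toNat * (N + 1) : ℕ) : ℝ) = 0 := by
          push_cast
          rw [e1, ← e2]
          ring
        rw [Set.mem_ofPred_eq, this, abs_zero]
        positivity
  have hT : {x : ℝ | IsAlgebraic ℤ x}ᶜ ∈ residual ℝ := by
    have : {x : ℝ | IsAlgebraic ℤ x}ᶜ = ⋂ y ∈ {x : ℝ | IsAlgebraic ℤ x}, {y}ᶜ := by
      ext x
      simp only [Set.mem_compl_iff, Set.mem_iInter, Set.mem_singleton_iff]
      exact ⟨fun h y hy hxy => h (hxy ▸ hy), fun h hx => h x hx rfl⟩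
    rw [this, countable_bInter_mem (Algebraic.countable ℤ ℝ)]
    exact fun y _ => residual_of_dense_open isOpen_compl_singleton (dense_compl_singleton y)
  have hall : ({x : ℝ | IsAlgebraic ℤ x}ᶜ ∩ ⋂ N, U N) ∈ residual ℝ :=
    Filter.inter_mem hT (countable_iInter_mem.mpr hU)
  obtain ⟨x, ⟨hx0, hx1⟩, hxT, hxU⟩ := (dense_of_mem_residual hall).inter_open_nonempty
    (Set.Ioo (0 : ℝ) 1) isOpen_Ioo ⟨1 / 2, by norm_num, by norm_num⟩
  refine ⟨x, hx0, hx1, hxT, fun N => ?_⟩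
  rcases Set.mem_iInter.mp hxU N with h | h
  · exact absurd h (not_lt.mpr hx0.le)
  · simp only [Set.mem_iUnion] at h
    obtain ⟨p, q, hp, hq, h⟩ := h
    exact ⟨p, q, hp, hq, h⟩

/-- Powers of a transcendental number are linearly independent over the integers. -/
theorem sum_pow_mul_ne_zero {x : ℝ} (hx : Transcendental ℤ x) (α : Fin n → ℤ) (hα : α ≠ 0) :
    ∑ j : Fin n, x ^ (j : ℕ) * (α j : ℝ) ≠ 0 := by
  classical
  intro h
  apply hα
  have := (transcendental_iff.mp hx) (∑ j : Fin n, Polynomial.monomial (j : ℕ) (α j)) (by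
    rw [map_sum, ← h]
    refine Finset.sum_congr rfl fun j _ => ?_
    rw [Polynomial.aeval_monomial]
    simp [mul_comm])
  funext j
  have hj := congrArg (fun f => Polynomial.coeff f (j : ℕ)) this
  simpa [Polynomial.finsetSum_coeff, Polynomial.coeff_monomial, Fin.val_inj] using hj

/-- Turning some of the members of a real family that is linearly independent over the integers by
a right angle keeps it independent. -/
theorem sum_ite_ne_zero {t : Fin n → ℝ}
    (ht : ∀ α : Fin n → ℤ, α ≠ 0 → ∑ j, t j * (α j : ℝ) ≠ 0) (κ : ℕ) {ε : ℝ} (hε : ε ≠ 0)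
    (α : Fin n → ℤ) (hα : α ≠ 0) :
    ∑ j : Fin n, (if (j : ℕ) < κ then Complex.I * (ε * t j : ℝ) else (t j : ℂ)) * (α j : ℂ) ≠ 0 := by
  intro h
  apply hα
  -- The real part of the relation involves only the hyperbolic indices, the imaginary part only the
  -- elliptic ones.
  have hre : ∑ j : Fin n, t j * (((if (j : ℕ) < κ then 0 else α j : ℤ)) : ℝ) = 0 := by
    have := congrArg Complex.re h
    rw [Complex.re_sum, Complex.zero_re] at this
    rw [← this]
    refine Finset.sum_congr rfl fun j _ => ?_
    split_ifs <;> simp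
  have him : ∑ j : Fin n, t j * (((if (j : ℕ) < κ then α j else 0 : ℤ)) : ℝ) = 0 := by
    have := congrArg Complex.im h
    rw [Complex.im_sum, Complex.zero_im] at this
    refine (mul_eq_zero.mp ?_).resolve_left hε
    rw [← this, Finset.mul_sum]
    refine Finset.sum_congr rfl fun j _ => ?_
    split_ifs <;> simp [mul_assoc]
  have h1 := not_imp_not.mp (ht _) hre
  have h2 := not_imp_not.mp (ht _) him
  funext j
  have h1j := congrFun h1 j
  have h2j := congrFun h2 j
  by_cases hj : (j : ℕ) < κ
  · simpa [hj] using h2j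
  · simpa [hj] using h1j

theorem nonResonant_spectrumOf {t : Fin n → ℝ}
    (ht : ∀ α : Fin n → ℤ, α ≠ 0 → ∑ j, t j * (α j : ℝ) ≠ 0) (κ : ℕ) :
    NonResonant (spectrumOf κ t) := fun α hα => by
  simpa [spectrumOf] using sum_ite_ne_zero ht κ one_ne_zero α hα

theorem intIndep_diagSpectrum {t : Fin n → ℝ}
    (ht : ∀ α : Fin n → ℤ, α ≠ 0 → ∑ j, t j * (α j : ℝ) ≠ 0) (κ : ℕ) :
    IntIndep (diagSpectrum κ t) := fun α hα => by
  simpa [diagSpectrum] using sum_ite_ne_zero ht κ (neg_ne_zero.mpr one_ne_zero) α hα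

theorem isSpectrum_spectrumOf {t : Fin n → ℝ} (ht : ∀ j, t j ≠ 0) (κ : ℕ) :
    IsSpectrum κ (spectrumOf κ t) := by
  refine ⟨fun j => ?_, fun k hk => ⟨k, hk, ?_⟩⟩
  · rw [spectrumOf]
    split_ifs with h
    · simp [h]
    · simp [h, ht j]
  · rw [spectrumOf, if_neg (not_lt.mpr hk), Complex.conj_ofReal]

end Spectrum

/-! ### Coefficient bounds, convergence and analyticity -/

section Convergence

variable {σ : Type*} [Fintype σ]

/-- Every finite partial sum lies in a box, where it factors into geometric sums. -/
theorem summable_pow_degree {ρ : ℝ} (h0 : 0 ≤ ρ) (h1 : ρ < 1) :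
    Summable fun m : σ →₀ ℕ => ρ ^ m.degree := by
  classical
  refine summable_of_sum_le (c := ∏ _i : σ, (1 - ρ)⁻¹) (fun m => by positivity) fun u => ?_
  obtain ⟨N, hN⟩ : ∃ N, ∀ m ∈ u, m.degree < N :=
    ⟨u.sup Finsupp.degree + 1, fun m hm => Nat.lt_succ_of_le (Finset.le_sup (f := Finsupp.degree) hm)⟩
  calc ∑ m ∈ u, ρ ^ m.degree
      = ∑ x ∈ u.map ⟨fun m : σ →₀ ℕ => (m : σ → ℕ), DFunLike.coe_injective⟩, ∏ i, ρ ^ x i := by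
        rw [Finset.sum_map]
        refine Finset.sum_congr rfl fun m _ => ?_
        rw [Finset.prod_pow_eq_pow_sum, Finsupp.degree_eq_sum]
        rfl
    _ ≤ ∑ x ∈ Fintype.piFinset fun _ : σ => Finset.range N, ∏ i, ρ ^ x i := by
        refine Finset.sum_le_sum_of_subset_of_nonneg (fun x hx => ?_)
          fun x _ _ => Finset.prod_nonneg fun i _ => by positivity
        obtain ⟨m, hm, rfl⟩ := Finset.mem_map.mp hx
        rw [Fintype.mem_piFinset]
        intro i
        exact Finset.mem_range.mpr ((Finsupp.le_degree i m).trans_lt (hN m hm))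
    _ = ∏ _i : σ, ∑ k ∈ Finset.range N, ρ ^ k := by
        rw [Finset.prod_univ_sum]
    _ ≤ _ := by
        refine Finset.prod_le_prod (fun _ _ => Finset.sum_nonneg fun _ _ => by positivity)
          fun _ _ => ?_
        rw [← tsum_geometric_of_lt_one h0 h1]
        exact (summable_geometric_of_lt_one h0 h1).sum_le_tsum _ fun _ _ => by positivity

/-- The multilinear map whose diagonal is a given monomial. -/
theorem exists_multilinear_monomial (d : ℕ) (m : σ →₀ ℕ) :
    ∃ M : ContinuousMultilinearMap ℝ (fun _ : Fin d => σ → ℝ) ℝ, ‖M‖ ≤ 1 ∧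
      (m.degree = d → ∀ z : σ → ℝ, M (fun _ => z) = m.prod fun i k => z i ^ k) := by
  by_cases h : m.degree = d
  · have hl : (Finsupp.toMultiset m).toList.length = d := by
      rw [Multiset.length_toList, Finsupp.card_toMultiset, ← h, Finsupp.degree_apply]
      rfl
    generalize hL : (Finsupp.toMultiset m).toList = l at hl
    subst hl
    refine ⟨(ContinuousMultilinearMap.mkPiAlgebraFin ℝ l.length ℝ).compContinuousLinearMap
      fun i => ContinuousLinearMap.proj (l.get i), ?_, fun _ z => ?_⟩
    · refine (ContinuousMultilinearMap.norm_compContinuousLinearMap_le _ _).trans ?_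
      rw [ContinuousMultilinearMap.norm_mkPiAlgebraFin, one_mul]
      refine Finset.prod_le_one (fun _ _ => norm_nonneg _) fun i _ => ?_
      refine ContinuousLinearMap.opNorm_le_bound _ zero_le_one fun z => ?_
      rw [one_mul]
      exact norm_le_pi_norm z _
    · have e1 : (List.ofFn fun i => z (l.get i)) = l.map z := by
        rw [← List.ofFn_get l, List.map_ofFn]
        simp [Function.comp_def]
      have e2 : (l.map z).prod = ((Finsupp.toMultiset m).map z).prod := by
        rw [← hL, ← Multiset.coe_toList (Finsupp.toMultiset m), Multiset.map_coe,
          Multiset.prod_coe, Multiset.coe_toList]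
      rw [ContinuousMultilinearMap.compContinuousLinearMap_apply,
        ContinuousMultilinearMap.mkPiAlgebraFin_apply]
      change (List.ofFn fun i => z (l.get i)).prod = _
      rw [e1, e2, Finsupp.toMultiset_map, Finsupp.prod_toMultiset,
        Finsupp.prod_mapDomain_index (fun _ => pow_zero _) fun _ _ _ => pow_add _ _ _]
  · exact ⟨0, by simp, fun h' => absurd h' h⟩

theorem abs_monomial_le {r : ℝ} {z : σ → ℝ} (hz : ‖z‖ ≤ r) (m : σ →₀ ℕ) :
    |m.prod fun i k => z i ^ k| ≤ r ^ m.degree := by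
  rw [Finsupp.prod, Finset.abs_prod, Finsupp.degree_apply, ← Finset.prod_pow_eq_pow_sum]
  refine Finset.prod_le_prod (fun _ _ => abs_nonneg _) fun i _ => ?_
  rw [abs_pow]
  exact pow_le_pow_left₀ (abs_nonneg _) ((norm_le_pi_norm z i).trans hz) _

/-- A power series with geometrically bounded coefficients is the expansion of an analytic function
that vanishes to the order of the series. -/
theorem exists_analyticAt_hasExpansion {H : MvPowerSeries σ ℝ} {C M : ℝ} (hM : 0 < M)
    (hH : ∀ m, |coeff m H| ≤ C * M ^ m.degree) {N : ℕ} (hN : H ∈ ordGE σ ℝ N) :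
    ∃ h : (σ → ℝ) → ℝ, AnalyticAt ℝ h 0 ∧ (h =O[𝓝 0] fun z => ‖z‖ ^ N) ∧ HasExpansion h H := by
  classical
  have hC : 0 ≤ C := by
    have := (abs_nonneg _).trans (hH 0)
    simpa using this
  have hS := (summable_pow_degree (σ := σ) (ρ := 1 / 2) (by norm_num) (by norm_num)).mul_left C
  -- This radius makes M r = 1/2, which leaves a summable bound in several variables.
  set r : ℝ := 1 / (2 * M) with hr
  have hr0 : 0 < r := by positivity
  have hMr : M * r = 1 / 2 := by
    rw [hr]
    field_simp
  have hb : ∀ m : σ →₀ ℕ, |coeff m H| * r ^ m.degree ≤ C * (1 / 2) ^ m.degree := fun m => by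
    rw [← hMr, mul_pow, ← mul_assoc]
    exact mul_le_mul_of_nonneg_right (hH m) (by positivity)
  choose E hE1 hE2 using exists_multilinear_monomial (σ := σ)
  let fib : ℕ → Finset (σ →₀ ℕ) := fun d => (Finsupp.finite_of_degree_eq (σ := σ) d).toFinset
  have hfib : ∀ d m, m ∈ fib d ↔ m.degree = d := fun d m => by simp [fib]
  let p : FormalMultilinearSeries ℝ (σ → ℝ) ℝ := fun d => ∑ m ∈ fib d, coeff m H • E d m
  have hp : ∀ d, p d = ∑ m ∈ fib d, coeff m H • E d m := fun _ => rfl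
  have hpz : ∀ d z, p d (fun _ => z) = ∑ m ∈ fib d, term H z m := fun d z => by
    rw [hp, sum_apply]
    refine Finset.sum_congr rfl fun m hm => ?_
    rw [smul_apply, hE2 d m ((hfib d m).mp hm), smul_eq_mul, term]
  have hrad : ENNReal.ofReal r ≤ p.radius := by
    refine p.le_radius_of_bound (∑' m : σ →₀ ℕ, C * (1 / 2) ^ m.degree) fun d => ?_
    rw [Real.coe_toNNReal _ hr0.le]
    calc ‖p d‖ * r ^ d ≤ (∑ m ∈ fib d, |coeff m H|) * r ^ d := by
          refine mul_le_mul_of_nonneg_right ?_ (by positivity)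
          rw [hp]
          refine norm_sum_le_of_le _ fun m _ => ?_
          rw [norm_smul, Real.norm_eq_abs]
          exact mul_le_of_le_one_right (abs_nonneg _) (hE1 d m)
      _ ≤ ∑ m ∈ fib d, C * (1 / 2) ^ m.degree := by
          rw [Finset.sum_mul]
          refine Finset.sum_le_sum fun m hm => ?_
          rw [← (hfib d m).mp hm]
          exact hb m
      _ ≤ _ := hS.sum_le_tsum _ fun m _ => by positivity
  have hball := p.hasFPowerSeriesOnBall ((ENNReal.ofReal_pos.mpr hr0).trans_le hrad)
  refine ⟨p.sum, hball.analyticAt, ?_, ?_⟩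
  · have h1 := hball.hasFPowerSeriesAt.isBigO_sub_partialSum_pow N
    refine h1.congr_left fun z => ?_
    rw [zero_add, sub_eq_self, FormalMultilinearSeries.partialSum]
    refine Finset.sum_eq_zero fun d hd => ?_
    rw [hpz]
    refine Finset.sum_eq_zero fun m hm => ?_
    rw [term, mem_ordGE.mp hN m (by rw [(hfib d m).mp hm]; exact Finset.mem_range.mp hd), zero_mul]
  · filter_upwards [Metric.ball_mem_nhds (0 : σ → ℝ) hr0] with z hz
    have hzr : ‖z‖ < r := by simpa using hz
    have hsum : Summable (term H z) := by
      refine Summable.of_norm_bounded hS fun m => ?_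
      rw [term, norm_mul, Real.norm_eq_abs, Real.norm_eq_abs]
      exact (mul_le_mul_of_nonneg_left (abs_monomial_le hzr.le m) (abs_nonneg _)).trans (hb m)
    have h1 := hball.hasSum (y := z) (by
      rw [Metric.mem_eball, edist_zero_right]
      refine lt_of_lt_of_le ?_ hrad
      rw [← ofReal_norm]
      exact (ENNReal.ofReal_lt_ofReal_iff hr0).mpr hzr)
    -- Absolute convergence allows regrouping the monomials by degree, as in the formal multilinear
    -- series.
    have h2 : HasSum (fun d => p d fun _ => z) (∑' m, term H z m) := by
      have h3 := (Equiv.sigmaFiberEquiv (Finsupp.degree (σ := σ) (R := ℕ))).hasSum_iff.mpr hsum.hasSum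
      refine h3.sigma fun d => ?_
      rw [hpz]
      rw [← Finset.sum_subtype_of_mem (p := fun m : σ →₀ ℕ => m.degree = d) (term H z)
        fun m hm => (hfib d m).mp hm]
      refine hasSum_sum_of_ne_finset_zero fun m hm => absurd ?_ hm
      exact Finset.mem_subtype.mpr ((hfib d m).mpr m.2)
    rw [zero_add] at h1
    rw [h1.unique h2]
    exact hsum.hasSum

/-- The coefficients of a convergent power series are geometrically bounded. -/
theorem IsConvergent.exists_bound {H : MvPowerSeries σ ℝ} (h : IsConvergent H) :
    ∃ C r : ℝ, 0 < r ∧ ∀ m, |coeff m H| * r ^ m.degree ≤ C := by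
  obtain ⟨ε, hε, hball⟩ := Metric.eventually_nhds_iff.mp h
  have hs : Summable (term H fun _ => ε / 2) := by
    refine hball ?_
    rw [dist_zero_right]
    refine (pi_norm_const_le _).trans_lt ?_
    rw [Real.norm_of_nonneg (by positivity)]
    linarith
  refine ⟨∑' m, |term H (fun _ => ε / 2) m|, ε / 2, by positivity, fun m => ?_⟩
  refine le_trans (le_of_eq ?_) (hs.abs.le_tsum m fun _ _ => abs_nonneg _)
  rw [term, abs_mul, Finsupp.prod, Finset.prod_pow_eq_pow_sum, Finsupp.degree_apply]
  congr 1
  rw [abs_of_nonneg (by positivity)]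

theorem hasSum_term_add {H₁ H₂ : MvPowerSeries σ ℝ} {z : σ → ℝ} {a b : ℝ}
    (h₁ : HasSum (term H₁ z) a) (h₂ : HasSum (term H₂ z) b) :
    HasSum (term (H₁ + H₂) z) (a + b) := by
  convert h₁.add h₂ using 1
  funext m
  rw [term, term, term, map_add, add_mul]

theorem hasSum_term_smul {H : MvPowerSeries σ ℝ} {z : σ → ℝ} {a : ℝ} (h : HasSum (term H z) a)
    (c : ℝ) : HasSum (term (c • H) z) (c * a) := by
  have : term (c • H) z = fun m => c * term H z m := by
    funext m
    rw [term, term, coeff_smul, mul_assoc]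
  rw [this]
  exact h.mul_left c

theorem hasSum_term_sum {ι : Type*} (s : Finset ι) {H : ι → MvPowerSeries σ ℝ} {z : σ → ℝ}
    {a : ι → ℝ} (h : ∀ i ∈ s, HasSum (term (H i) z) (a i)) :
    HasSum (term (∑ i ∈ s, H i) z) (∑ i ∈ s, a i) := by
  convert hasSum_sum h using 1
  funext m
  simp only [term]
  rw [map_sum, Finset.sum_mul]

theorem hasSum_term_monomial (e : σ →₀ ℕ) (z : σ → ℝ) :
    HasSum (term (monomial e (1 : ℝ)) z) (e.prod fun i k => z i ^ k) := by
  classical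
  have := hasSum_single (f := term (monomial e (1 : ℝ)) z) e fun m hm => by
    rw [term, coeff_monomial_ne hm, zero_mul]
  rwa [term, coeff_monomial_same, one_mul] at this

end Convergence

/-! ### The quadratic part as a function and as a series -/

section QuadraticPart

variable {n : ℕ}

theorem quadraticPart_spectrumOf {κ : ℕ} {t : Fin n → ℝ} (ht : Function.Injective t)
    (z : Coord n → ℝ) :
    quadraticPart κ (spectrumOf κ t) z = ∑ j : Fin n, t j *
      if (j : ℕ) < κ then -1 / 2 * (z (.inl j) ^ 2 + z (.inr j) ^ 2) else z (.inl j) * z (.inr j) := by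
  classical
  have h2 : ∑ p ∈ Finset.univ.filter (fun p : Fin n × Fin n => IsConjPair κ (spectrumOf κ t) p),
      spectrumOf κ t p.1 * ((z (.inl p.1) : ℂ) + Complex.I * (z (.inl p.2) : ℂ)) *
        ((z (.inr p.1) : ℂ) - Complex.I * (z (.inr p.2) : ℂ))
      = ∑ j ∈ Finset.univ.filter (fun j : Fin n => ¬ (j : ℕ) < κ),
        ((2 * (t j * (z (.inl j) * z (.inr j))) : ℝ) : ℂ) := by
    refine Finset.sum_bij' (fun p _ => p.1) (fun j _ => (j, j)) ?_ ?_ ?_ ?_ ?_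
    · intro p hp
      have := (isConjPair_spectrumOf ht).mp (Finset.mem_filter.mp hp).2
      simpa using this.1
    · intro j hj
      refine Finset.mem_filter.mpr ⟨Finset.mem_univ _, (isConjPair_spectrumOf ht).mpr ⟨?_, rfl⟩⟩
      simpa using hj
    · intro p hp
      have := (isConjPair_spectrumOf ht).mp (Finset.mem_filter.mp hp).2
      exact Prod.ext rfl this.2
    · intro j _
      rfl
    · intro p hp
      have := (isConjPair_spectrumOf ht).mp (Finset.mem_filter.mp hp).2
      rw [← this.2, spectrumOf, if_neg (not_lt.mpr this.1)]
      push_cast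
      linear_combination (-(t p.1 * z (.inl p.1) * z (.inr p.1)) : ℂ) * Complex.I_mul_I
  rw [quadraticPart, ← Finset.sum_filter_add_sum_filter_not Finset.univ
    (fun j : Fin n => (j : ℕ) < κ) (fun j => t j * _)]
  congr 1
  · rw [Finset.mul_sum]
    refine Finset.sum_congr rfl fun j hj => ?_
    have hj' := (Finset.mem_filter.mp hj).2
    rw [if_pos hj', spectrumOf, if_pos hj', ← mul_assoc Complex.I, Complex.I_mul_I]
    simp only [neg_mul, one_mul, Complex.neg_re, Complex.ofReal_re]
    ring
  · rw [h2, ← Complex.ofReal_sum, Complex.ofReal_re, Finset.mul_sum]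
    refine Finset.sum_congr rfl fun j hj => ?_
    rw [if_neg (Finset.mem_filter.mp hj).2]
    ring

theorem analyticAt_quadraticPart {κ : ℕ} {t : Fin n → ℝ} (ht : Function.Injective t) :
    AnalyticAt ℝ (quadraticPart κ (spectrumOf κ t)) 0 := by
  have hc : ∀ i : Coord n, AnalyticAt ℝ (fun z : Coord n → ℝ => z i) 0 := fun i =>
    (ContinuousLinearMap.proj (R := ℝ) (φ := fun _ : Coord n => ℝ) i).analyticAt 0
  have : quadraticPart κ (spectrumOf κ t) = fun z : Coord n → ℝ => ∑ j : Fin n, t j *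
      if (j : ℕ) < κ then -1 / 2 * (z (.inl j) ^ 2 + z (.inr j) ^ 2)
        else z (.inl j) * z (.inr j) := funext fun z => quadraticPart_spectrumOf ht z
  rw [this]
  refine Finset.analyticAt_fun_sum _ fun j _ => analyticAt_const.mul ?_
  split_ifs
  · exact analyticAt_const.mul (((hc _).pow 2).add ((hc _).pow 2))
  · exact (hc _).mul (hc _)

theorem hasSum_term_quadSeries {κ : ℕ} {t : Fin n → ℝ} (ht : Function.Injective t)
    (z : Coord n → ℝ) :
    HasSum (term (quadSeries κ t) z) (quadraticPart κ (spectrumOf κ t) z) := by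
  classical
  rw [quadraticPart_spectrumOf ht, quadSeries]
  refine hasSum_term_sum _ fun j _ => hasSum_term_smul ?_ _
  rw [planeQuad]
  split_ifs
  · refine hasSum_term_smul (hasSum_term_add ?_ ?_) _
    all_goals
      rw [X_pow_eq]
      convert hasSum_term_monomial _ z using 1
      exact (Finsupp.prod_single_index (h := fun i k => z i ^ k) (pow_zero _)).symm
  · rw [act, X, X, monomial_mul_monomial, one_mul]
    convert hasSum_term_monomial _ z using 1
    rw [Finsupp.prod_add_index' (fun _ => pow_zero _) (fun _ _ _ => pow_add _ _ _),
      Finsupp.prod_single_index (h := fun i k => z i ^ k) (pow_zero _),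
      Finsupp.prod_single_index (h := fun i k => z i ^ k) (pow_zero _), pow_one, pow_one]

end QuadraticPart

/-! ### The real perturbation and its coefficients -/

section PairSeries

variable {n : ℕ}

theorem posForm_mem_ordGE (κ : ℕ) (j : Fin n) : posForm κ j ∈ ordGE (Coord n) ℂ 1 := by
  rw [posForm]
  split_ifs
  · exact Ideal.sub_mem _ (X_mem_ordGE _) (Ideal.mul_mem_left _ _ (X_mem_ordGE _))
  · exact X_mem_ordGE _

theorem momForm_mem_ordGE (κ : ℕ) (j : Fin n) : momForm κ j ∈ ordGE (Coord n) ℂ 1 := by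
  rw [momForm]
  split_ifs
  · exact Ideal.add_mem _ (X_mem_ordGE _) (Ideal.mul_mem_left _ _ (X_mem_ordGE _))
  · exact X_mem_ordGE _

theorem norm_coeff_mul_X_le {σ : Type*} {f : MvPowerSeries σ ℂ} {M : ℝ}
    (hf : ∀ m, ‖coeff m f‖ ≤ M) (i : σ) (m : σ →₀ ℕ) : ‖coeff m (f * X i)‖ ≤ M := by
  classical
  rw [X, coeff_mul_monomial]
  split_ifs
  · rw [mul_one]
    exact hf _
  · rw [norm_zero]
    exact (norm_nonneg _).trans (hf 0)

theorem norm_coeff_mul_C_I_mul_X_le {σ : Type*} {f : MvPowerSeries σ ℂ} {M : ℝ}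
    (hf : ∀ m, ‖coeff m f‖ ≤ M) (i : σ) (m : σ →₀ ℕ) :
    ‖coeff m (f * (C Complex.I * X i))‖ ≤ M := by
  rw [mul_left_comm, coeff_C_mul, norm_mul, Complex.norm_I, one_mul]
  exact norm_coeff_mul_X_le hf i m

/-- The form has at most two terms, with coefficients of modulus one, so multiplication by it at
most doubles the largest coefficient. -/
theorem norm_coeff_mul_posForm_le (κ : ℕ) (j : Fin n) {f : MvPowerSeries (Coord n) ℂ} {M : ℝ}
    (hf : ∀ m, ‖coeff m f‖ ≤ M) (m : Coord n →₀ ℕ) : ‖coeff m (f * posForm κ j)‖ ≤ M * 2 := by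
  rw [posForm]
  split_ifs
  · rw [mul_sub, map_sub, mul_two]
    exact (norm_sub_le _ _).trans
      (add_le_add (norm_coeff_mul_X_le hf _ m) (norm_coeff_mul_C_I_mul_X_le hf _ m))
  · linarith [norm_coeff_mul_X_le hf (.inl j) m, (norm_nonneg _).trans (hf 0)]

theorem norm_coeff_mul_momForm_le (κ : ℕ) (j : Fin n) {f : MvPowerSeries (Coord n) ℂ} {M : ℝ}
    (hf : ∀ m, ‖coeff m f‖ ≤ M) (m : Coord n →₀ ℕ) : ‖coeff m (f * momForm κ j)‖ ≤ M * 2 := by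
  rw [momForm]
  split_ifs
  · rw [mul_add, map_add, mul_two]
    exact (norm_add_le _ _).trans
      (add_le_add (norm_coeff_mul_X_le hf _ m) (norm_coeff_mul_C_I_mul_X_le hf _ m))
  · linarith [norm_coeff_mul_X_le hf (.inr j) m, (norm_nonneg _).trans (hf 0)]

theorem norm_coeff_mul_pow_le {σ : Type*} {g : MvPowerSeries σ ℂ}
    (hg : ∀ (f : MvPowerSeries σ ℂ) (M : ℝ), (∀ m, ‖coeff m f‖ ≤ M) →
      ∀ m, ‖coeff m (f * g)‖ ≤ M * 2)
    {f : MvPowerSeries σ ℂ} {M : ℝ} (hf : ∀ m, ‖coeff m f‖ ≤ M) (k : ℕ) :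
    ∀ m, ‖coeff m (f * g ^ k)‖ ≤ M * 2 ^ k := by
  induction k with
  | zero => simpa using hf
  | succ k ih =>
    rw [pow_succ, pow_succ, ← mul_assoc, ← mul_assoc]
    exact hg _ _ ih

/-- The sum of the monomials `ξ_s^p η_t^q` and `η_s^p ξ_t^q` in the diagonalizing coordinates, up to
factors. -/
noncomputable def pairSeries (κ : ℕ) (s t : Fin n) (p q : ℕ) : MvPowerSeries (Coord n) ℂ :=
  posForm κ s ^ p * momForm κ t ^ q + momForm κ s ^ p * posForm κ t ^ q

theorem pairSeries_mem_ordGE (κ : ℕ) (s t : Fin n) (p q : ℕ) :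
    pairSeries κ s t p q ∈ ordGE (Coord n) ℂ (p + q) := by
  have h := fun {f : MvPowerSeries (Coord n) ℂ} (hf : f ∈ ordGE (Coord n) ℂ 1) (k : ℕ) =>
    (by simpa using pow_mem_ordGE hf k : f ^ k ∈ ordGE (Coord n) ℂ k)
  exact Ideal.add_mem _ (mul_mem_ordGE (h (posForm_mem_ordGE κ s) p) (h (momForm_mem_ordGE κ t) q))
    (mul_mem_ordGE (h (momForm_mem_ordGE κ s) p) (h (posForm_mem_ordGE κ t) q))

theorem norm_coeff_pairSeries_le (κ : ℕ) (s t : Fin n) (p q : ℕ) (m : Coord n →₀ ℕ) :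
    ‖coeff m (pairSeries κ s t p q)‖ ≤ 2 * 2 ^ (p + q) := by
  classical
  have h1 : ∀ m, ‖coeff m (1 : MvPowerSeries (Coord n) ℂ)‖ ≤ 1 := fun m => by
    rw [coeff_one]
    split_ifs <;> simp
  have hp := fun (j : Fin n) (f : MvPowerSeries (Coord n) ℂ) (M : ℝ)
    (hf : ∀ m, ‖coeff m f‖ ≤ M) => norm_coeff_mul_posForm_le κ j hf
  have hm := fun (j : Fin n) (f : MvPowerSeries (Coord n) ℂ) (M : ℝ)
    (hf : ∀ m, ‖coeff m f‖ ≤ M) => norm_coeff_mul_momForm_le κ j hf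
  have e1 := norm_coeff_mul_pow_le (hm t) (norm_coeff_mul_pow_le (hp s) h1 p) q m
  have e2 := norm_coeff_mul_pow_le (hp t) (norm_coeff_mul_pow_le (hm s) h1 p) q m
  rw [one_mul, one_mul, ← pow_add] at e1 e2
  rw [pairSeries, map_add, two_mul]
  exact (norm_add_le _ _).trans (add_le_add e1 e2)

/-- Conjugation exchanges the two forms of an elliptic plane and fixes those of a hyperbolic one. It
therefore swaps or fixes both summands together, provided that the planes have the same type. -/
theorem map_conj_pairSeries {κ : ℕ} {s t : Fin n} (hst : (s : ℕ) < κ ↔ (t : ℕ) < κ) (p q : ℕ) :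
    MvPowerSeries.map (starRingEnd ℂ) (pairSeries κ s t p q) = pairSeries κ s t p q := by
  have hI : MvPowerSeries.map (starRingEnd ℂ) (C Complex.I : MvPowerSeries (Coord n) ℂ)
      = -C Complex.I := by
    rw [map_C, Complex.conj_I, map_neg]
  have hp : ∀ j : Fin n, (j : ℕ) < κ →
      MvPowerSeries.map (starRingEnd ℂ) (posForm κ j) = momForm κ j := fun j hj => by
    rw [posForm, momForm, if_pos hj, if_pos hj, map_sub, map_mul, hI, map_X, map_X]
    ring
  have hm : ∀ j : Fin n, (j : ℕ) < κ →
      MvPowerSeries.map (starRingEnd ℂ) (momForm κ j) = posForm κ j := fun j hj => by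
    rw [posForm, momForm, if_pos hj, if_pos hj, map_add, map_mul, hI, map_X, map_X]
    ring
  by_cases hs : (s : ℕ) < κ
  · have ht := hst.mp hs
    rw [pairSeries, map_add, map_mul, map_mul, map_pow, map_pow, map_pow, map_pow, hp s hs, hm s hs,
      hp t ht, hm t ht, add_comm]
  · have ht := fun h => hs (hst.mpr h)
    simp only [pairSeries, posForm, momForm, if_neg hs, if_neg ht, map_add, map_mul, map_pow, map_X]

/-- The real series with complexification `pairSeries`. -/
noncomputable def realPair (κ : ℕ) (s t : Fin n) (p q : ℕ) : MvPowerSeries (Coord n) ℝ :=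
  fun m => (coeff m (pairSeries κ s t p q)).re

theorem coeff_realPair (κ : ℕ) (s t : Fin n) (p q : ℕ) (m : Coord n →₀ ℕ) :
    coeff m (realPair κ s t p q) = (coeff m (pairSeries κ s t p q)).re := rfl

theorem realPair_mem_ordGE (κ : ℕ) (s t : Fin n) (p q : ℕ) :
    realPair κ s t p q ∈ ordGE (Coord n) ℝ (p + q) := by
  rw [mem_ordGE]
  intro m hm
  rw [coeff_realPair, mem_ordGE.mp (pairSeries_mem_ordGE κ s t p q) m hm, Complex.zero_re]

theorem complexify_realPair {κ : ℕ} {s t : Fin n} (hst : (s : ℕ) < κ ↔ (t : ℕ) < κ) (p q : ℕ) :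
    complexify (realPair κ s t p q) = pairSeries κ s t p q := by
  ext m
  rw [complexify, coeff_map, coeff_realPair]
  refine Complex.conj_eq_iff_re.mp ?_
  have := congrArg (coeff m) (map_conj_pairSeries hst p q)
  rwa [coeff_map] at this

theorem abs_coeff_realPair_le (κ : ℕ) (s t : Fin n) (p q : ℕ) (m : Coord n →₀ ℕ) :
    |coeff m (realPair κ s t p q)| ≤ 2 * 2 ^ m.degree := by
  rcases lt_or_ge m.degree (p + q) with h | h
  · rw [mem_ordGE.mp (realPair_mem_ordGE κ s t p q) m h, abs_zero]
    positivity
  · rw [coeff_realPair]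
    refine (Complex.abs_re_le_norm _).trans ((norm_coeff_pairSeries_le κ s t p q m).trans ?_)
    -- Only degrees at least p + q matter, so the bound becomes geometric in the degree,
    -- independently of p and q.
    exact mul_le_mul_of_nonneg_left (pow_le_pow_right₀ one_le_two h) zero_le_two

theorem exists_diagonalize_pairSeries (κ : ℕ) (s t : Fin n) (p q : ℕ) :
    ∃ a b : ℂ, 1 ≤ ‖a * b‖ ∧ diagonalize n κ (pairSeries κ s t p q)
      = a • crossMonomial ℂ s t p q + b • crossMonomial ℂ t s q p := by
  set α : Fin n → ℂ := fun j => if (j : ℕ) < κ then 2 else 1 with hα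
  set β : Fin n → ℂ := fun j => if (j : ℕ) < κ then Complex.I else 1 with hβ
  have nα : ∀ j, 1 ≤ ‖α j‖ := fun j => by
    simp only [hα]
    split_ifs <;> simp
  have nβ : ∀ j, 1 ≤ ‖β j‖ := fun j => by
    simp only [hβ]
    split_ifs <;> simp
  refine ⟨α s ^ p * β t ^ q, α t ^ q * β s ^ p, ?_, ?_⟩
  · simp only [norm_mul, norm_pow]
    exact one_le_mul_of_one_le_of_one_le
      (one_le_mul_of_one_le_of_one_le (one_le_pow₀ (nα s)) (one_le_pow₀ (nβ t)))
      (one_le_mul_of_one_le_of_one_le (one_le_pow₀ (nα t)) (one_le_pow₀ (nβ s)))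
  · rw [pairSeries, map_add, map_mul, map_mul, map_pow, map_pow, map_pow, map_pow,
      diagonalize_posForm, diagonalize_posForm, diagonalize_momForm, diagonalize_momForm,
      smul_pow, smul_pow, smul_pow, smul_pow, smul_mul_smul_comm, smul_mul_smul_comm,
      crossMonomial, crossMonomial]
    congr 1
    rw [mul_comm (α t ^ q), mul_comm (X (Sum.inr s) ^ p)]

end PairSeries

/-! ### Choosing the exponents and summing the perturbations -/

section Assembly

variable {n : ℕ}

/-- A sum of series of increasing orders. -/
theorem exists_sum_of_ordGE {σ : Type*} (G : ℕ → MvPowerSeries σ ℝ) {d : ℕ → ℕ}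
    (hd : StrictMono d) (hG : ∀ i, G i ∈ ordGE σ ℝ (d i)) :
    ∃ H : MvPowerSeries σ ℝ, (∀ k, H - ∑ i ∈ Finset.range k, G i ∈ ordGE σ ℝ (d k)) ∧
      ∀ m, coeff m H = ∑ i ∈ Finset.range (m.degree + 1), coeff m (G i) := by
  let H : MvPowerSeries σ ℝ := fun m => ∑ i ∈ Finset.range (m.degree + 1), coeff m (G i)
  have hH : ∀ m, coeff m H = ∑ i ∈ Finset.range (m.degree + 1), coeff m (G i) := fun _ => rfl
  refine ⟨H, fun k => ?_, hH⟩
  rw [mem_ordGE]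
  intro m hm
  have hz : ∀ i, m.degree < d i → coeff m (G i) = 0 := fun i hi => mem_ordGE.mp (hG i) m hi
  rw [map_sub, map_sum, hH, sub_eq_zero]
  rcases le_total (m.degree + 1) k with h | h
  · refine Finset.sum_subset (Finset.range_mono h) fun i _ hi => hz i ?_
    rw [Finset.mem_range, not_lt] at hi
    exact (Nat.lt_of_succ_le hi).trans_le (hd.le_apply)
  · refine (Finset.sum_subset (Finset.range_mono h) fun i _ hi => hz i ?_).symm
    rw [Finset.mem_range, not_lt] at hi
    exact hm.trans_le (hd.monotone hi)

/-- Adding a suitable small multiple of `realPair` produces a large coefficient in the normal form,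
whatever terms of higher order are added. -/
theorem exists_large_coeff {κ : ℕ} {t : Fin n → ℝ} {i j : Fin n} (hij : i ≠ j)
    (hκ : (i : ℕ) < κ ↔ (j : ℕ) < κ) {p q : ℕ} (hp : 1 ≤ p) (hpq : 3 ≤ p + q)
    (hδ : diagSpectrum κ t j * q - diagSpectrum κ t i * p ≠ 0)
    {G : MvPowerSeries (Coord n) ℝ} (hG : G ∈ ordGE (Coord n) ℝ 3) :
    ∃ c : ℝ, |c| ≤ 1 ∧ ∀ R ∈ ordGE (Coord n) ℝ (2 * (p + q) - 1),
      ∃ (e : MvPowerSeries (Coord n) ℂ ≃ₐ[ℂ] MvPowerSeries (Coord n) ℂ)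
        (F : MvPowerSeries (Coord n) ℂ), IsSymplecticAut e ∧
        e (diagonalize n κ (complexify (quadSeries κ t + (G + c • realPair κ i j p q + R)))) = F ∧
        pb (diagQuad (diagSpectrum κ t)) F = 0 ∧
        F - diagQuad (diagSpectrum κ t) ∈ ordGE (Coord n) ℂ 3 ∧
        1 / (2 * ‖diagSpectrum κ t j * q - diagSpectrum κ t i * p‖)
          ≤ ‖coeff (actExp (Finsupp.single i (p - 1) + Finsupp.single j q)) F‖ := by
  have hT := isSymplecticAut_diagonalize (n := n) κ
  obtain ⟨a, b, hab, hP⟩ := exists_diagonalize_pairSeries κ i j p q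
  have hH : diagonalize n κ (complexify (quadSeries κ t + G)) - diagQuad (diagSpectrum κ t)
      ∈ ordGE (Coord n) ℂ 3 := by
    rw [← diagonalize_quadSeries, ← map_sub, ← map_sub, add_sub_cancel_left]
    exact hT.map_mem _ _ (map_mem_ordGE _ hG)
  obtain ⟨c, hc, hR⟩ := exists_large_normalForm hH hij hp hpq a b hδ
  refine ⟨c, by rcases hc with h | h | h <;> simp [h], fun R hRm => ?_⟩
  obtain ⟨e, F, he, heF, h1, h2, h3⟩ := hR (diagonalize n κ (complexify R))
    (hT.map_mem _ _ (map_mem_ordGE _ hRm))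
  refine ⟨e, F, he, ?_, h1, h2, le_trans ?_ h3⟩
  · rw [← heF, ← hP, ← complexify_realPair hκ, ← map_smul, ← complexify_smul, ← map_add, ← map_add,
      ← map_add, ← map_add]
    congr 3
    ring
  · exact div_le_div_of_nonneg_right hab (by positivity)

/-- For neighbouring powers of x in planes of the same type, the divisor is a unit times x^i (q x -
p). -/
theorem norm_diagSpectrum_sub {κ : ℕ} {x : ℝ} {i j : Fin n} (hij : (j : ℕ) = i + 1)
    (hκ : (i : ℕ) < κ ↔ (j : ℕ) < κ) (h0 : 0 < x) (h1 : x < 1) (p q : ℕ) :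
    ‖diagSpectrum κ (fun l : Fin n => x ^ (l : ℕ)) j * q
      - diagSpectrum κ (fun l : Fin n => x ^ (l : ℕ)) i * p‖ ≤ |(q : ℝ) * x - p| := by
  have key : ∀ u : ℂ, ‖u‖ = 1 → ‖u * ((x ^ (i : ℕ) * ((q : ℝ) * x - p) : ℝ) : ℂ)‖
      ≤ |(q : ℝ) * x - p| := fun u hu => by
    rw [norm_mul, hu, one_mul, Complex.norm_real, norm_mul, Real.norm_eq_abs, Real.norm_eq_abs,
      abs_of_pos (pow_pos h0 _)]
    exact mul_le_of_le_one_left (abs_nonneg _) (pow_le_one₀ h0.le h1.le)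
  rw [diagSpectrum, diagSpectrum]
  by_cases hi : (i : ℕ) < κ
  · rw [if_pos hi, if_pos (hκ.mp hi)]
    convert key (-Complex.I) (by simp) using 2
    rw [hij]
    push_cast
    ring
  · rw [if_neg hi, if_neg fun h => hi (hκ.mpr h)]
    convert key 1 (by simp) using 2
    rw [hij]
    push_cast
    ring

/-- Exponents of rapidly increasing degree with very small divisors. -/
theorem exists_sparse_exponents {x : ℝ} (hx : ∀ N : ℕ, ∃ p q : ℕ, N ≤ p ∧ 1 ≤ q ∧
      |(q : ℝ) * x - p| < 1 / ((p + q : ℕ) : ℝ) ^ (p + q)) :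
    ∃ p q : ℕ → ℕ, (∀ k, 3 ≤ p k) ∧ (∀ k, 1 ≤ q k) ∧
      (∀ k, |(q k : ℝ) * x - p k| < 1 / ((p k + q k : ℕ) : ℝ) ^ (p k + q k)) ∧
      ∀ k, 2 * (p k + q k) ≤ p (k + 1) + q (k + 1) := by
  choose P Q hP hQ hPQ using hx
  -- Each lower bound for p is twice the previous degree p + q, which forces the degrees to double.
  let N : ℕ → ℕ := fun k => Nat.rec 3 (fun _ N => 2 * (P N + Q N)) k
  have hN : ∀ k, N (k + 1) = 2 * (P (N k) + Q (N k)) := fun _ => rfl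
  have h3 : ∀ k, 3 ≤ N k := fun k => by
    induction k with
    | zero => exact le_rfl
    | succ k ih =>
      have := hP (N k)
      rw [hN]
      omega
  refine ⟨fun k => P (N k), fun k => Q (N k), fun k => (h3 k).trans (hP _), fun k => hQ _,
    fun k => hPQ _, fun k => ?_⟩
  have := hP (N (k + 1))
  have := hN k
  simp only
  omega

/-- Coefficients that grow faster than geometrically along a sequence of degrees. -/
theorem not_isConvergent_of_large {σ : Type*} [Fintype σ] {F : MvPowerSeries σ ℝ} {d : ℕ → ℕ}
    (hd : StrictMono d) (hd1 : ∀ k, 1 ≤ d k)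
    (h : ∀ k, ∃ m : σ →₀ ℕ, m.degree = 2 * (d k - 1) ∧
      (d k : ℝ) ^ d k / 2 ≤ 2 ^ (d k - 1) * |coeff m F|) : ¬ IsConvergent F := by
  intro hF
  obtain ⟨C, r, hr, hC⟩ := hF.exists_bound
  -- With d = d k this gives d r²/2 ≥ 2 and C r² ≤ d. The two bounds on the coefficient then combine
  -- to 2^d ≤ (d r²/2)^d ≤ C r² ≤ d, which is absurd.
  obtain ⟨k, hk⟩ := exists_nat_ge (max (4 / r ^ 2) (C * r ^ 2))
  obtain ⟨m, hm, hmF⟩ := h k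
  have hkd : (k : ℝ) ≤ d k := by exact_mod_cast hd.le_apply
  have e1 : 2 ≤ (d k : ℝ) * (r ^ 2 / 2) := by
    have := (le_max_left _ _).trans (hk.trans hkd)
    rw [div_le_iff₀ (by positivity)] at this
    linarith
  have e2 : C * r ^ 2 ≤ d k := (le_max_right _ _).trans (hk.trans hkd)
  have hCm := hC m
  rw [hm] at hCm
  obtain ⟨D, hD⟩ : ∃ D, d k = D + 1 := ⟨d k - 1, (Nat.sub_add_cancel (hd1 k)).symm⟩
  have e3 : ((d k : ℝ) * (r ^ 2 / 2)) ^ d k ≤ C * r ^ 2 := by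
    rw [hD] at hmF hCm ⊢
    rw [Nat.add_sub_cancel] at hmF hCm
    have f1 : (((D + 1 : ℕ) : ℝ) * (r ^ 2 / 2)) ^ (D + 1)
        = ((D + 1 : ℕ) : ℝ) ^ (D + 1) / 2 * (r ^ (2 * D) * r ^ 2 / 2 ^ D) := by
      rw [mul_pow, div_pow, pow_succ (r ^ 2), pow_succ (2 : ℝ), pow_mul]
      field_simp
    rw [f1]
    calc _ ≤ 2 ^ D * |coeff m F| * (r ^ (2 * D) * r ^ 2 / 2 ^ D) :=
          mul_le_mul_of_nonneg_right hmF (by positivity)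
      _ = |coeff m F| * r ^ (2 * D) * r ^ 2 := by field_simp
      _ ≤ _ := mul_le_mul_of_nonneg_right hCm (by positivity)
  have e4 : (2 : ℝ) ^ d k ≤ d k := (pow_le_pow_left₀ zero_le_two e1 _).trans (e3.trans e2)
  have e5 : d k < 2 ^ d k := Nat.lt_two_pow_self
  exact absurd e4 (not_le.mpr (by exact_mod_cast e5))

/-- Two consecutive planes of the same type. -/
theorem exists_consecutive {κ : ℕ} (hn : 2 ≤ n) (hexc : ¬ (n = 2 ∧ κ = 1)) :
    ∃ i j : Fin n, (j : ℕ) = i + 1 ∧ ((i : ℕ) < κ ↔ (j : ℕ) < κ) := by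
  by_cases h : 2 ≤ κ
  · exact ⟨⟨0, by omega⟩, ⟨1, by omega⟩, rfl, by simp; omega⟩
  -- If κ ≤ 1, the last two planes are hyperbolic, except when n = 2 and κ = 1.
  · exact ⟨⟨n - 2, by omega⟩, ⟨n - 1, by omega⟩, by simp; omega, by simp; omega⟩

end Assembly

/-- The perturbation: a sum of small multiples of `realPair` such that every stage produces a large
coefficient in the normal form. -/
theorem exists_divergent_perturbation {n κ : ℕ} {t : Fin n → ℝ} {i j : Fin n} (hij : i ≠ j)
    (hκ : (i : ℕ) < κ ↔ (j : ℕ) < κ) {p q : ℕ → ℕ} (hp : ∀ k, 3 ≤ p k)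
    (hsparse : ∀ k, 2 * (p k + q k) ≤ p (k + 1) + q (k + 1))
    (hδ : ∀ k, diagSpectrum κ t j * q k - diagSpectrum κ t i * p k ≠ 0) :
    ∃ G : MvPowerSeries (Coord n) ℝ, G ∈ ordGE (Coord n) ℝ 3 ∧
      (∀ m, |coeff m G| ≤ 2 * 4 ^ m.degree) ∧
      ∀ k, ∃ (e : MvPowerSeries (Coord n) ℂ ≃ₐ[ℂ] MvPowerSeries (Coord n) ℂ)
        (F : MvPowerSeries (Coord n) ℂ), IsSymplecticAut e ∧
        e (diagonalize n κ (complexify (quadSeries κ t + G))) = F ∧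
        pb (diagQuad (diagSpectrum κ t)) F = 0 ∧
        F - diagQuad (diagSpectrum κ t) ∈ ordGE (Coord n) ℂ 3 ∧
        1 / (2 * ‖diagSpectrum κ t j * q k - diagSpectrum κ t i * p k‖)
          ≤ ‖coeff (actExp (Finsupp.single i (p k - 1) + Finsupp.single j (q k))) F‖ := by
  have hd : StrictMono fun k => p k + q k := strictMono_nat_of_lt_succ fun k => by
    have := hp k
    have := hsparse k
    omega
  have hd3 : ∀ k, 3 ≤ p k + q k := fun k => (hp k).trans (Nat.le_add_right _ _)
  have step : ∀ (k : ℕ) (G : MvPowerSeries (Coord n) ℝ), G ∈ ordGE (Coord n) ℝ 3 → _ :=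
    fun k G hG => exists_large_coeff (t := t) hij hκ ((by norm_num : 1 ≤ 3).trans (hp k)) (hd3 k)
      (hδ k) hG
  -- The constant is a function of the stage and of the partial sum reached so far.
  choose! c hc1 hc using step
  let P : ℕ → MvPowerSeries (Coord n) ℝ := fun k => realPair κ i j (p k) (q k)
  let S : ℕ → MvPowerSeries (Coord n) ℝ := fun k => Nat.rec 0 (fun k G => G + c k G • P k) k
  have hS : ∀ k, S (k + 1) = S k + c k (S k) • P k := fun _ => rfl
  have hSsum : ∀ k, S k = ∑ l ∈ Finset.range k, c l (S l) • P l := fun k => by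
    induction k with
    | zero => rfl
    | succ k ih => rw [hS, Finset.sum_range_succ, ← ih]
  have hP : ∀ k, c k (S k) • P k ∈ ordGE (Coord n) ℝ (p k + q k) := fun k =>
    smul_mem_ordGE (realPair_mem_ordGE κ i j (p k) (q k)) _
  have hS3 : ∀ k, S k ∈ ordGE (Coord n) ℝ 3 := fun k => by
    rw [hSsum]
    exact Ideal.sum_mem _ fun l _ => ordGE_anti (hd3 l) (hP l)
  obtain ⟨G, hG, hGc⟩ := exists_sum_of_ordGE (fun k => c k (S k) • P k) hd hP
  simp only [← hSsum] at hG
  refine ⟨G, ?_, fun m => ?_, fun k => ?_⟩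
  · have := hG 0
    rw [hSsum, Finset.sum_range_zero, sub_zero] at this
    exact ordGE_anti (hd3 0) this
  · rw [hGc]
    calc |∑ l ∈ Finset.range (m.degree + 1), coeff m (c l (S l) • P l)|
        ≤ ∑ _l ∈ Finset.range (m.degree + 1), 2 * (2 : ℝ) ^ m.degree := by
          refine (Finset.abs_sum_le_sum_abs _ _).trans (Finset.sum_le_sum fun l _ => ?_)
          rw [coeff_smul, abs_mul]
          exact (mul_le_of_le_one_left (abs_nonneg _) (hc1 l (S l) (hS3 l))).trans
            (abs_coeff_realPair_le κ i j (p l) (q l) m)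
      _ = 2 * ((m.degree + 1 : ℕ) * (2 : ℝ) ^ m.degree) := by
          rw [Finset.sum_const, Finset.card_range, nsmul_eq_mul]
          ring
      -- The number of stages that can reach degree m is absorbed through m + 1 ≤ 2^m.
      _ ≤ 2 * ((2 : ℝ) ^ m.degree * (2 : ℝ) ^ m.degree) := by
          have : m.degree + 1 ≤ 2 ^ m.degree := Nat.lt_two_pow_self
          gcongr
          exact_mod_cast this
      _ = 2 * 4 ^ m.degree := by
          rw [← mul_pow]
          norm_num
  -- All later stages together form the remainder R, of order at least twice the current degree.
  · obtain ⟨e, F, he, heF, h⟩ := hc k (S k) (hS3 k) (G - S (k + 1))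
      (ordGE_anti (by have := hsparse k; omega) (hG (k + 1)))
    refine ⟨e, F, he, ?_, h⟩
    rw [← heF, ← hS, add_sub_cancel]

end Birkhoff

/-! ### The main theorem -/

open Birkhoff

theorem theorem1 (n κ : ℕ) (hn : 2 ≤ n) (hκ : κ ≤ n) (hexc : ¬ (n = 2 ∧ κ = 1)) :
    ∃ (lam : Fin n → ℂ) (h : (Birkhoff.Coord n → ℝ) → ℝ)
      (H : MvPowerSeries (Birkhoff.Coord n) ℝ),
      Birkhoff.IsSpectrum κ lam ∧
      Birkhoff.NonResonant lam ∧
      AnalyticAt ℝ h 0 ∧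
      ((fun z => h z - Birkhoff.quadraticPart κ lam z) =O[𝓝 0] fun z => ‖z‖ ^ 3) ∧
      Birkhoff.HasExpansion h H ∧
      (∃ F, Birkhoff.IsBirkhoffNormalFormOf κ lam F H) ∧
      ∀ F, Birkhoff.IsBirkhoffNormalFormOf κ lam F H → ¬ Birkhoff.IsConvergent F := by
  obtain ⟨x, hx0, hx1, hxT, hx⟩ := exists_transcendental_approximable
  obtain ⟨i, j, hij, hijκ⟩ := exists_consecutive (κ := κ) hn hexc
  have hne : i ≠ j := fun h => by
    rw [h] at hij
    omega
  obtain ⟨p, q, hp, hq, hpq, hsparse⟩ := exists_sparse_exponents hx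
  set t : Fin n → ℝ := fun l => x ^ (l : ℕ) with ht
  have htinj : Function.Injective t := fun a b hab =>
    Fin.ext (pow_right_injective₀ hx0 hx1.ne hab)
  have hindep := fun α hα => sum_pow_mul_ne_zero (n := n) hxT α hα
  have hμ : IntIndep (diagSpectrum κ t) := intIndep_diagSpectrum hindep κ
  -- The divisor is the value of the frequency form at the nonzero integer vector q e_j - p e_i.
  have hδ : ∀ k, diagSpectrum κ t j * q k - diagSpectrum κ t i * p k ≠ 0 := fun k h => by
    classical
    refine hμ (Pi.single j (q k : ℤ) - Pi.single i (p k : ℤ)) (fun h0 => ?_) ?_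
    · have := congrFun h0 j
      simp [hne.symm] at this
      have := hq k
      omega
    · rw [← h]
      simp [mul_sub, Finset.sum_sub_distrib, Pi.single_apply]
  obtain ⟨G, hG3, hGb, hGk⟩ := exists_divergent_perturbation hne hijκ hp hsparse hδ
  obtain ⟨g, hga, hgO, hgG⟩ := exists_analyticAt_hasExpansion (by norm_num : (0 : ℝ) < 4) hGb hG3
  refine ⟨spectrumOf κ t, fun z => quadraticPart κ (spectrumOf κ t) z + g z, quadSeries κ t + G,
    isSpectrum_spectrumOf (fun l => (pow_pos hx0 _).ne') κ, nonResonant_spectrumOf hindep κ,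
    (analyticAt_quadraticPart htinj).add hga, ?_, ?_, ?_, fun F hF => ?_⟩
  · simpa using hgO
  · filter_upwards [hgG] with z hz
    exact hasSum_term_add (hasSum_term_quadSeries htinj z) hz
  · exact exists_birkhoffNormalForm htinj hμ (by rwa [add_sub_cancel_left])
  · have hd : StrictMono fun k => p k + q k := strictMono_nat_of_lt_succ fun k => by
      have := hp k
      have := hsparse k
      omega
    refine not_isConvergent_of_large hd
      (fun k => ((by norm_num : 1 ≤ 3).trans (hp k)).trans (Nat.le_add_right _ _)) fun k => ?_
    obtain ⟨e, F₁, he, heF, h1, h2, h3⟩ := hGk k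
    obtain ⟨m, hm, hmF⟩ := exists_coeff_ge htinj hμ hF he heF h1 h2
      (Finsupp.single i (p k - 1) + Finsupp.single j (q k))
    have hdeg : (Finsupp.single i (p k - 1) + Finsupp.single j (q k)).degree = p k + q k - 1 := by
      have := hp k
      rw [map_add, Finsupp.degree_single, Finsupp.degree_single]
      omega
    rw [hdeg] at hm hmF
    refine ⟨m, hm, le_trans ?_ (h3.trans hmF)⟩
    -- With d = p + q the divisor is at most d^(-d), so the large coefficient is at least d^d / 2.
    have hsmall := (norm_diagSpectrum_sub hij hijκ hx0 hx1 (p k) (q k)).trans (hpq k).le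
    have hpos := norm_pos_iff.mpr (hδ k)
    have hpow : (0 : ℝ) < ((p k + q k : ℕ) : ℝ) ^ (p k + q k) := by
      have := hp k
      have : 0 < p k + q k := by omega
      positivity
    rw [le_div_iff₀ hpow] at hsmall
    rw [div_le_div_iff₀ two_pos (by positivity)]
    linarith
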